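/- **Setting.** Let $\gamma>1/3$. For functions on $[0,1]$ and $[0,1]^2$ put $\|X\|_\gamma=\sup_{\xi\ne\eta}|X_\xi-X_\eta|/|\xi-\eta|^{\gamma}$ and $\|R\|_{2\gamma}=\sup_{\xi\neq\eta}|R_{\xi\eta}|/|\xi-\eta|^{2\gamma}$. A $\gamma$-rough path is a pair $\mathbb X=(X,\mathbb X^2)$, where $X:[0,1]\to\mathbb R^3$ is continuous, $X_0=X_1$, $\|X\|_\gamma<\infty$, and $\mathbb X^2:[0,1]^2\to\mathbb R^3\otimes\mathbb R^3$ is continuous with $\|\mathbb X^2\|_{2\gamma}<\infty$, $\mathbb X^2_{\xi\xi}=0$ and $$\mathbb X^{2,ij}_{\xi\rho}-\mathbb X^{2,ij}_{\xi\eta}-\mathbb X^{2,ij}_{\eta\rho}=(X^i_\xi-X^i_\eta)(X^j_\eta-X^j_\rho)\qquad(\xi,\eta,\rho\in[0,1]).$$ Let $\Sigma^\gamma$ be the set of $\gamma$-rough paths with $d(\mathbb X,\widetilde{\mathbb X})=\|X-\widetilde X\|_\gamma+\|\mathbb X^2-\widetilde{\mathbb X}^2\|_{2\gamma}$, and let $\mathscr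 B(\Sigma^\gamma;r)=\{\mathbb X: d(\mathbb X,(0,0))<r\}$, $r>0$. For curves in $\Sigma^\gamma$ the uniform distance on $[0,T]$ is $\sup_{t\in[0,T]}d(\mathbb Y(t),\widetilde{\mathbb Y}(t))$. A path weakly controlled by $X$ is a pair $(Y,Y')$, $Y:[0,1]\to\mathbb R^3$, $Y_0=Y_1$, $Y':[0,1]\to\mathbb R^3\otimes\mathbb R^3$, such that, with $R_{\eta\xi}=Y_\xi-Y_\eta-Y'_\eta(X_\xi-X_\eta)$, the norm $\|Y\|_D^*=\|Y\|_D+\|Y\|_\infty$, where $\|Y\|_D=\|Y'\|_\gamma+\|R\|_{2\gamma}+\|Y'\|_\infty$, is finite; $\mathscr D_X$ is the space of these pairs. For a controlled integrand $(F,F')$ and $(Z,Z')\in\mathscr D_X$ the rough integral $\int_a^bF\,dZ$ is the limit, as the mesh of the partitions $a=\xi_0,\xi_1,\dots,\xi_n=b$ (monotone from $a$ to $b$) tends to $0$, of $\sum_{m}\big[F_{\xi_m}(Z_{\xi_{m+1}}-Z_{\xi_m})+F'_{\xi_m}Z'_{\xi_m}\mathbb X^2_{\xi_m\xi_{m+1}}\big]$,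 where $F'Z'\mathbb X^2=\sum_{k,l}F'(e_k)(Z'e_l)\,\mathbb X^{2,kl}$. Let $A:\mathbb R^3\to\mathbb R^3\otimes\mathbb R^3$ be of class $C^5$ with $\|\nabla A\|_4<\infty$, where $\|\nabla A\|_n=\sum_{k=0}^n\sup_x|\nabla^{k+1}A(x)|$. For $(Y,Y')\in\mathscr D_X$ let $V^Y(x)=\int_0^1A(x-Y_\eta)\,dY_\eta$ (rough integral, the integrand having derivative $-\nabla A(x-Y_\eta)Y'_\eta$). A solution on $[0,T]$ started at $\mathbb X$ is $(Y,Y')\in C([0,T],\mathscr D_X)$ with $$Y(t)_\xi=X_\xi+\int_0^tV^{Y(s)}(Y(s)_\xi)\,ds,\qquad Y'(t)_\xi=\mathrm{Id}+\int_0^t\nabla V^{Y(s)}(Y(s)_\xi)\,Y'(s)_\xi\,ds .$$ Call $T>0$ an existence time with bound $B$ for $(A,r)$ if every $\mathbb X\in\mathscr B(\Sigma^\gamma;r)$ has a solution on $[0,T]$ with $\sup_{t\le T}\|Y(t)\|_D\le B$. **Theorem.** 1. For all $r>0$, $M\ge 0$ there are $T_0>0$ and $B$, depending only on $\gamma,r,M$,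 such that $T_0$ is an existence time with bound $B$ for $(A,r)$ whenever $\|\nabla A\|_3\le M$ (and $\|\nabla A\|_4<\infty$). 2. Let $T$ be an existence time with bound $B$ for $(A,r)$ (for instance $T=T_0$). Then each $\mathbb X\in\mathscr B(\Sigma^\gamma;r)$ has exactly one solution $(Y,Y')$ on $[0,T]$; the rough integrals $\mathbb Y^{2,ij}(t)_{\rho\xi}=\int_\rho^\xi(Y(t)^i_\eta-Y(t)^i_\rho)\,dY(t)^j_\eta$ exist, and $\Gamma(\mathbb X):=(Y,\mathbb Y^2)$ belongs to $C([0,T],\Sigma^\gamma)$. The map $\Gamma:\mathscr B(\Sigma^\gamma;r)\to C([0,T],\Sigma^\gamma)$ is Lipschitz for the uniform distance: there is $L$, depending only on $\gamma,r,T,B$ and a bound for $\|\nabla A\|_4$, with $$\sup_{t\in[0,T]}d\big(\Gamma(\mathbb X)(t),\Gamma(\widetilde{\mathbb X})(t)\big)\le L\,d(\mathbb X,\widetilde{\mathbb X})\qquad\text{for all }\mathbb X,\widetilde{\mathbb X}\in\mathscr B(\Sigma^\gamma;r).$$ 3. With $T$ as in 2: call $\mathbb X\in\Sigma^\gamma$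 the geometric lift of the loop $X$ if $X$ is $C^1$ on $[0,1]$ and $\mathbb X^{2,ij}_{\xi\eta}=\int_\xi^\eta(X_\rho-X_\xi)^i\,dX^j_\rho$. A classical solution on $[0,T]$ is a family of closed curves $y(t)$, with $y$ and $\partial_\xi y$ jointly continuous, such that $\partial_ty(t)_\xi=\int_0^1A(y(t)_\xi-y(t)_\eta)\,\partial_\eta y(t)_\eta\,d\eta$. If $\mathbb X\in\mathscr B(\Sigma^\gamma;r)$ is the geometric lift of a $C^1$ loop $X$, then the first component of $\Gamma(\mathbb X)$ is the unique classical solution on $[0,T]$ with $y(0)=X$, and $\Gamma(\mathbb X)(t)$ is its geometric lift for every $t$. If $\mathbb X\in\mathscr B(\Sigma^\gamma;r)$ and $\mathbb X^{(n)}$ are geometric lifts of $C^1$ loops with $d(\mathbb X^{(n)},\mathbb X)\to0$, then (for large $n$) the geometric lifts of the classical solutions on $[0,T]$ started at $X^{(n)}$ converge to $\Gamma(\mathbb X)$ in the uniform distance on $[0,T]$. -/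

import Mathlib

open Set Filter Topology MeasureTheory
open scoped NNReal ENNReal

noncomputable section

namespace VortexFilament

/-- Euclidean three-space. -/
abbrev Vec : Type := EuclideanSpace ℝ (Fin 3)

/-- Canonical basis vectors of three-space. -/
def stdVec (k : Fin 3) : Vec := EuclideanSpace.single k 1

/-- The parameter interval `[0,1]`. -/
abbrev Param : Type := unitInterval

/-! ### Hölder seminorms, rough paths and their distance -/

/-- `sup_{ξ,η ∈ [0,1]} N ξ η / |ξ-η|^α` in `[0,∞]` (with `0 / 0 = 0` and `c / 0 = ∞` for `c > 0`);
`N ξ η` is the size of an increment or of a two-parameter function. -/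
def holderSup (α : ℝ) (N : Param → Param → ℝ) : ℝ≥0∞ :=
  ⨆ ξ : Param, ⨆ η : Param, ENNReal.ofReal (N ξ η) / ENNReal.ofReal (dist ξ η ^ α)

/-- The Hölder seminorm `‖X‖_γ` of a function on `[0,1]`. -/
def holderSeminorm {F : Type*} [NormedAddCommGroup F] (γ : ℝ) (X : Param → F) : ℝ≥0∞ :=
  holderSup γ (fun ξ η => ‖X ξ - X η‖)

/-- The norm of a `3 × 3` matrix: the sum of the absolute values of its entries. -/
def matNorm (M : Matrix (Fin 3) (Fin 3) ℝ) : ℝ := ∑ i, ∑ j, |M i j|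

/-- A `γ`-rough path over a closed curve in three-space. -/
@[ext]
structure RoughPath (γ : ℝ) where
  path : Param → Vec
  area : Param → Param → Matrix (Fin 3) (Fin 3) ℝ
  path_continuous : Continuous path
  path_closed : path 0 = path 1
  path_holder : holderSeminorm γ path < ⊤
  area_continuous : Continuous (fun p : Param × Param => area p.1 p.2)
  area_compat : ∀ (ξ η ρ : Param) (i j : Fin 3),
    area ξ ρ i j - area ξ η i j - area η ρ i j
      = (path ξ i - path η i) * (path η j - path ρ j)
  area_holder : holderSup (2 * γ) (fun ξ η => matNorm (area ξ η)) < ⊤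

/-- The trivial rough path `(0,0)`. -/
def RoughPath.trivial (γ : ℝ) : RoughPath γ where
  path := fun _ => 0
  area := fun _ _ => 0
  path_continuous := continuous_const
  path_closed := rfl
  path_holder := by simp [holderSeminorm, holderSup]
  area_continuous := continuous_const
  area_compat := by simp
  area_holder := by simp [holderSup, matNorm]

/-- The distance `d(𝕏,𝕏̃) = ‖X - X̃‖_γ + ‖𝕏² - 𝕏̃²‖_{2γ}`. -/
def roughDist {γ : ℝ} (X Z : RoughPath γ) : ℝ≥0∞ :=
  holderSeminorm γ (fun ξ => X.path ξ - Z.path ξ)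
    + holderSup (2 * γ) (fun ξ η => matNorm (X.area ξ η - Z.area ξ η))

/-- The open ball of radius `r` centred at the trivial rough path. -/
def roughBall (γ r : ℝ) : Set (RoughPath γ) :=
  {X | roughDist X (RoughPath.trivial γ) < ENNReal.ofReal r}

/-- Continuity on `[0,T]` of a curve of rough paths. -/
def IsContinuousCurve {γ : ℝ} (T : ℝ) (Y : ℝ → RoughPath γ) : Prop :=
  ∀ t ∈ Icc 0 T, Tendsto (fun s => roughDist (Y s) (Y t)) (𝓝[Icc 0 T] t) (𝓝 0)

/-- The uniform distance on `[0,T]` between two curves of rough paths. -/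
def uniformDist {γ : ℝ} (T : ℝ) (Y Z : ℝ → RoughPath γ) : ℝ≥0∞ :=
  ⨆ t ∈ Icc 0 T, roughDist (Y t) (Z t)

/-! ### Weakly controlled paths -/

/-- The remainder `R_{ηξ} = Y_ξ - Y_η - Y'_η (X_ξ - X_η)`. -/
def remainder (X Y : Param → Vec) (Y' : Param → Vec →L[ℝ] Vec) (η ξ : Param) : Vec :=
  Y ξ - Y η - Y' η (X ξ - X η)

/-- The norm `‖Y‖_D = ‖Y'‖_γ + ‖R‖_{2γ} + ‖Y'‖_∞` of a pair `(Y, Y')` relative to `X`. -/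
def ctrlNorm (γ : ℝ) (X Y : Param → Vec) (Y' : Param → Vec →L[ℝ] Vec) : ℝ≥0∞ :=
  holderSeminorm γ Y' + holderSup (2 * γ) (fun η ξ => ‖remainder X Y Y' η ξ‖)
    + ⨆ ξ : Param, ENNReal.ofReal ‖Y' ξ‖

/-- The norm `‖Y‖*_D = ‖Y‖_D + ‖Y‖_∞`. -/
def ctrlNormStar (γ : ℝ) (X Y : Param → Vec) (Y' : Param → Vec →L[ℝ] Vec) : ℝ≥0∞ :=
  ctrlNorm γ X Y Y' + ⨆ ξ : Param, ENNReal.ofReal ‖Y ξ‖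

/-- `(Y, Y')` is a closed path weakly controlled by `X`. -/
def IsControlled (γ : ℝ) (X Y : Param → Vec) (Y' : Param → Vec →L[ℝ] Vec) : Prop :=
  Y 0 = Y 1 ∧ ctrlNormStar γ X Y Y' < ⊤

/-! ### Rough integrals -/

/-- One term of the renormalized sums for `∫ f dg`: with `f` taking values in linear maps,
`f_a (g_b - g_a) + ∑_{k,l} f'_a(e_k)(g'_a e_l) 𝕏²^{kl}_{ab}`. -/
def roughTerm {F : Type*} [NormedAddCommGroup F] [NormedSpace ℝ F]
    (XX : Param → Param → Matrix (Fin 3) (Fin 3) ℝ)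
    (f : Param → Vec →L[ℝ] F) (f' : Param → Vec →L[ℝ] Vec →L[ℝ] F)
    (g : Param → Vec) (g' : Param → Vec →L[ℝ] Vec) (a b : Param) : F :=
  f a (g b - g a) + ∑ k, ∑ l, XX a b k l • f' a (stdVec k) (g' a (stdVec l))

/-- `J = ∫_a^b f dg` as a rough integral: the renormalized sums over the partitions
`a = P 0, P 1, …, P n = b` (increasing if `a ≤ b`, decreasing if `b ≤ a`) tend to `J` as the mesh
tends to zero. -/
def HasRoughIntegral {F : Type*} [NormedAddCommGroup F] [NormedSpace ℝ F]
    (XX : Param → Param → Matrix (Fin 3) (Fin 3) ℝ)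
    (f : Param → Vec →L[ℝ] F) (f' : Param → Vec →L[ℝ] Vec →L[ℝ] F)
    (g : Param → Vec) (g' : Param → Vec →L[ℝ] Vec) (a b : Param) (J : F) : Prop :=
  ∀ ε : ℝ, 0 < ε → ∃ δ : ℝ, 0 < δ ∧ ∀ (n : ℕ) (P : ℕ → Param),
    (Monotone P ∨ Antitone P) → P 0 = a → P n = b →
    (∀ i < n, dist (P i) (P (i + 1)) < δ) →
    ‖(∑ i ∈ Finset.range n, roughTerm XX f f' g g' (P i) (P (i + 1))) - J‖ < ε

/-- `u = V^Y(x) = ∫_0^1 A(x - Y_η) dY_η`, where the integrand is controlled with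
derivative `-∇A(x - Y_η) Y'_η`. -/
def IsVelocity (A : Vec → Vec →L[ℝ] Vec) (XX : Param → Param → Matrix (Fin 3) (Fin 3) ℝ)
    (Y : Param → Vec) (Y' : Param → Vec →L[ℝ] Vec) (x u : Vec) : Prop :=
  HasRoughIntegral XX (fun η => A (x - Y η)) (fun η => -((fderiv ℝ A (x - Y η)).comp (Y' η)))
    Y Y' 0 1 u

/-- `Z` is the lift of the controlled path `(Y, Y')` to a rough path:
`Z.path = Y` and `Z.area^{ij}_{ρξ} = ∫_ρ^ξ (Y^i_η - Y^i_ρ) dY^j_η`. -/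
def IsLift {γ : ℝ} (X : RoughPath γ) (Y : Param → Vec) (Y' : Param → Vec →L[ℝ] Vec)
    (Z : RoughPath γ) : Prop :=
  Z.path = Y ∧ ∀ (ρ ξ : Param) (i j : Fin 3),
    HasRoughIntegral X.area
      (fun η => (Y η i - Y ρ i) • (EuclideanSpace.proj j : Vec →L[ℝ] ℝ))
      (fun η => ((EuclideanSpace.proj i : Vec →L[ℝ] ℝ).comp (Y' η)).smulRight
        (EuclideanSpace.proj j : Vec →L[ℝ] ℝ))
      Y Y' ρ ξ (Z.area ρ ξ i j)

/-! ### The evolution problem -/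

/-- `‖∇A‖_n = ∑_{k=0}^n sup_x |∇^{k+1} A(x)|`. -/
def gradNorm (A : Vec → Vec →L[ℝ] Vec) (n : ℕ) : ℝ≥0∞ :=
  ∑ k ∈ Finset.range (n + 1), ⨆ x : Vec, ENNReal.ofReal ‖iteratedFDeriv ℝ (k + 1) A x‖

/-- `(Y, Y')` is a solution on `[0,T]`, in `C([0,T], D_X)`, of
`Y(t)_ξ = X_ξ + ∫_0^t V^{Y(s)}(Y(s)_ξ) ds`, together with the equation for the derivative
`Y'(t)_ξ = Id + ∫_0^t ∇V^{Y(s)}(Y(s)_ξ) Y'(s)_ξ ds`; here `v s = V^{Y(s)}` and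
`dv s = ∇V^{Y(s)}`. -/
structure IsRoughSolution {γ : ℝ} (A : Vec → Vec →L[ℝ] Vec) (X : RoughPath γ) (T : ℝ)
    (Y : ℝ → Param → Vec) (Y' : ℝ → Param → Vec →L[ℝ] Vec) : Prop where
  controlled : ∀ t ∈ Icc 0 T, IsControlled γ X.path (Y t) (Y' t)
  continuous_curve : ∀ t ∈ Icc 0 T,
    Tendsto (fun s => ctrlNormStar γ X.path (Y s - Y t) (Y' s - Y' t)) (𝓝[Icc 0 T] t) (𝓝 0)
  equation : ∃ (v : ℝ → Vec → Vec) (dv : ℝ → Vec → Vec →L[ℝ] Vec),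
    (∀ s ∈ Icc 0 T, ∀ x, IsVelocity A X.area (Y s) (Y' s) x (v s x)) ∧
    (∀ s ∈ Icc 0 T, ∀ x, HasFDerivAt (v s) (dv s x) x) ∧
    ∀ t ∈ Icc 0 T, ∀ ξ : Param,
      IntervalIntegrable (fun s => v s (Y s ξ)) volume 0 t ∧
      Y t ξ = X.path ξ + ∫ s in (0 : ℝ)..t, v s (Y s ξ) ∧
      IntervalIntegrable (fun s => (dv s (Y s ξ)).comp (Y' s ξ)) volume 0 t ∧
      Y' t ξ = ContinuousLinearMap.id ℝ Vec + ∫ s in (0 : ℝ)..t, (dv s (Y s ξ)).comp (Y' s ξ)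

/-- `T` is an existence time, with a priori bound `B`, for the data in the ball of radius `r`. -/
def IsExistenceTime (γ r : ℝ) (A : Vec → Vec →L[ℝ] Vec) (T : ℝ) (B : ℝ≥0) : Prop :=
  ∀ X ∈ roughBall γ r, ∃ (Y : ℝ → Param → Vec) (Y' : ℝ → Param → Vec →L[ℝ] Vec),
    IsRoughSolution A X T Y Y' ∧ ∀ t ∈ Icc 0 T, ctrlNorm γ X.path (Y t) (Y' t) ≤ B

/-- The curve of rough paths `Z` on `[0,T]` is a solution started at `X`, lifted at each time. -/
def IsLiftedSolution {γ : ℝ} (A : Vec → Vec →L[ℝ] Vec) (X : RoughPath γ) (T : ℝ)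
    (Z : ℝ → RoughPath γ) : Prop :=
  ∃ (Y : ℝ → Param → Vec) (Y' : ℝ → Param → Vec →L[ℝ] Vec),
    IsRoughSolution A X T Y Y' ∧ ∀ t ∈ Icc 0 T, IsLift X (Y t) (Y' t) (Z t)

/-! ### Smooth curves and classical solutions -/

/-- A function on `[0,1]` extended to the line by its end values. -/
def endExtend {F : Type*} (f : Param → F) : ℝ → F := Set.IccExtend zero_le_one f

/-- `df` is the derivative of `f` on `[0,1]` (one-sided at the end points). -/
def IsDerivOf (f df : Param → Vec) : Prop :=
  ∀ ξ : Param, HasDerivWithinAt (endExtend f) (df ξ) (Icc 0 1) (ξ : ℝ)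

/-- `X` is a continuously differentiable loop with its geometric area
`∫_ξ^η (X_ρ - X_ξ)^i dX^j_ρ`. -/
def IsGeometricLift {γ : ℝ} (X : RoughPath γ) : Prop :=
  ∃ dX : Param → Vec, Continuous dX ∧ IsDerivOf X.path dX ∧
    ∀ (ξ η : Param) (i j : Fin 3),
      X.area ξ η i j
        = ∫ ρ in (ξ : ℝ)..(η : ℝ), (endExtend X.path ρ i - X.path ξ i) * endExtend dX ρ j

/-- `∫_0^1 A(x - f_η) f'_η dη` for a continuously differentiable `f` with derivative `df`. -/
def classicalVelocity (A : Vec → Vec →L[ℝ] Vec) (f df : Param → Vec) (x : Vec) : Vec :=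
  ∫ η in (0 : ℝ)..1, A (x - endExtend f η) (endExtend df η)

/-- `y` is a classical solution on `[0,T]` of `∂_t y(t)_ξ = V^{y(t)}(y(t)_ξ)`, `y(0) = X`:
closed curves, continuously differentiable in the parameter, jointly continuously in time. -/
def IsClassicalSolution (A : Vec → Vec →L[ℝ] Vec) (T : ℝ) (X : Param → Vec)
    (y : ℝ → Param → Vec) : Prop :=
  ∃ dy : ℝ → Param → Vec,
    ContinuousOn (fun p : ℝ × Param => y p.1 p.2) (Icc 0 T ×ˢ univ) ∧
    ContinuousOn (fun p : ℝ × Param => dy p.1 p.2) (Icc 0 T ×ˢ univ) ∧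
    y 0 = X ∧
    ∀ t ∈ Icc 0 T, y t 0 = y t 1 ∧ IsDerivOf (y t) (dy t) ∧
      ∀ ξ : Param, HasDerivWithinAt (fun s => y s ξ)
        (classicalVelocity A (y t) (dy t) (y t ξ)) (Icc 0 T) t

end VortexFilament

end

open VortexFilament

noncomputable section

set_option linter.unusedSectionVars false
set_option maxSynthPendingDepth 10

namespace VortexFilament

/-! Rough integrals come from sewing: a germ whose additivity defect over three points within
distance `D` is `O(D ^ θ)`, `θ > 1`, has convergent Riemann sums. By Chen's relation the germ of a
rough integral has a defect of order `3 * γ > 1`.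

All estimates are proved for families of data indexed by `ι`, with sizes at most `S` and mutual
distances at most `S * ε` (`Near`). A one-element family with `ε = 0` yields a priori bounds, and a
family over `Bool` yields Lipschitz estimates, from the same computation.

For a closed loop the leading term `f_0 (Y_1 - Y_0)` of the germ vanishes, so the velocity is
bounded through derivatives of the kernel alone. It is linear in the kernel and therefore inherits
the kernel's regularity in `x` (`LoopFam.exists_convField`). Composition with smooth functions
preserves controlled paths (`SmoothFam.comp`). Together they give `LoopFam.evo`: the right side of
the evolution is bounded in terms of four derivatives of `A` and Lipschitz in terms of five.

Existence is Picard–Lindelöf in the Banach space `ctrlSpace` of loops controlled by a fixed `X`. The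
time depends only on the bound of the vector field, hence on `‖∇A‖_3`, and not on its Lipschitz
constant. Stability cannot be read in that space, because loops over different `X` live in different
spaces. Instead derivative, increments and remainder are compared separately, as time integrals; an
exponential weight in time makes the comparison a contraction (`BddFlow.near`). The area of the
solution is one more rough integral, with the same estimates (`exists_lift`).

Over the geometric lift of a `C^1` loop the area is quadratic in the parameter distance, so rough
integrals are ordinary ones. A Gronwall argument shows that the remainder is quadratic in the
increments of `X`; thus `Y(t)` is `C^1` with derivative `Y'(t) ∂X`, and the solution is classical.
Classical solutions are unique, since integration by parts makes the velocity Lipschitz in the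
uniform norm. Lifted classical solutions are therefore values of `Γ`, and their convergence is the
Lipschitz estimate. -/

/-! ### Sewing -/

section Sewing

variable {F : Type*} [NormedAddCommGroup F] [NormedSpace ℝ F]

/-- The Riemann sums of the germ `Ξ` over partitions from `a` to `b` tend to `J` as the mesh
tends to zero. -/
def HasSewing (Ξ : Param → Param → F) (a b : Param) (J : F) : Prop :=
  ∀ ε : ℝ, 0 < ε → ∃ δ : ℝ, 0 < δ ∧ ∀ (n : ℕ) (P : ℕ → Param),
    (Monotone P ∨ Antitone P) → P 0 = a → P n = b →
    (∀ i < n, dist (P i) (P (i + 1)) < δ) →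
    ‖(∑ i ∈ Finset.range n, Ξ (P i) (P (i + 1))) - J‖ < ε

/-- Without partitions of arbitrarily small mesh the limit in `HasSewing` could hold vacuously;
uniqueness of integrals rests on this. The weights `min 1 (i / N)` stay equal to `1` from `N` on,
which keeps the sequence monotone on all of `ℕ`. -/
theorem exists_partition (a b : Param) {δ : ℝ} (hδ : 0 < δ) :
    ∃ (n : ℕ) (P : ℕ → Param), (Monotone P ∨ Antitone P) ∧ P 0 = a ∧ P n = b ∧
      ∀ i < n, dist (P i) (P (i + 1)) < δ := by
  obtain ⟨n, hn⟩ := exists_nat_one_div_lt hδ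
  set N : ℝ := (n : ℝ) + 1 with hN
  have hN0 : 0 < N := by positivity
  have hs0 : ∀ i : ℕ, 0 ≤ min 1 ((i : ℝ) / N) := fun i => le_min zero_le_one (by positivity)
  have hs1 : ∀ i : ℕ, min 1 ((i : ℝ) / N) ≤ 1 := fun i => min_le_left _ _
  have hmem : ∀ i : ℕ, (1 - min 1 ((i : ℝ) / N)) * (a : ℝ) + min 1 ((i : ℝ) / N) * (b : ℝ)
      ∈ Icc (0 : ℝ) 1 := fun i =>
    (convex_Icc (0 : ℝ) 1) a.2 b.2 (sub_nonneg.2 (hs1 i)) (hs0 i) (by ring)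
  have hmono : ∀ i j : ℕ, i ≤ j → min 1 ((i : ℝ) / N) ≤ min 1 ((j : ℝ) / N) := fun i j hij =>
    min_le_min le_rfl (by gcongr)
  refine ⟨n + 1, fun i => ⟨_, hmem i⟩, ?_, ?_, ?_, ?_⟩
  · rcases le_total a b with h | h
    · left
      intro i j hij
      have h' : (a : ℝ) ≤ b := h
      have := hmono i j hij
      simp only [Subtype.mk_le_mk]
      nlinarith
    · right
      intro i j hij
      have h' : (b : ℝ) ≤ a := h
      have := hmono i j hij
      simp only [Subtype.mk_le_mk]
      nlinarith
  · ext; simp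
  · ext
    have : ((n + 1 : ℕ) : ℝ) / N = 1 := by rw [hN]; push_cast; field_simp
    simp only [this, min_self]; ring
  · intro i _
    refine lt_of_le_of_lt ?_ hn
    rw [Subtype.dist_eq, Real.dist_eq]
    have h1 := hmono i (i + 1) (Nat.le_succ i)
    have h2 : min 1 (((i + 1 : ℕ) : ℝ) / N) - min 1 ((i : ℝ) / N) ≤ 1 / N := by
      have e : ((i + 1 : ℕ) : ℝ) / N = (i : ℝ) / N + 1 / N := by push_cast; ring
      have hp : 0 ≤ 1 / N := by positivity
      rw [e]
      rcases le_total 1 ((i : ℝ) / N) with h | h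
      · rw [min_eq_left h, min_eq_left (by linarith)]; linarith
      · rw [min_eq_right h]; linarith [min_le_right 1 ((i : ℝ) / N + 1 / N)]
    have h3 : |(a : ℝ) - b| ≤ 1 := by
      rw [abs_le]; constructor <;> linarith [a.2.1, a.2.2, b.2.1, b.2.2]
    have e : (1 - min 1 ((i : ℝ) / N)) * (a : ℝ) + min 1 ((i : ℝ) / N) * (b : ℝ) -
        ((1 - min 1 (((i + 1 : ℕ) : ℝ) / N)) * (a : ℝ) + min 1 (((i + 1 : ℕ) : ℝ) / N) * (b : ℝ))
        = (min 1 (((i + 1 : ℕ) : ℝ) / N) - min 1 ((i : ℝ) / N)) * ((a : ℝ) - b) := by ring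
    rw [e, abs_mul, abs_of_nonneg (sub_nonneg.2 h1)]
    calc _ ≤ (1 / N) * 1 := mul_le_mul h2 h3 (abs_nonneg _) (by positivity)
      _ = _ := by rw [mul_one]

namespace HasSewing

variable {Ξ Ξ' : Param → Param → F} {a b : Param} {J J' : F}

theorem unique (h : HasSewing Ξ a b J) (h' : HasSewing Ξ a b J') : J = J' := by
  by_contra hne
  have hpos : 0 < ‖J - J'‖ / 2 := by
    have := norm_pos_iff.2 (sub_ne_zero.2 hne); positivity
  obtain ⟨δ, hδ, H⟩ := h _ hpos
  obtain ⟨δ', hδ', H'⟩ := h' _ hpos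
  obtain ⟨n, P, hP, h0, hn, hm⟩ := exists_partition a b (lt_min hδ hδ')
  have A := H n P hP h0 hn fun i hi => (hm i hi).trans_le (min_le_left _ _)
  have B := H' n P hP h0 hn fun i hi => (hm i hi).trans_le (min_le_right _ _)
  have := norm_sub_le ((∑ i ∈ Finset.range n, Ξ (P i) (P (i + 1))) - J')
    ((∑ i ∈ Finset.range n, Ξ (P i) (P (i + 1))) - J)
  rw [sub_sub_sub_cancel_left] at this
  linarith

theorem sub (h : HasSewing Ξ a b J) (h' : HasSewing Ξ' a b J') :
    HasSewing (fun x y => Ξ x y - Ξ' x y) a b (J - J') := by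
  intro ε hε
  obtain ⟨δ, hδ, H⟩ := h _ (half_pos hε)
  obtain ⟨δ', hδ', H'⟩ := h' _ (half_pos hε)
  refine ⟨min δ δ', lt_min hδ hδ', fun n P hP h0 hn hm => ?_⟩
  have A := H n P hP h0 hn fun i hi => (hm i hi).trans_le (min_le_left _ _)
  have B := H' n P hP h0 hn fun i hi => (hm i hi).trans_le (min_le_right _ _)
  rw [Finset.sum_sub_distrib, sub_sub_sub_comm]
  exact (norm_sub_le _ _).trans_lt (by linarith)

theorem clm {G : Type*} [NormedAddCommGroup G] [NormedSpace ℝ G] (L : F →L[ℝ] G)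
    (h : HasSewing Ξ a b J) : HasSewing (fun x y => L (Ξ x y)) a b (L J) := by
  intro ε hε
  have hL : 0 < ‖L‖ + 1 := by positivity
  obtain ⟨δ, hδ, H⟩ := h (ε / (‖L‖ + 1)) (by positivity)
  refine ⟨δ, hδ, fun n P hP h0 hn hm => ?_⟩
  rw [← map_sum, ← map_sub]
  refine (L.le_opNorm _).trans_lt ?_
  have := H n P hP h0 hn hm
  rw [lt_div_iff₀ hL] at this
  nlinarith [norm_nonneg ((∑ i ∈ Finset.range n, Ξ (P i) (P (i + 1))) - J)]

end HasSewing

/-! ### Sewing of almost additive germs -/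

theorem sum_dist_partition {P : ℕ → Param} (hP : Monotone P ∨ Antitone P) (n : ℕ) :
    ∑ i ∈ Finset.range n, dist (P i) (P (i + 1)) ≤ 1 := by
  have key : ∀ n, ∑ i ∈ Finset.range n, dist (P i) (P (i + 1)) = |(P n : ℝ) - P 0| := by
    intro n
    rcases hP with hP | hP
    · have : ∀ i, dist (P i) (P (i + 1)) = (P (i + 1) : ℝ) - P i := fun i => by
        rw [Subtype.dist_eq, Real.dist_eq, abs_sub_comm]
        exact abs_of_nonneg (sub_nonneg.2 (Subtype.coe_le_coe.2 (hP (Nat.le_succ i))))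
      rw [Finset.sum_congr rfl fun i _ => this i, Finset.sum_range_sub (fun i => (P i : ℝ)),
        abs_of_nonneg (sub_nonneg.2 (Subtype.coe_le_coe.2 (hP (Nat.zero_le n))))]
    · have : ∀ i, dist (P i) (P (i + 1)) = (P i : ℝ) - P (i + 1) := fun i => by
        rw [Subtype.dist_eq, Real.dist_eq]
        exact abs_of_nonneg (sub_nonneg.2 (Subtype.coe_le_coe.2 (hP (Nat.le_succ i))))
      rw [Finset.sum_congr rfl fun i _ => this i, Finset.sum_range_sub' (fun i => (P i : ℝ)),
        abs_sub_comm, abs_of_nonneg (sub_nonneg.2 (Subtype.coe_le_coe.2 (hP (Nat.zero_le n))))]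
  rw [key, abs_le]
  constructor <;> linarith [(P n).2.1, (P n).2.2, (P 0).2.1, (P 0).2.2]

/-- The increments of `φ` telescope exactly, and the errors add up to at most `C` times the mesh to
the power `θ - 1`, because the lengths of the cells sum to at most one. -/
theorem hasSewing_of_additive {Ξ : Param → Param → F} {φ : Param → F} {C θ : ℝ} (hθ : 1 < θ)
    (h : ∀ a b, ‖φ b - φ a - Ξ a b‖ ≤ C * dist a b ^ θ) (a b : Param) :
    HasSewing Ξ a b (φ b - φ a) := by
  intro ε hε
  have hC : 0 ≤ |C| + 1 := by positivity
  have hc : Tendsto (fun δ : ℝ => (|C| + 1) * δ ^ (θ - 1)) (𝓝 0) (𝓝 0) := by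
    have h1 : ContinuousAt (fun δ : ℝ => (|C| + 1) * δ ^ (θ - 1)) 0 :=
      continuousAt_const.mul (Real.continuousAt_rpow_const _ _ (Or.inr (by linarith)))
    have := h1.tendsto
    rwa [Real.zero_rpow (by linarith), mul_zero] at this
  obtain ⟨δ, hδ, H⟩ := Metric.tendsto_nhds_nhds.1 hc ε hε
  refine ⟨δ / 2, half_pos hδ, fun n P hP h0 hn hm => ?_⟩
  have hsum : (∑ i ∈ Finset.range n, Ξ (P i) (P (i + 1))) - (φ b - φ a)
      = -∑ i ∈ Finset.range n, (φ (P (i + 1)) - φ (P i) - Ξ (P i) (P (i + 1))) := by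
    rw [Finset.sum_sub_distrib, Finset.sum_range_sub (fun i => φ (P i)), h0, hn]; abel
  have hpow : (|C| + 1) * (δ / 2) ^ (θ - 1) < ε := by
    have := H (x := δ / 2) (by
      rw [dist_zero_right, Real.norm_eq_abs, abs_of_pos (half_pos hδ)]; linarith)
    rw [dist_zero_right, Real.norm_eq_abs] at this
    exact (le_abs_self _).trans_lt this
  rw [hsum, norm_neg]
  refine lt_of_le_of_lt ?_ hpow
  calc _ ≤ ∑ i ∈ Finset.range n, (|C| + 1) * (δ / 2) ^ (θ - 1) * dist (P i) (P (i + 1)) := by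
        refine norm_sum_le_of_le _ fun i hi => (h _ _).trans ?_
        have hd : (0 : ℝ) ≤ dist (P i) (P (i + 1)) := dist_nonneg
        have e : dist (P i) (P (i + 1)) ^ θ
            = dist (P i) (P (i + 1)) ^ (θ - 1) * dist (P i) (P (i + 1)) := by
          rw [← Real.rpow_add_one' hd (by linarith), sub_add_cancel]
        rw [e, ← mul_assoc]
        gcongr
        · linarith [le_abs_self C]
        · exact (hm i (Finset.mem_range.1 hi)).le
    _ = (|C| + 1) * (δ / 2) ^ (θ - 1) * ∑ i ∈ Finset.range n, dist (P i) (P (i + 1)) := by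
        rw [Finset.mul_sum]
    _ ≤ (|C| + 1) * (δ / 2) ^ (θ - 1) * 1 := by
        gcongr
        exact sum_dist_partition hP n
    _ = _ := mul_one _

/-- The constant of the sewing lemma. -/
def sewConst (θ : ℝ) : ℝ := 2 / (1 - 2 ^ (1 - θ))

theorem sewConst_pos {θ : ℝ} (hθ : 1 < θ) : 0 < sewConst θ := by
  have : (2 : ℝ) ^ (1 - θ) < 1 := Real.rpow_lt_one_of_one_lt_of_neg one_lt_two (by linarith)
  exact div_pos two_pos (by linarith)

/-- The fixed-point equation behind the induction in `norm_sum_germ_sub_le`: two defects, plus the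
same bound on two pieces of at most half the length. -/
theorem sewConst_eq {θ : ℝ} (hθ : 1 < θ) :
    sewConst θ = 2 + 2 * (sewConst θ * (1 / 2 : ℝ) ^ θ) := by
  have h1 : (2 : ℝ) ^ (1 - θ) < 1 := Real.rpow_lt_one_of_one_lt_of_neg one_lt_two (by linarith)
  have h2 : (2 : ℝ) ^ (1 - θ) = 2 * (1 / 2 : ℝ) ^ θ := by
    rw [Real.rpow_sub two_pos, Real.rpow_one, one_div, Real.inv_rpow two_pos.le, div_eq_mul_inv]
  have h3 : sewConst θ * (1 - 2 ^ (1 - θ)) = 2 := div_mul_cancel₀ _ (by linarith)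
  rw [h2] at h3
  linarith

theorem exists_between_index {P : ℕ → ℝ} (hP : Monotone P) {n : ℕ} (hn : 0 < n) {m : ℝ}
    (h0 : P 0 ≤ m) (h1 : m ≤ P n) : ∃ j < n, P j ≤ m ∧ m ≤ P (j + 1) := by
  classical
  have hex : ∃ k, m ≤ P k := ⟨n, h1⟩
  rcases hk : Nat.find hex with _ | j
  · have := Nat.find_spec hex
    rw [hk] at this
    exact ⟨0, hn, h0, this.trans (hP (Nat.zero_le 1))⟩
  · have hs := Nat.find_spec hex
    have hlt := Nat.find_min hex (m := j) (by omega)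
    have hle : Nat.find hex ≤ n := Nat.find_min' hex h1
    rw [hk] at hs
    exact ⟨j, by omega, (not_le.1 hlt).le, hs⟩

/-- Induction on the number of cells. The cell containing the midpoint of `[P 0, P n]` is cut out;
the partitions on its two sides each span at most half of the interval, and reassembling the three
pieces costs two defects. The constant closes by `sewConst_eq` and does not depend on `n`. -/
theorem norm_sum_germ_sub_le {Ξ : Param → Param → F} {C θ : ℝ} (hθ : 1 < θ) (hC : 0 ≤ C)
    (hdiag : ∀ a, Ξ a a = 0)
    (hdef : ∀ a b c, a ≤ b → b ≤ c → ‖Ξ a c - Ξ a b - Ξ b c‖ ≤ C * dist a c ^ θ) :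
    ∀ (n : ℕ) (P : ℕ → Param), Monotone P →
      ‖(∑ k ∈ Finset.range n, Ξ (P k) (P (k + 1))) - Ξ (P 0) (P n)‖
        ≤ sewConst θ * C * dist (P 0) (P n) ^ θ := by
  intro n
  induction n using Nat.strong_induction_on with
  | _ n ih =>
    intro P hP
    have hK := sewConst_pos hθ
    rcases Nat.eq_zero_or_pos n with rfl | hn
    · simp [hdiag]; positivity
    have hPr : Monotone fun k => (P k : ℝ) := hP
    obtain ⟨j, hj, hj1, hj2⟩ := exists_between_index hPr hn
      (m := ((P 0 : ℝ) + P n) / 2) (by linarith [hPr (Nat.zero_le n)])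
      (by linarith [hPr (Nat.zero_le n)])
    obtain ⟨l, rfl⟩ : ∃ l, n = j + 1 + l := ⟨n - (j + 1), by omega⟩
    have dle : ∀ {x y : ℕ}, x ≤ y → dist (P x) (P y) = (P y : ℝ) - P x := fun h => by
      rw [Subtype.dist_eq, Real.dist_eq, abs_sub_comm]
      exact abs_of_nonneg (sub_nonneg.2 (Subtype.coe_le_coe.2 (hP h)))
    set D := dist (P 0) (P (j + 1 + l)) with hD
    have hDe : D = (P (j + 1 + l) : ℝ) - P 0 := dle (Nat.zero_le _)
    have hD0 : 0 ≤ D := dist_nonneg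
    have A := ih j hj P hP
    have B := ih l (by omega) (fun k => P (j + 1 + k)) (fun x y h => hP (by omega))
    have hd1 : dist (P 0) (P j) ^ θ ≤ (1 / 2 : ℝ) ^ θ * D ^ θ := by
      rw [← Real.mul_rpow (by norm_num) hD0]
      refine Real.rpow_le_rpow dist_nonneg ?_ (by linarith)
      rw [dle (Nat.zero_le j), hDe]; linarith
    have hd2 : dist (P (j + 1)) (P (j + 1 + l)) ^ θ ≤ (1 / 2 : ℝ) ^ θ * D ^ θ := by
      rw [← Real.mul_rpow (by norm_num) hD0]
      refine Real.rpow_le_rpow dist_nonneg ?_ (by linarith)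
      rw [dle (by omega), hDe]; linarith
    have d1 := hdef (P 0) (P j) (P (j + 1 + l)) (hP (by omega)) (hP (by omega))
    have d2 := hdef (P j) (P (j + 1)) (P (j + 1 + l)) (hP (by omega)) (hP (by omega))
    have hd3 : dist (P j) (P (j + 1 + l)) ^ θ ≤ D ^ θ := by
      refine Real.rpow_le_rpow dist_nonneg ?_ (by linarith)
      rw [dle (by omega), hDe]; linarith [hPr (Nat.zero_le j)]
    simp only [Nat.add_zero, ← add_assoc] at B
    rw [Finset.sum_range_add, Finset.sum_range_succ]
    have e : (∑ k ∈ Finset.range j, Ξ (P k) (P (k + 1))) + Ξ (P j) (P (j + 1))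
          + (∑ k ∈ Finset.range l, Ξ (P (j + 1 + k)) (P (j + 1 + k + 1)))
          - Ξ (P 0) (P (j + 1 + l))
        = ((∑ k ∈ Finset.range j, Ξ (P k) (P (k + 1))) - Ξ (P 0) (P j))
          + ((∑ k ∈ Finset.range l, Ξ (P (j + 1 + k)) (P (j + 1 + k + 1)))
            - Ξ (P (j + 1)) (P (j + 1 + l)))
          - (Ξ (P 0) (P (j + 1 + l)) - Ξ (P 0) (P j) - Ξ (P j) (P (j + 1 + l)))
          - (Ξ (P j) (P (j + 1 + l)) - Ξ (P j) (P (j + 1)) - Ξ (P (j + 1)) (P (j + 1 + l))) := by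
      abel
    rw [e]
    have hKC : 0 ≤ sewConst θ * C := by positivity
    have A' := A.trans (mul_le_mul_of_nonneg_left hd1 hKC)
    have B' := B.trans (mul_le_mul_of_nonneg_left hd2 hKC)
    have d2' := d2.trans (mul_le_mul_of_nonneg_left hd3 hC)
    refine (norm_sub_le _ _).trans ((add_le_add ((norm_sub_le _ _).trans
      (add_le_add ((norm_add_le _ _).trans (add_le_add A' B')) d1)) d2').trans ?_)
    have hke := sewConst_eq hθ
    have : sewConst θ * C * D ^ θ
        = (2 + 2 * (sewConst θ * (1 / 2 : ℝ) ^ θ)) * (C * D ^ θ) := by rw [← hke]; ring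
    rw [this]
    apply le_of_eq
    ring

/-- The dyadic point `i / 2 ^ n`. -/
def dyadicPt (n i : ℕ) : Param := Set.projIcc 0 1 zero_le_one ((i : ℝ) / 2 ^ n)

theorem dyadicPt_mono (n : ℕ) : Monotone (dyadicPt n) := fun i j h =>
  Set.monotone_projIcc _ (by gcongr)

theorem dyadicPt_zero (n : ℕ) : dyadicPt n 0 = 0 := by
  simp only [dyadicPt, Nat.cast_zero, zero_div]
  exact Set.projIcc_left _

theorem dyadicPt_last (n : ℕ) : dyadicPt n (2 ^ n) = 1 := by
  have : (((2 ^ n : ℕ) : ℝ)) / 2 ^ n = 1 := by push_cast; field_simp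
  simp only [dyadicPt, this]
  exact Set.projIcc_right _

theorem dyadicPt_double (n i : ℕ) : dyadicPt (n + 1) (2 * i) = dyadicPt n i := by
  have : ((2 * i : ℕ) : ℝ) / 2 ^ (n + 1) = (i : ℝ) / 2 ^ n := by
    rw [pow_succ]; push_cast; field_simp
  simp only [dyadicPt, this]

theorem dist_dyadicPt_le (n i : ℕ) :
    dist (dyadicPt n i) (dyadicPt n (i + 1)) ≤ (1 / 2 : ℝ) ^ n := by
  refine ((LipschitzWith.projIcc zero_le_one).dist_le_mul _ _).trans ?_
  rw [NNReal.coe_one, one_mul, Real.dist_eq, ← sub_div, abs_div,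
    abs_of_pos (by positivity : (0:ℝ) < 2 ^ n)]
  push_cast
  simp

theorem sum_range_two_mul (f : ℕ → F) (n : ℕ) :
    ∑ i ∈ Finset.range (2 * n), f i = ∑ i ∈ Finset.range n, (f (2 * i) + f (2 * i + 1)) := by
  induction n with
  | zero => simp
  | succ n ih =>
    rw [Finset.sum_range_succ, ← ih, Nat.mul_succ, Finset.sum_range_succ, Finset.sum_range_succ,
      add_assoc]

theorem dist_le_of_mem_Icc {a b c d : Param} (hac : a ≤ c) (hcd : c ≤ d) (hdb : d ≤ b) :
    dist c d ≤ dist a b := by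
  rw [Subtype.dist_eq, Subtype.dist_eq]
  have h1 : (a : ℝ) ≤ c := hac
  have h2 : (c : ℝ) ≤ d := hcd
  have h3 : (d : ℝ) ≤ b := hdb
  rw [Real.dist_eq, Real.dist_eq, abs_sub_comm, abs_of_nonneg (by linarith), abs_sub_comm,
    abs_of_nonneg (by linarith)]
  linarith

theorem dist_min_min_le {s u : Param} (t : Param) (h : s ≤ u) :
    dist (min t s) (min t u) ≤ dist s u := by
  rcases le_total t s with h1 | h1
  · rw [min_eq_left h1, min_eq_left (h1.trans h), dist_self]; exact dist_nonneg
  · rw [min_eq_right h1]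
    exact dist_le_of_mem_Icc le_rfl (le_min h1 h) (min_le_right _ _)

/-- Dyadic approximation of the sewn function. -/
def dyadicSum (Ξ : Param → Param → F) (n : ℕ) (t : Param) : F :=
  ∑ i ∈ Finset.range (2 ^ n), Ξ (min t (dyadicPt n i)) (min t (dyadicPt n (i + 1)))

/-- At dyadic level `n` there are `2 ^ n` cells with error `(2 ^ (-n)) ^ θ` each; for `θ > 1` the
total is a decaying geometric sequence. -/
theorem pow_rpow_geometric {C θ : ℝ} (n : ℕ) :
    ∑ _i ∈ Finset.range (2 ^ n), C * ((1 / 2 : ℝ) ^ n) ^ θ = C * ((2 : ℝ) ^ (1 - θ)) ^ n := by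
  rw [Finset.sum_const, Finset.card_range, nsmul_eq_mul]
  have h : ((1 / 2 : ℝ) ^ n) ^ θ = ((1 / 2 : ℝ) ^ θ) ^ n := by
    rw [← Real.rpow_natCast, ← Real.rpow_natCast, ← Real.rpow_mul (by norm_num),
      ← Real.rpow_mul (by norm_num), mul_comm]
  have h2 : (2 : ℝ) ^ (1 - θ) = 2 * (1 / 2 : ℝ) ^ θ := by
    rw [Real.rpow_sub two_pos, Real.rpow_one, one_div, Real.inv_rpow two_pos.le, div_eq_mul_inv]
  rw [h, h2, mul_pow]
  push_cast
  ring

/-- The primitive is the limit of the dyadic sums stopped at `t`, which form a Cauchy sequence by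
the geometric bound on successive levels. The hypothesis on the defect covers triples in any order,
so that integrals can also run backwards. -/
theorem exists_sewing [CompleteSpace F] {Ξ : Param → Param → F} {C θ : ℝ} (hθ : 1 < θ)
    (hC : 0 ≤ C) (hdiag : ∀ a, Ξ a a = 0)
    (hdef : ∀ a b c D, dist a b ≤ D → dist b c ≤ D → dist a c ≤ D →
      ‖Ξ a c - Ξ a b - Ξ b c‖ ≤ C * D ^ θ) :
    ∃ φ : Param → F, ∀ a b, ‖φ b - φ a - Ξ a b‖ ≤ (sewConst θ + 1) * C * dist a b ^ θ := by
  have hmono : ∀ a b c, a ≤ b → b ≤ c → ‖Ξ a c - Ξ a b - Ξ b c‖ ≤ C * dist a c ^ θ :=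
    fun a b c hab hbc => hdef a b c _ (dist_le_of_mem_Icc le_rfl hab hbc)
      (dist_le_of_mem_Icc hab hbc le_rfl) le_rfl
  have hK := sewConst_pos hθ
  have hr : (2 : ℝ) ^ (1 - θ) < 1 := Real.rpow_lt_one_of_one_lt_of_neg one_lt_two (by linarith)
  have hr0 : 0 < (2 : ℝ) ^ (1 - θ) := by positivity
  have hstep : ∀ t n, dist (dyadicSum Ξ n t) (dyadicSum Ξ (n + 1) t)
      ≤ C * ((2 : ℝ) ^ (1 - θ)) ^ n := by
    intro t n
    rw [dist_comm, dist_eq_norm, ← norm_neg, neg_sub]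
    unfold dyadicSum
    rw [pow_succ' 2 n, sum_range_two_mul, ← Finset.sum_sub_distrib, ← pow_rpow_geometric]
    refine norm_sum_le_of_le _ fun i _ => ?_
    rw [dyadicPt_double, show 2 * i + 1 + 1 = 2 * (i + 1) by ring, dyadicPt_double, ← sub_sub]
    refine (hmono _ _ _ (min_le_min le_rfl ?_) (min_le_min le_rfl ?_)).trans ?_
    · rw [← dyadicPt_double]; exact dyadicPt_mono _ (Nat.le_succ _)
    · rw [← dyadicPt_double n (i + 1)]; exact dyadicPt_mono _ (Nat.le_succ _)
    · gcongr
      exact (dist_min_min_le t (dyadicPt_mono n (Nat.le_succ i))).trans (dist_dyadicPt_le n i)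
  have hlim : ∀ t, ∃ x, Tendsto (fun n => dyadicSum Ξ n t) atTop (𝓝 x) := fun t =>
    cauchySeq_tendsto_of_complete (cauchySeq_of_le_geometric _ C hr (hstep t))
  choose φ hφ using hlim
  have hle : ∀ a b, a ≤ b → ‖φ b - φ a - Ξ a b‖ ≤ sewConst θ * C * dist a b ^ θ := by
    intro a b hab
    have hT : Tendsto (fun n => sewConst θ * C * dist a b ^ θ + C * ((2 : ℝ) ^ (1 - θ)) ^ n) atTop
        (𝓝 (sewConst θ * C * dist a b ^ θ + C * 0)) :=
      tendsto_const_nhds.add ((tendsto_pow_atTop_nhds_zero_of_lt_one hr0.le hr).const_mul C)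
    rw [mul_zero, add_zero] at hT
    refine le_of_tendsto_of_tendsto' ((((hφ b).sub (hφ a)).sub_const (Ξ a b)).norm) hT fun n => ?_
    -- The dyadic partition clipped to `[a, b]`: its Riemann sum is compared with `Ξ a b` by the
    -- bound that is uniform in the number of cells.
    set Q : ℕ → Param := fun i => max a (min b (dyadicPt n i)) with hQ
    have hQm : Monotone Q := fun i j h =>
      max_le_max le_rfl (min_le_min le_rfl (dyadicPt_mono n h))
    have hQ0 : Q 0 = a := by
      simp only [hQ, dyadicPt_zero]
      rw [min_eq_right (show (0 : Param) ≤ b from b.2.1)]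
      exact max_eq_left (show (0 : Param) ≤ a from a.2.1)
    have hQ1 : Q (2 ^ n) = b := by
      simp only [hQ, dyadicPt_last]
      rw [min_eq_left (show b ≤ (1 : Param) from b.2.2), max_eq_right hab]
    have hsum := norm_sum_germ_sub_le hθ hC hdiag hmono (2 ^ n) Q hQm
    rw [hQ0, hQ1] at hsum
    -- Cells on either side of `a` cancel exactly. Only a cell with `a` in its interior leaves a
    -- term, which is a single defect and vanishes in the limit.
    have herr : ‖dyadicSum Ξ n b - dyadicSum Ξ n a
        - ∑ k ∈ Finset.range (2 ^ n), Ξ (Q k) (Q (k + 1))‖ ≤ C * ((2 : ℝ) ^ (1 - θ)) ^ n := by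
      unfold dyadicSum
      rw [← Finset.sum_sub_distrib, ← Finset.sum_sub_distrib, ← pow_rpow_geometric]
      refine norm_sum_le_of_le _ fun i _ => ?_
      have hsu := dyadicPt_mono n (Nat.le_succ i)
      have hd := dist_dyadicPt_le n i
      simp only [hQ]
      simp only [Nat.succ_eq_add_one] at hsu
      generalize dyadicPt n i = s at *
      generalize dyadicPt n (i + 1) = u at *
      have hpos : 0 ≤ C * ((1 / 2 : ℝ) ^ n) ^ θ := by positivity
      rcases le_total u a with h | h
      · rw [min_eq_right (hsu.trans (h.trans hab)), min_eq_right (h.trans hab),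
          min_eq_right (hsu.trans h), min_eq_right h, max_eq_left (hsu.trans h),
          max_eq_left h, hdiag]
        simpa using hpos
      rcases le_total a s with h' | h'
      · rw [min_eq_left h', min_eq_left h, max_eq_right (le_min hab h'),
          max_eq_right (le_min hab h), hdiag]
        simpa using hpos
      · rw [min_eq_right (h'.trans hab), min_eq_right h', min_eq_left h, max_eq_left h',
          max_eq_right (le_min hab h)]
        refine (hmono _ _ _ h' (le_min hab h)).trans ?_
        gcongr
        exact (dist_le_of_mem_Icc le_rfl (h'.trans (le_min hab h)) (min_le_right _ _)).trans hd
    calc _ = ‖(dyadicSum Ξ n b - dyadicSum Ξ n a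
            - ∑ k ∈ Finset.range (2 ^ n), Ξ (Q k) (Q (k + 1)))
          + ((∑ k ∈ Finset.range (2 ^ n), Ξ (Q k) (Q (k + 1))) - Ξ a b)‖ := by congr 1; abel
      _ ≤ _ := (norm_add_le _ _).trans (by linarith)
  refine ⟨φ, fun a b => ?_⟩
  rcases le_total a b with h | h
  · refine (hle a b h).trans ?_
    gcongr
    linarith
  · have h1 := hle b a h
    -- For `b ≤ a` the degenerate triple `a, b, a` relates `Ξ a b` to `-Ξ b a`; this is the `+ 1` in
    -- the constant.
    have h2 := hdef a b a (dist a b) le_rfl (dist_comm a b).ge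
      (by rw [dist_self]; exact dist_nonneg)
    rw [hdiag, dist_comm b a] at *
    calc _ = ‖-(φ a - φ b - Ξ b a) + (0 - Ξ a b - Ξ b a)‖ := by congr 1; abel
      _ ≤ _ := (norm_add_le _ _).trans (by rw [norm_neg]; linarith)

end Sewing

/-! ### Families of vectors of bounded size at bounded mutual distance -/

section Near

variable {ι E F G : Type*} [NormedAddCommGroup E] [NormedSpace ℝ E] [NormedAddCommGroup F]
  [NormedSpace ℝ F] [NormedAddCommGroup G] [NormedSpace ℝ G]

/-- The members of the family `p` have norm at most `S` and mutual distance at most `S * ε`. -/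
def Near (S ε : ℝ) (p : ι → E) : Prop := ∀ i j, ‖p i‖ ≤ S ∧ ‖p i - p j‖ ≤ S * ε

namespace Near

variable {S S' ε : ℝ} {p q : ι → E}

theorem mono (h : Near S ε p) (hε : 0 ≤ ε) (hS : S ≤ S') : Near S' ε p := fun i j =>
  ⟨(h i j).1.trans hS, (h i j).2.trans (mul_le_mul_of_nonneg_right hS hε)⟩

theorem mono_eps {ε' : ℝ} (h : Near S ε p) (hε : ε ≤ ε') : Near S ε' p := fun i j =>
  ⟨(h i j).1, (h i j).2.trans
    (mul_le_mul_of_nonneg_left hε ((norm_nonneg _).trans (h i j).1))⟩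

theorem add (h : Near S ε p) (h' : Near S' ε q) : Near (S + S') ε fun i => p i + q i :=
  fun i j => ⟨(norm_add_le _ _).trans (add_le_add (h i j).1 (h' i j).1), by
    rw [add_sub_add_comm, add_mul]
    exact (norm_add_le _ _).trans (add_le_add (h i j).2 (h' i j).2)⟩

theorem neg (h : Near S ε p) : Near S ε fun i => -p i := fun i j => by
  beta_reduce
  rw [norm_neg, neg_sub_neg]
  exact ⟨(h i j).1, (h j i).2⟩

theorem sub (h : Near S ε p) (h' : Near S' ε q) : Near (S + S') ε fun i => p i - q i := by
  simpa only [sub_eq_add_neg] using h.add h'.neg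

theorem const {v : E} (hv : ‖v‖ ≤ S) (hε : 0 ≤ ε) : Near S ε fun _ : ι => v := fun _ _ =>
  ⟨hv, by rw [sub_self, norm_zero]; exact mul_nonneg ((norm_nonneg _).trans hv) hε⟩

/-- The factor `2` is the product rule for the difference; the size alone would not need it. -/
theorem clm_apply {L : ι → E →L[ℝ] F} (h : Near S ε L) (h' : Near S' ε p) :
    Near (2 * S * S') ε fun i => L i (p i) := fun i j => by
  have hS : 0 ≤ S := (norm_nonneg _).trans (h i j).1
  have hS' : 0 ≤ S' := (norm_nonneg _).trans (h' i j).1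
  constructor
  · have := (L i).le_of_opNorm_le_of_le (h i j).1 (h' i j).1
    nlinarith [mul_nonneg hS hS']
  · have e : L i (p i) - L j (p j) = (L i - L j) (p i) + L j (p i - p j) := by
      simp
    rw [e]
    have h1 := (L i - L j).le_of_opNorm_le_of_le (h i j).2 (h' i j).1
    have h2 := (L j).le_of_opNorm_le_of_le (h j j).1 (h' i j).2
    exact (norm_add_le _ _).trans ((add_le_add h1 h2).trans (le_of_eq (by ring)))

theorem apply_unit {L : ι → E →L[ℝ] F} (h : Near S ε L) {v : E} (hv : ‖v‖ ≤ 1) :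
    Near S ε fun i => L i v := fun i j => by
  constructor
  · simpa using (L i).le_of_opNorm_le_of_le (h i j).1 hv
  · simpa using (L i - L j).le_of_opNorm_le_of_le (h i j).2 hv

theorem map_unit (h : Near S ε p) (L : E →L[ℝ] F) (hL : ‖L‖ ≤ 1) :
    Near S ε fun i => L (p i) := fun i j => by
  constructor
  · simpa using L.le_of_opNorm_le_of_le hL (h i j).1
  · rw [← map_sub]; simpa using L.le_of_opNorm_le_of_le hL (h i j).2

theorem clm_comp {L : ι → F →L[ℝ] G} {K : ι → E →L[ℝ] F} (h : Near S ε L) (h' : Near S' ε K) :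
    Near (2 * S * S') ε fun i => (L i).comp (K i) := fun i j => by
  have hS : 0 ≤ S := (norm_nonneg _).trans (h i j).1
  have hS' : 0 ≤ S' := (norm_nonneg _).trans (h' i j).1
  constructor
  · have := ((L i).opNorm_comp_le (K i)).trans
      (mul_le_mul (h i j).1 (h' i j).1 (norm_nonneg _) hS)
    nlinarith [mul_nonneg hS hS']
  · have e : (L i).comp (K i) - (L j).comp (K j)
        = (L i - L j).comp (K i) + (L j).comp (K i - K j) := by
      ext v; simp
    rw [e]
    have h1 := ((L i - L j).opNorm_comp_le (K i)).trans
      (mul_le_mul (h i j).2 (h' i j).1 (norm_nonneg _) ((norm_nonneg _).trans (h i j).2))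
    have h2 := ((L j).opNorm_comp_le (K i - K j)).trans
      (mul_le_mul (h j j).1 (h' i j).2 (norm_nonneg _) hS)
    exact (norm_add_le _ _).trans ((add_le_add h1 h2).trans (le_of_eq (by ring)))

theorem smul {a : ι → ℝ} (h : Near S ε a) (h' : Near S' ε p) :
    Near (2 * S * S') ε fun i => a i • p i := fun i j => by
  have hS : 0 ≤ S := (norm_nonneg _).trans (h i j).1
  have hS' : 0 ≤ S' := (norm_nonneg _).trans (h' i j).1
  constructor
  · rw [norm_smul]
    nlinarith [mul_nonneg hS hS', mul_le_mul (h i j).1 (h' i j).1 (norm_nonneg _) hS]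
  · have e : a i • p i - a j • p j = (a i - a j) • p i + a j • (p i - p j) := by
      rw [sub_smul, smul_sub]; abel
    rw [e]
    refine (norm_add_le _ _).trans ?_
    rw [norm_smul, norm_smul]
    have h1 := mul_le_mul (h i j).2 (h' i j).1 (norm_nonneg _) ((norm_nonneg _).trans (h i j).2)
    have h2 := mul_le_mul (h j j).1 (h' i j).2 (norm_nonneg _) hS
    exact (add_le_add h1 h2).trans (le_of_eq (by ring))

theorem sum_three {p : Fin 3 → ι → E} (h : ∀ k, Near S ε (p k)) :
    Near (3 * S) ε fun i => ∑ k, p k i := by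
  have := ((h 0).add (h 1)).add (h 2)
  simp only [Fin.sum_univ_three]
  convert this using 1
  ring

end Near

end Near

@[simp] theorem norm_stdVec (k : Fin 3) : ‖stdVec k‖ = 1 := by
  simp [stdVec]

theorem sum_coord_stdVec (v : Vec) : ∑ k, v k • stdVec k = v := by
  ext j
  fin_cases j <;> simp [stdVec, Fin.sum_univ_three]

/-! ### Families of rough paths and of controlled paths -/

/-- The Hölder weight `|ξ-η|^γ`. -/
def wt (γ : ℝ) (ξ η : Param) : ℝ := dist ξ η ^ γ

theorem wt_nonneg (γ : ℝ) (ξ η : Param) : 0 ≤ wt γ ξ η := Real.rpow_nonneg dist_nonneg _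

theorem dist_param_le_one (ξ η : Param) : dist ξ η ≤ 1 := by
  rw [Subtype.dist_eq, Real.dist_eq, abs_le]
  constructor <;> linarith [ξ.2.1, ξ.2.2, η.2.1, η.2.2]

theorem wt_le_one {γ : ℝ} (hγ : 0 ≤ γ) (ξ η : Param) : wt γ ξ η ≤ 1 :=
  Real.rpow_le_one dist_nonneg (dist_param_le_one ξ η) hγ

theorem wt_sq (γ : ℝ) (ξ η : Param) : dist ξ η ^ (2 * γ) = wt γ ξ η ^ 2 := by
  rw [wt, mul_comm, Real.rpow_mul dist_nonneg, Real.rpow_two]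

theorem rpow_three_mul (γ : ℝ) {D : ℝ} (hD : 0 ≤ D) : D ^ (3 * γ) = (D ^ γ) ^ 3 := by
  rw [mul_comm, Real.rpow_mul hD]
  norm_cast

section Families

variable {ι : Type*} {γ : ℝ} {E F G : Type*} [NormedAddCommGroup E] [NormedSpace ℝ E]
  [NormedAddCommGroup F] [NormedSpace ℝ F] [NormedAddCommGroup G] [NormedSpace ℝ G]

/-- A family of rough paths of size at most `S` and of mutual distance at most `S * ε`. -/
structure RoughFam (S ε : ℝ) (X : ι → RoughPath γ) : Prop where
  path : ∀ ξ η, Near (S * wt γ ξ η) ε fun i => (X i).path η - (X i).path ξ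
  area : ∀ ξ η k l, Near (S * wt γ ξ η ^ 2) ε fun i => (X i).area ξ η k l

/-- A family of controlled paths of size at most `S` and of mutual distance at most `S * ε`. -/
structure CtrlFam (γ S ε : ℝ) (x : ι → Param → Vec) (Y : ι → Param → E)
    (Y' : ι → Param → Vec →L[ℝ] E) : Prop where
  der : ∀ ξ, Near S ε fun i => Y' i ξ
  inc : ∀ ξ η, Near (S * wt γ ξ η) ε fun i => Y' i η - Y' i ξ
  rem : ∀ ξ η, Near (S * wt γ ξ η ^ 2) ε fun i => Y i η - Y i ξ - Y' i ξ (x i η - x i ξ)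

theorem RoughFam.mono_eps {S ε ε' : ℝ} {X : ι → RoughPath γ} (h : RoughFam S ε X) (hε : ε ≤ ε') :
    RoughFam S ε' X :=
  ⟨fun ξ η => (h.path ξ η).mono_eps hε, fun ξ η k l => (h.area ξ η k l).mono_eps hε⟩

theorem CtrlFam.mono {S S' ε : ℝ} {x : ι → Param → Vec} {Y : ι → Param → E}
    {Y' : ι → Param → Vec →L[ℝ] E} (h : CtrlFam γ S ε x Y Y') (hε : 0 ≤ ε) (hS : S ≤ S') :
    CtrlFam γ S' ε x Y Y' :=
  ⟨fun ξ => (h.der ξ).mono hε hS,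
    fun ξ η => (h.inc ξ η).mono hε (mul_le_mul_of_nonneg_right hS (wt_nonneg _ _ _)),
    fun ξ η => (h.rem ξ η).mono hε (mul_le_mul_of_nonneg_right hS (sq_nonneg _))⟩

theorem CtrlFam.mono_eps {S ε ε' : ℝ} {x : ι → Param → Vec} {Y : ι → Param → E}
    {Y' : ι → Param → Vec →L[ℝ] E} (h : CtrlFam γ S ε x Y Y') (hε : ε ≤ ε') :
    CtrlFam γ S ε' x Y Y' :=
  ⟨fun ξ => (h.der ξ).mono_eps hε, fun ξ η => (h.inc ξ η).mono_eps hε,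
    fun ξ η => (h.rem ξ η).mono_eps hε⟩

/-- The increments of controlled paths. -/
theorem CtrlFam.increment (hγ : 0 ≤ γ) {S M ε : ℝ} (hε : 0 ≤ ε) (hM : 0 ≤ M)
    {X : ι → RoughPath γ} {Y : ι → Param → E}
    {Y' : ι → Param → Vec →L[ℝ] E} (hX : RoughFam S ε X)
    (h : CtrlFam γ M ε (fun i => (X i).path) Y Y') (ξ η : Param) :
    Near ((2 * S + 1) * M * wt γ ξ η) ε fun i => Y i η - Y i ξ := by
  have := ((h.der ξ).clm_apply (hX.path ξ η)).add (h.rem ξ η)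
  simp only [add_sub_cancel] at this
  refine this.mono hε ?_
  have hw := wt_nonneg γ ξ η
  have h1 := wt_le_one hγ ξ η
  nlinarith [mul_nonneg hM (mul_nonneg hw (sub_nonneg.2 h1))]

/-! ### The germ of a rough integral and its defect of additivity -/

theorem roughTerm_self {XX : Param → Param → Matrix (Fin 3) (Fin 3) ℝ}
    (hXX : ∀ a, XX a a = 0) (f : Param → Vec →L[ℝ] F) (f' : Param → Vec →L[ℝ] Vec →L[ℝ] F)
    (g : Param → Vec) (g' : Param → Vec →L[ℝ] Vec) (a : Param) :
    roughTerm XX f f' g g' a a = 0 := by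
  simp [roughTerm, hXX]

theorem RoughPath.area_self (X : RoughPath γ) (a : Param) : X.area a a = 0 := by
  ext i j
  have := X.area_compat a a a i j
  simpa using this

/-- The defect of additivity of the germ of a rough integral. -/
theorem roughTerm_defect (X : RoughPath γ) (f : Param → Vec →L[ℝ] F)
    (f' : Param → Vec →L[ℝ] Vec →L[ℝ] F)
    (g : Param → Vec) (g' : Param → Vec →L[ℝ] Vec) (a b c : Param) :
    roughTerm X.area f f' g g' a c - roughTerm X.area f f' g g' a b
        - roughTerm X.area f f' g g' b c
      = (∑ k, ∑ l, X.area b c k l • ((f' a - f' b) (stdVec k) (g' a (stdVec l))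
          + f' b (stdVec k) ((g' a - g' b) (stdVec l))))
        - ((f b - f a - f' a (X.path b - X.path a)) (g c - g b)
          + f' a (X.path b - X.path a) ((g c - g b - g' b (X.path c - X.path b))
              + (g' b - g' a) (X.path c - X.path b))) := by
  -- Chen's relation, with both factors of the product reversed in sign.
  have hXX : ∀ k l, X.area a c k l = X.area a b k l + X.area b c k l
      + (X.path b - X.path a) k * (X.path c - X.path b) l := fun k l => by
    have := X.area_compat a b c k l
    simp only [PiLp.sub_apply]
    linarith
  -- Expanding in the basis turns the product of increments in Chen's relation into `f'_a` applied
  -- to the increments. It then cancels the first-order parts of `f` and `g` and leaves only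
  -- remainders.
  have hexp : ∀ u v : Vec, ∑ k, ∑ l, (u k * v l) • f' a (stdVec k) (g' a (stdVec l))
      = f' a u (g' a v) := fun u v => by
    conv_rhs => rw [← sum_coord_stdVec u, ← sum_coord_stdVec v]
    simp only [map_sum, map_smul, sum_apply, smul_apply,
      Finset.smul_sum, smul_smul]
    rw [Finset.sum_comm]
    exact Finset.sum_congr rfl fun _ _ => Finset.sum_congr rfl fun _ _ => by rw [mul_comm]
  have hsum : ∑ k, ∑ l, X.area a c k l • f' a (stdVec k) (g' a (stdVec l))
      = (∑ k, ∑ l, X.area a b k l • f' a (stdVec k) (g' a (stdVec l)))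
        + (∑ k, ∑ l, X.area b c k l • f' a (stdVec k) (g' a (stdVec l)))
        + f' a (X.path b - X.path a) (g' a (X.path c - X.path b)) := by
    rw [← hexp]
    simp only [hXX, add_smul, Finset.sum_add_distrib]
  have hsum2 : (∑ k, ∑ l, X.area b c k l • ((f' a - f' b) (stdVec k) (g' a (stdVec l))
          + f' b (stdVec k) ((g' a - g' b) (stdVec l))))
      = (∑ k, ∑ l, X.area b c k l • f' a (stdVec k) (g' a (stdVec l)))
        - ∑ k, ∑ l, X.area b c k l • f' b (stdVec k) (g' b (stdVec l)) := by
    simp only [← Finset.sum_sub_distrib, ← smul_sub]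
    refine Finset.sum_congr rfl fun k _ => Finset.sum_congr rfl fun l _ => ?_
    congr 1
    simp
  simp only [roughTerm]
  rw [hsum, hsum2]
  simp only [sub_apply, map_sub, map_add]
  abel

/-- The constant in the bound of the defect. -/
def defectConst (S : ℝ) : ℝ :=
  72 * S ^ 2 + (2 * ((2 * S + 1) * S) + 4 * S * (S + 2 * S * S))

theorem defectConst_nonneg {S : ℝ} (hS : 0 ≤ S) : 0 ≤ defectConst S := by
  unfold defectConst; positivity

theorem Near.scale {ε : ℝ} {p : ι → E} {w H K : ℝ} (h : Near (K * w) ε p) (hε : 0 ≤ ε)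
    (hK : 0 ≤ K) (hw : w ≤ H) : Near (K * H) ε p :=
  h.mono hε (mul_le_mul_of_nonneg_left hw hK)

/-- Every summand of the defect carries three Hölder weights: a remainder times an increment, or an
area times an increment of a derivative. Hence the order `3 * γ`. The bound is linear in the size
`M` of the integrand, so small kernels give small integrals. -/
theorem near_defect (hγ : 0 ≤ γ) {S M ε : ℝ} (hε : 0 ≤ ε) (hS : 0 ≤ S) (hM : 0 ≤ M)
    {X : ι → RoughPath γ} (hX : RoughFam S ε X)
    {f : ι → Param → Vec →L[ℝ] F} {f' : ι → Param → Vec →L[ℝ] Vec →L[ℝ] F}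
    {g : ι → Param → Vec} {g' : ι → Param → Vec →L[ℝ] Vec}
    (hf : CtrlFam γ M ε (fun i => (X i).path) f f')
    (hg : CtrlFam γ S ε (fun i => (X i).path) g g') {a b c : Param} {D : ℝ}
    (hab : dist a b ≤ D) (hbc : dist b c ≤ D) :
    Near (defectConst S * M * (D ^ γ) ^ 3) ε fun i =>
      roughTerm (X i).area (f i) (f' i) (g i) (g' i) a c
        - roughTerm (X i).area (f i) (f' i) (g i) (g' i) a b
        - roughTerm (X i).area (f i) (f' i) (g i) (g' i) b c := by
  simp only [roughTerm_defect]
  set H := D ^ γ with hH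
  have hH0 : 0 ≤ H := Real.rpow_nonneg (dist_nonneg.trans hab) _
  have h1 : wt γ a b ≤ H := Real.rpow_le_rpow dist_nonneg hab hγ
  have h2 : wt γ b c ≤ H := Real.rpow_le_rpow dist_nonneg hbc hγ
  have h1' : wt γ a b ^ 2 ≤ H ^ 2 := pow_le_pow_left₀ (wt_nonneg _ _ _) h1 2
  have h2' : wt γ b c ^ 2 ≤ H ^ 2 := pow_le_pow_left₀ (wt_nonneg _ _ _) h2 2
  have xab := (hX.path a b).scale hε hS h1
  have xbc := (hX.path b c).scale hε hS h2
  have A := fun k l => (hX.area b c k l).scale hε hS h2'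
  have fR := (hf.rem a b).scale hε hM h1'
  have gR := (hg.rem b c).scale hε hS h2'
  have gI := (CtrlFam.increment hγ hε hS hX hg b c).scale hε (by positivity) h2
  have fd := (hf.inc a b).scale hε hM h1
  have fd' : Near (M * H) ε fun i => f' i a - f' i b := by
    simpa using fd.neg
  have gd := (hg.inc a b).scale hε hS h1
  have gd' : Near (S * H) ε fun i => g' i a - g' i b := by
    simpa using gd.neg
  have T1 := fR.clm_apply gI
  have T2 := ((hf.der a).clm_apply xab).clm_apply (gR.add (gd.clm_apply xbc))
  have T3 : ∀ k l, Near _ ε _ := fun k l =>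
    (A k l).smul (((fd'.apply_unit (norm_stdVec k).le).clm_apply
      ((hg.der a).apply_unit (norm_stdVec l).le)).add
      (((hf.der b).apply_unit (norm_stdVec k).le).clm_apply
        (gd'.apply_unit (norm_stdVec l).le)))
  have T := (Near.sum_three fun k => Near.sum_three fun l => T3 k l).sub (T1.add T2)
  refine T.mono hε (le_of_eq ?_)
  unfold defectConst
  ring

/-- The constant in the estimate of rough integrals. -/
def integralConst (γ S : ℝ) : ℝ := (sewConst (3 * γ) + 1) * defectConst S

theorem integralConst_nonneg {γ S : ℝ} (hγ : 1 / 3 < γ) (hS : 0 ≤ S) : 0 ≤ integralConst γ S :=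
  mul_nonneg (by linarith [sewConst_pos (θ := 3 * γ) (by linarith)]) (defectConst_nonneg hS)

/-- The size follows by sewing each germ. For the mutual distance the difference of two germs is
sewn, with a constant proportional to `ε`; by uniqueness of sewing its primitive has the increments
of `φ i - φ j`. -/
theorem exists_roughIntegral [CompleteSpace F] (hγ : 1 / 3 < γ) {S M ε : ℝ} (hε : 0 ≤ ε)
    (hS : 0 ≤ S) (hM : 0 ≤ M) {X : ι → RoughPath γ} (hX : RoughFam S ε X)
    {f : ι → Param → Vec →L[ℝ] F} {f' : ι → Param → Vec →L[ℝ] Vec →L[ℝ] F}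
    {g : ι → Param → Vec} {g' : ι → Param → Vec →L[ℝ] Vec}
    (hf : CtrlFam γ M ε (fun i => (X i).path) f f')
    (hg : CtrlFam γ S ε (fun i => (X i).path) g g') :
    ∃ φ : ι → Param → F,
      (∀ i a b, HasRoughIntegral (X i).area (f i) (f' i) (g i) (g' i) a b (φ i b - φ i a)) ∧
      ∀ a b, Near (integralConst γ S * M * wt γ a b ^ 3) ε fun i =>
        φ i b - φ i a - roughTerm (X i).area (f i) (f' i) (g i) (g' i) a b := by
  have hθ : 1 < 3 * γ := by linarith
  have hγ0 : 0 ≤ γ := by linarith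
  have hd := defectConst_nonneg hS
  set Ξ : ι → Param → Param → F := fun i => roughTerm (X i).area (f i) (f' i) (g i) (g' i) with hΞ
  have hdiag : ∀ i a, Ξ i a a = 0 := fun i a => roughTerm_self (X i).area_self _ _ _ _ a
  have hdef : ∀ {a b c : Param} {D : ℝ}, dist a b ≤ D → dist b c ≤ D →
      Near (defectConst S * M * (D ^ γ) ^ 3) ε fun i => Ξ i a c - Ξ i a b - Ξ i b c :=
    fun h1 h2 => near_defect hγ0 hε hS hM hX hf hg h1 h2
  have hex : ∀ i, ∃ φ : Param → F, ∀ a b, ‖φ b - φ a - Ξ i a b‖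
      ≤ (sewConst (3 * γ) + 1) * (defectConst S * M) * dist a b ^ (3 * γ) := fun i =>
    exists_sewing hθ (by positivity) (hdiag i) fun a b c D h1 h2 _ => by
      rw [rpow_three_mul γ (dist_nonneg.trans h1)]
      exact (hdef h1 h2 i i).1
  choose φ hφ using hex
  have hint : ∀ i a b, HasSewing (Ξ i) a b (φ i b - φ i a) := fun i =>
    hasSewing_of_additive hθ (hφ i)
  refine ⟨φ, hint, fun a b i j => ⟨?_, ?_⟩⟩
  · refine (hφ i a b).trans (le_of_eq ?_)
    rw [rpow_three_mul γ dist_nonneg, integralConst, wt]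
    ring
  · obtain ⟨ψ, hψ⟩ := exists_sewing (Ξ := fun a b => Ξ i a b - Ξ j a b)
      (C := defectConst S * M * ε) hθ (by positivity) (fun a => by simp [hdiag])
      fun a b c D h1 h2 _ => by
        rw [rpow_three_mul γ (dist_nonneg.trans h1)]
        have := (hdef h1 h2 i j).2
        beta_reduce at this
        refine (le_of_eq ?_).trans (this.trans (le_of_eq ?_))
        · congr 1; abel
        · ring
    have hu := (hasSewing_of_additive hθ hψ a b).unique ((hint i a b).sub (hint j a b))
    have := hψ a b
    rw [hu] at this
    rw [sub_sub_sub_comm]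
    refine this.trans (le_of_eq ?_)
    rw [rpow_three_mul γ dist_nonneg, integralConst, wt]
    ring

end Families

/-! ### Composition of controlled paths with smooth functions -/

section Smooth

variable {ι : Type*} {γ : ℝ} {E : Type*} [NormedAddCommGroup E] [NormedSpace ℝ E]

/-- The bound on second differences of a function with bounded Lipschitz derivative. -/
def TwoLip (M : ℝ) (g : Vec → E) : Prop := ∀ a b a' b',
  ‖g a - g b - (g a' - g b')‖ ≤ M * (‖a - b - (a' - b')‖ + (‖a - a'‖ + ‖b - b'‖) * ‖a' - b'‖)

theorem hasDerivWithinAt_segment {g : Vec → E} {g1 : Vec → Vec →L[ℝ] E}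
    (hg : ∀ x, HasFDerivAt g (g1 x) x) (b u : Vec) (s : Set ℝ) (τ : ℝ) :
    HasDerivWithinAt (fun τ : ℝ => g (b + τ • u)) (g1 (b + τ • u) u) s τ := by
  have h1 : HasDerivAt (fun τ : ℝ => b + τ • u) u τ := by
    simpa using ((hasDerivAt_id τ).smul_const u).const_add b
  exact ((hg _).comp_hasDerivAt τ h1).hasDerivWithinAt

theorem norm_sub_segment_le {τ : ℝ} (h0 : 0 ≤ τ) (h1 : τ ≤ 1) (b b' u u' : Vec) :
    ‖b + τ • u - (b' + τ • u')‖ ≤ ‖b + u - (b' + u')‖ + ‖b - b'‖ := by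
  have e : b + τ • u - (b' + τ • u') = τ • (b + u - (b' + u')) + (1 - τ) • (b - b') := by
    simp only [smul_sub, smul_add, sub_smul, one_smul]; abel
  rw [e]
  refine (norm_add_le _ _).trans ?_
  rw [norm_smul, norm_smul, Real.norm_of_nonneg h0, Real.norm_of_nonneg (sub_nonneg.2 h1)]
  nlinarith [norm_nonneg (b + u - (b' + u')), norm_nonneg (b - b')]

/-- Mean value inequality along the two segments `[b, a]` and `[b', a']` run simultaneously. -/
theorem twoLip_of_hasFDerivAt {M : ℝ} {g : Vec → E} {g1 : Vec → Vec →L[ℝ] E}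
    (hg : ∀ x, HasFDerivAt g (g1 x) x) (hb : ∀ x, ‖g1 x‖ ≤ M)
    (hl : ∀ x y, ‖g1 x - g1 y‖ ≤ M * ‖x - y‖) : TwoLip M g := by
  intro a b a' b'
  have hM : 0 ≤ M := (norm_nonneg _).trans (hb 0)
  set u := a - b with hu
  set u' := a' - b' with hu'
  have ea : a = b + u := by rw [hu]; abel
  have ea' : a' = b' + u' := by rw [hu']; abel
  have key := norm_image_sub_le_of_norm_deriv_le_segment_01'
    (f := fun τ : ℝ => g (b + τ • u) - g (b' + τ • u'))
    (f' := fun τ => g1 (b + τ • u) u - g1 (b' + τ • u') u')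
    (C := M * (‖u - u'‖ + (‖a - a'‖ + ‖b - b'‖) * ‖u'‖))
    (fun τ _ => (hasDerivWithinAt_segment hg b u _ τ).sub (hasDerivWithinAt_segment hg b' u' _ τ))
    (fun τ hτ => by
      have e : g1 (b + τ • u) u - g1 (b' + τ • u') u'
          = g1 (b + τ • u) (u - u') + (g1 (b + τ • u) - g1 (b' + τ • u')) u' := by
        simp
      rw [e]
      have h1 := (g1 (b + τ • u)).le_of_opNorm_le (hb _) (u - u')
      have h2 := (g1 (b + τ • u) - g1 (b' + τ • u')).le_of_opNorm_le (hl _ _) u'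
      have h3 := norm_sub_segment_le hτ.1 hτ.2.le b b' u u'
      rw [← ea, ← ea'] at h3
      refine (norm_add_le _ _).trans ((add_le_add h1 h2).trans ?_)
      rw [mul_add, ← mul_assoc]
      gcongr)
  refine le_trans (le_of_eq ?_) key
  simp only [one_smul, zero_smul, add_zero, ← ea, ← ea']
  congr 1
  abel

theorem norm_taylor_le {M : ℝ} {g : Vec → E} {g1 : Vec → Vec →L[ℝ] E}
    (hg : ∀ x, HasFDerivAt g (g1 x) x)
    (hl : ∀ x y, ‖g1 x - g1 y‖ ≤ M * ‖x - y‖) (a b : Vec) :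
    ‖g a - g b - g1 b (a - b)‖ ≤ M * ‖a - b‖ ^ 2 := by
  set u := a - b with hu
  have ea : a = b + u := by rw [hu]; abel
  have hM : 0 ≤ M * ‖u‖ := (norm_nonneg _).trans (hl a b)
  have key := norm_image_sub_le_of_norm_deriv_le_segment_01'
    (f := fun τ : ℝ => g (b + τ • u) - τ • g1 b u)
    (f' := fun τ => g1 (b + τ • u) u - (1 : ℝ) • g1 b u)
    (C := M * ‖u‖ ^ 2)
    (fun τ _ => (hasDerivWithinAt_segment hg b u _ τ).sub
      ((hasDerivWithinAt_id τ _).smul_const _))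
    (fun τ hτ => by
      rw [one_smul, ← sub_apply]
      refine ((g1 (b + τ • u) - g1 b).le_of_opNorm_le (hl _ _) u).trans ?_
      rw [add_sub_cancel_left, norm_smul, Real.norm_of_nonneg hτ.1]
      have := mul_le_mul_of_nonneg_right hτ.2.le (mul_nonneg hM (norm_nonneg u))
      nlinarith)
  refine le_trans (le_of_eq ?_) key
  simp only [one_smul, zero_smul, add_zero, ← ea]
  congr 1
  abel

/-- Taylor remainders are compared along two segments run simultaneously; second differences of `g1`
are needed for this. The first alternative in `h2` serves families with `ε = 0`, where the points
coincide and one derivative less is required. -/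
theorem norm_taylor_sub_le {M : ℝ} (hM : 0 ≤ M) {g : Vec → E} {g1 : Vec → Vec →L[ℝ] E}
    (hg : ∀ x, HasFDerivAt g (g1 x) x)
    (hl : ∀ x y, ‖g1 x - g1 y‖ ≤ M * ‖x - y‖) {a b a' b' : Vec}
    (h2 : (a = a' ∧ b = b') ∨ TwoLip M g1) :
    ‖g a - g b - g1 b (a - b) - (g a' - g b' - g1 b' (a' - b'))‖
      ≤ M * ((‖a - b - (a' - b')‖ + (‖a - a'‖ + 2 * ‖b - b'‖) * ‖a' - b'‖) * ‖a - b‖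
          + ‖a' - b'‖ * ‖a - b - (a' - b')‖) := by
  rcases h2 with ⟨rfl, rfl⟩ | h2
  · rw [sub_self, norm_zero]; positivity
  set u := a - b with hu
  set u' := a' - b' with hu'
  have ea : a = b + u := by rw [hu]; abel
  have ea' : a' = b' + u' := by rw [hu']; abel
  have key := norm_image_sub_le_of_norm_deriv_le_segment_01'
    (f := fun τ : ℝ => (g (b + τ • u) - τ • g1 b u) - (g (b' + τ • u') - τ • g1 b' u'))
    (f' := fun τ => (g1 (b + τ • u) u - (1 : ℝ) • g1 b u)
      - (g1 (b' + τ • u') u' - (1 : ℝ) • g1 b' u'))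
    (C := M * ((‖u - u'‖ + (‖a - a'‖ + 2 * ‖b - b'‖) * ‖u'‖) * ‖u‖ + ‖u'‖ * ‖u - u'‖))
    (fun τ _ => ((hasDerivWithinAt_segment hg b u _ τ).sub
      ((hasDerivWithinAt_id τ _).smul_const _)).sub ((hasDerivWithinAt_segment hg b' u' _ τ).sub
      ((hasDerivWithinAt_id τ _).smul_const _)))
    (fun τ hτ => by
      have e : (g1 (b + τ • u) u - (1 : ℝ) • g1 b u) - (g1 (b' + τ • u') u' - (1 : ℝ) • g1 b' u')
          = (g1 (b + τ • u) - g1 b - (g1 (b' + τ • u') - g1 b')) u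
            + (g1 (b' + τ • u') - g1 b') (u - u') := by
        simp only [one_smul, sub_apply, map_sub]; abel
      rw [e]
      have h3 := norm_sub_segment_le hτ.1 hτ.2.le b b' u u'
      rw [← ea, ← ea'] at h3
      have e1 : b + τ • u - b - (b' + τ • u' - b') = τ • (u - u') := by
        rw [add_sub_cancel_left, add_sub_cancel_left]; exact (smul_sub τ u u').symm
      have e2 : b' + τ • u' - b' = τ • u' := add_sub_cancel_left _ _
      have n1 : ‖τ • (u - u')‖ ≤ ‖u - u'‖ := by
        rw [norm_smul, Real.norm_of_nonneg hτ.1]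
        exact mul_le_of_le_one_left (norm_nonneg _) hτ.2.le
      have n2 : ‖τ • u'‖ ≤ ‖u'‖ := by
        rw [norm_smul, Real.norm_of_nonneg hτ.1]
        exact mul_le_of_le_one_left (norm_nonneg _) hτ.2.le
      have t1 := h2 (b + τ • u) b (b' + τ • u') b'
      rw [e1, e2] at t1
      have t1' : ‖g1 (b + τ • u) - g1 b - (g1 (b' + τ • u') - g1 b')‖
          ≤ M * (‖u - u'‖ + (‖a - a'‖ + 2 * ‖b - b'‖) * ‖u'‖) := by
        exact t1.trans (mul_le_mul_of_nonneg_left (add_le_add n1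
          (mul_le_mul (by linarith) n2 (norm_nonneg _) (by positivity))) hM)
      have t2 : ‖g1 (b' + τ • u') - g1 b'‖ ≤ M * ‖u'‖ := by
        refine (hl _ _).trans ?_
        rw [e2]
        gcongr
      have h4 := (g1 (b + τ • u) - g1 b - (g1 (b' + τ • u') - g1 b')).le_of_opNorm_le t1' u
      have h5 := (g1 (b' + τ • u') - g1 b').le_of_opNorm_le t2 (u - u')
      refine (norm_add_le _ _).trans ((add_le_add h4 h5).trans (le_of_eq ?_))
      ring)
  refine le_trans (le_of_eq ?_) key
  simp only [one_smul, zero_smul, add_zero, sub_zero, ← ea, ← ea']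
  congr 1
  abel

/-- A family of functions `g i` with derivatives `g1 i`, of size at most `M` and of mutual
distance at most `M * ε`; for `ε ≠ 0` the second differences of the derivatives are controlled. -/
structure SmoothFam (M ε : ℝ) (g : ι → Vec → E) (g1 : ι → Vec → Vec →L[ℝ] E) : Prop where
  hasFDeriv : ∀ i x, HasFDerivAt (g i) (g1 i x) x
  bound : ∀ i x, ‖g1 i x‖ ≤ M
  lip : ∀ i x y, ‖g1 i x - g1 i y‖ ≤ M * ‖x - y‖
  two : ε = 0 ∨ ∀ i, TwoLip M (g1 i)
  close : ∀ i j x, ‖g1 i x - g1 j x‖ ≤ M * ε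
  close_lip : ∀ i j x y, ‖g1 i x - g1 j x - (g1 i y - g1 j y)‖ ≤ M * ε * ‖x - y‖

/-- The constant for the composition with a smooth function. -/
def compConst (S : ℝ) : ℝ :=
  2 * (S + 1) * S + (2 * ((2 * S + 1) * S * (2 * S + 2)) * S + 2 * (S + 1) * S)
    + (((2 * S + 1) * S) ^ 2 * (3 * S + 3) + 2 * (S + 1) * S)

theorem compConst_nonneg {S : ℝ} (hS : 0 ≤ S) : 0 ≤ compConst S := by
  unfold compConst; positivity

/-- The remainder of `g(Y)` is the second-order Taylor remainder of `g` along the increment of `Y`,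
plus `g1(Y)` applied to the remainder of `Y`. The estimates are linear in `M`. -/
theorem SmoothFam.comp {M ε S : ℝ} (hγ : 0 ≤ γ) (hε : 0 ≤ ε) (hS : 0 ≤ S) (hM : 0 ≤ M)
    {g : ι → Vec → E} {g1 : ι → Vec → Vec →L[ℝ] E} (hg : SmoothFam M ε g g1)
    {X : ι → RoughPath γ} (hX : RoughFam S ε X) {Y : ι → Param → Vec}
    {Y' : ι → Param → Vec →L[ℝ] Vec} (hY : CtrlFam γ S ε (fun i => (X i).path) Y Y')
    (hsup : ∀ i j ξ, ‖Y i ξ - Y j ξ‖ ≤ S * ε) :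
    CtrlFam γ (compConst S * M) ε (fun i => (X i).path) (fun i ξ => g i (Y i ξ))
      (fun i ξ => (g1 i (Y i ξ)).comp (Y' i ξ)) := by
  set K := (2 * S + 1) * S with hK
  have hK0 : 0 ≤ K := by positivity
  have hinc : ∀ ξ η, Near (K * wt γ ξ η) ε fun i => Y i η - Y i ξ :=
    CtrlFam.increment hγ hε hS hX hY
  -- If `ε = 0`, all members of the family are the same path by `hsup`.
  have htwo : ∀ i j ξ η, (Y i ξ = Y j ξ ∧ Y i η = Y j η) ∨ TwoLip M (g1 i) := by
    intro i j ξ η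
    rcases hg.two with h | h
    · left
      have hz : ∀ ξ, Y i ξ = Y j ξ := fun ξ => by
        have := hsup i j ξ
        rw [h, mul_zero] at this
        exact sub_eq_zero.1 (norm_le_zero_iff.1 this)
      exact ⟨hz ξ, hz η⟩
    · exact Or.inr (h i)
  have d1 : ∀ ξ, Near (M * (S + 1)) ε fun i => g1 i (Y i ξ) := fun ξ i j => by
    constructor
    · nlinarith [hg.bound i (Y i ξ), mul_nonneg hM hS]
    · have e : g1 i (Y i ξ) - g1 j (Y j ξ)
          = (g1 i (Y i ξ) - g1 i (Y j ξ)) + (g1 i (Y j ξ) - g1 j (Y j ξ)) := by abel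
      beta_reduce
      rw [e]
      refine (norm_add_le _ _).trans ((add_le_add (hg.lip i _ _) (hg.close i j _)).trans ?_)
      have := mul_le_mul_of_nonneg_left (hsup i j ξ) hM
      linarith
  have d2 : ∀ ξ η, Near (M * (K * (2 * S + 2)) * wt γ ξ η) ε
      fun i => g1 i (Y i η) - g1 i (Y i ξ) := fun ξ η i j => by
    have hw := wt_nonneg γ ξ η
    have hi := (hinc ξ η i j).1
    have hj := (hinc ξ η j j).1
    have hij := (hinc ξ η i j).2
    beta_reduce at hi hj hij ⊢
    constructor
    · refine (hg.lip i _ _).trans ?_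
      have h1 := mul_le_mul_of_nonneg_left hi hM
      have h2 : 0 ≤ M * K * wt γ ξ η := by positivity
      nlinarith [mul_nonneg h2 hS]
    -- The difference is split into one function on two paths, controlled by second differences, and
    -- two functions on one path, controlled by `close_lip`. The same splitting is used for `d3`.
    · have e : g1 i (Y i η) - g1 i (Y i ξ) - (g1 j (Y j η) - g1 j (Y j ξ))
          = (g1 i (Y i η) - g1 i (Y i ξ) - (g1 i (Y j η) - g1 i (Y j ξ)))
            + (g1 i (Y j η) - g1 j (Y j η) - (g1 i (Y j ξ) - g1 j (Y j ξ))) := by abel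
      rw [e]
      have t1 : ‖g1 i (Y i η) - g1 i (Y i ξ) - (g1 i (Y j η) - g1 i (Y j ξ))‖
          ≤ M * (K * wt γ ξ η * ε + (S * ε + S * ε) * (K * wt γ ξ η)) := by
        rcases htwo i j ξ η with ⟨h, h'⟩ | h
        · rw [h, h', sub_self, norm_zero]; positivity
        · refine (h _ _ _ _).trans ?_
          gcongr
          · exact hsup i j η
          · exact hsup i j ξ
      have t2 := (hg.close_lip i j (Y j η) (Y j ξ)).trans
        (mul_le_mul_of_nonneg_left hj (mul_nonneg hM hε))
      refine (norm_add_le _ _).trans ((add_le_add t1 t2).trans (le_of_eq (by ring)))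
  have d3 : ∀ ξ η, Near (M * (K ^ 2 * (3 * S + 3)) * wt γ ξ η ^ 2) ε
      fun i => g i (Y i η) - g i (Y i ξ) - g1 i (Y i ξ) (Y i η - Y i ξ) := fun ξ η i j => by
    have hw := wt_nonneg γ ξ η
    have hi := (hinc ξ η i j).1
    have hj := (hinc ξ η j j).1
    have hij := (hinc ξ η i j).2
    beta_reduce at hi hj hij ⊢
    constructor
    · refine (norm_taylor_le (hg.hasFDeriv i) (hg.lip i) _ _).trans ?_
      have h1 := mul_le_mul_of_nonneg_left (pow_le_pow_left₀ (norm_nonneg _) hi 2) hM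
      have h2 : 0 ≤ M * K ^ 2 * wt γ ξ η ^ 2 := by positivity
      nlinarith [mul_nonneg h2 hS]
    · have e : g i (Y i η) - g i (Y i ξ) - g1 i (Y i ξ) (Y i η - Y i ξ)
            - (g j (Y j η) - g j (Y j ξ) - g1 j (Y j ξ) (Y j η - Y j ξ))
          = (g i (Y i η) - g i (Y i ξ) - g1 i (Y i ξ) (Y i η - Y i ξ)
            - (g i (Y j η) - g i (Y j ξ) - g1 i (Y j ξ) (Y j η - Y j ξ)))
            + ((g i (Y j η) - g j (Y j η)) - (g i (Y j ξ) - g j (Y j ξ))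
              - (g1 i (Y j ξ) - g1 j (Y j ξ)) (Y j η - Y j ξ)) := by
        rw [sub_apply]; abel
      rw [e]
      have t1 : ‖g i (Y i η) - g i (Y i ξ) - g1 i (Y i ξ) (Y i η - Y i ξ)
            - (g i (Y j η) - g i (Y j ξ) - g1 i (Y j ξ) (Y j η - Y j ξ))‖
          ≤ M * ((K * wt γ ξ η * ε + (S * ε + 2 * (S * ε)) * (K * wt γ ξ η)) * (K * wt γ ξ η)
            + (K * wt γ ξ η) * (K * wt γ ξ η * ε)) := by
        refine (norm_taylor_sub_le hM (hg.hasFDeriv i) (hg.lip i) (htwo i j η ξ)).trans ?_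
        gcongr
        · exact hsup i j η
        · exact hsup i j ξ
      have t2 := (norm_taylor_le (g := fun x => g i x - g j x) (g1 := fun x => g1 i x - g1 j x)
        (fun x => (hg.hasFDeriv i x).sub (hg.hasFDeriv j x)) (hg.close_lip i j) (Y j η) (Y j ξ)).trans
        (mul_le_mul_of_nonneg_left (pow_le_pow_left₀ (norm_nonneg _) hj 2) (mul_nonneg hM hε))
      refine (norm_add_le _ _).trans ((add_le_add t1 t2).trans (le_of_eq (by ring)))
  have hc1 : 0 ≤ 2 * (S + 1) * S := by positivity
  have hc2 : 0 ≤ 2 * ((2 * S + 1) * S * (2 * S + 2)) * S + 2 * (S + 1) * S := by positivity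
  have hc3 : 0 ≤ ((2 * S + 1) * S) ^ 2 * (3 * S + 3) + 2 * (S + 1) * S := by positivity
  refine ⟨fun ξ => ?_, fun ξ η => ?_, fun ξ η => ?_⟩
  · refine ((d1 ξ).clm_comp (hY.der ξ)).mono hε ?_
    have := mul_nonneg hM (add_nonneg hc2 hc3)
    unfold compConst
    linarith
  · have e : ∀ i, (g1 i (Y i η)).comp (Y' i η) - (g1 i (Y i ξ)).comp (Y' i ξ)
        = (g1 i (Y i η) - g1 i (Y i ξ)).comp (Y' i η) + (g1 i (Y i ξ)).comp (Y' i η - Y' i ξ) :=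
      fun i => by ext v; simp
    simp only [e]
    refine (((d2 ξ η).clm_comp (hY.der η)).add ((d1 ξ).clm_comp (hY.inc ξ η))).mono hε ?_
    have := mul_nonneg (mul_nonneg hM (add_nonneg hc1 hc3)) (wt_nonneg γ ξ η)
    unfold compConst
    simp only [hK]
    linarith
  · have e : ∀ i, g i (Y i η) - g i (Y i ξ)
          - ((g1 i (Y i ξ)).comp (Y' i ξ)) ((X i).path η - (X i).path ξ)
        = (g i (Y i η) - g i (Y i ξ) - g1 i (Y i ξ) (Y i η - Y i ξ))
          + g1 i (Y i ξ) (Y i η - Y i ξ - Y' i ξ ((X i).path η - (X i).path ξ)) :=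
      fun i => by
        rw [map_sub (g1 i (Y i ξ)) (Y i η - Y i ξ), ContinuousLinearMap.comp_apply]; abel
    simp only [e]
    refine ((d3 ξ η).add ((d1 ξ).clm_apply (hY.rem ξ η))).mono hε ?_
    have := mul_nonneg (mul_nonneg hM (add_nonneg hc1 hc2)) (sq_nonneg (wt γ ξ η))
    unfold compConst
    simp only [hK]
    linarith

end Smooth

/-! ### The velocity field of a family of controlled loops -/

section Velocity

variable {ι : Type*} {γ : ℝ} {E G : Type*} [NormedAddCommGroup E] [NormedSpace ℝ E]
  [NormedAddCommGroup G] [NormedSpace ℝ G]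

theorem lip_of_hasFDerivAt {M : ℝ} {g : Vec → E} {g1 : Vec → Vec →L[ℝ] E}
    (hg : ∀ x, HasFDerivAt g (g1 x) x) (hb : ∀ x, ‖g1 x‖ ≤ M) (x y : Vec) :
    ‖g x - g y‖ ≤ M * ‖x - y‖ :=
  convex_univ.norm_image_sub_le_of_norm_hasFDerivWithin_le
    (fun x _ => (hg x).hasFDerivWithinAt) (fun x _ => hb x) (mem_univ y) (mem_univ x)

theorem TwoLip.parallel {M : ℝ} {g : Vec → E} (h : TwoLip M g) (x y d : Vec) :
    ‖g (x + d) - g x - (g (y + d) - g y)‖ ≤ 2 * M * ‖d‖ * ‖x - y‖ := by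
  refine (h _ _ _ _).trans (le_of_eq ?_)
  have e : x + d - x - (y + d - y) = 0 := by abel
  rw [e, norm_zero, add_sub_add_right_eq_sub, add_sub_cancel_left]
  ring

/-- A closed family of paths controlled by a family of rough paths. -/
structure LoopFam (S ε : ℝ) (X : ι → RoughPath γ) (Y : ι → Param → Vec)
    (Y' : ι → Param → Vec →L[ℝ] Vec) : Prop where
  rough : RoughFam S ε X
  ctrl : CtrlFam γ S ε (fun i => (X i).path) Y Y'
  closed : ∀ i, Y i 0 = Y i 1
  sup : ∀ i j ξ, ‖Y i ξ - Y j ξ‖ ≤ S * ε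

theorem Near.single {S ε : ℝ} {p : ι → E} (h : Near S ε p) (i : ι) :
    Near S 0 fun _ : Unit => p i := fun _ _ => ⟨(h i i).1, by simp⟩

/-- Isolating one member sets `ε = 0`, which removes the requirement on second differences. -/
theorem LoopFam.single {S ε : ℝ} {X : ι → RoughPath γ} {Y : ι → Param → Vec}
    {Y' : ι → Param → Vec →L[ℝ] Vec} (h : LoopFam S ε X Y Y') (i : ι) :
    LoopFam S 0 (fun _ : Unit => X i) (fun _ => Y i) (fun _ => Y' i) where
  rough := ⟨fun ξ η => (h.rough.path ξ η).single i, fun ξ η k l => (h.rough.area ξ η k l).single i⟩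
  ctrl := ⟨fun ξ => (h.ctrl.der ξ).single i, fun ξ η => (h.ctrl.inc ξ η).single i,
    fun ξ η => (h.ctrl.rem ξ η).single i⟩
  closed _ := h.closed i
  sup _ _ _ := by simp

/-- `J = ∫_0^1 L (q (-Y_η)) dY_η`. -/
def HasConv (X : RoughPath γ) (Y : Param → Vec) (Y' : Param → Vec →L[ℝ] Vec)
    (L : E →L[ℝ] Vec →L[ℝ] G) (q : Vec → E) (q1 : Vec → Vec →L[ℝ] E) (J : G) : Prop :=
  HasRoughIntegral X.area (fun η => L (q (-Y η))) (fun η => (-(L.comp (q1 (-Y η)))).comp (Y' η))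
    Y Y' 0 1 J

theorem HasConv.unique {X : RoughPath γ} {Y : Param → Vec} {Y' : Param → Vec →L[ℝ] Vec}
    {L : E →L[ℝ] Vec →L[ℝ] G} {q : Vec → E} {q1 : Vec → Vec →L[ℝ] E} {J J' : G}
    (h : HasConv X Y Y' L q q1 J) (h' : HasConv X Y Y' L q q1 J') : J = J' :=
  HasSewing.unique h h'

/-- Linearity in the kernel: regularity of the velocity in `x` is obtained by integrating
differences of shifted kernels. -/
theorem HasConv.sub {X : RoughPath γ} {Y : Param → Vec} {Y' : Param → Vec →L[ℝ] Vec}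
    {L : E →L[ℝ] Vec →L[ℝ] G} {q p : Vec → E} {q1 p1 : Vec → Vec →L[ℝ] E} {J J' : G}
    (h : HasConv X Y Y' L q q1 J) (h' : HasConv X Y Y' L p p1 J') :
    HasConv X Y Y' L (fun w => q w - p w) (fun w => q1 w - p1 w) (J - J') := by
  have := HasSewing.sub h h'
  refine (iff_of_eq ?_).1 this
  refine congrArg₂ (fun Ξ J => HasSewing Ξ 0 1 J) ?_ rfl
  funext a b
  simp only [roughTerm, map_sub, sub_apply, ContinuousLinearMap.comp_apply,
    neg_apply, smul_sub, smul_neg, Finset.sum_sub_distrib, Finset.sum_neg_distrib]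
  abel

/-- The constant in the bound of integrals of smooth functions along loops. -/
def fieldConst (γ S : ℝ) : ℝ :=
  integralConst γ S * compConst S + 36 * S * (compConst S * S)

theorem fieldConst_nonneg {γ S : ℝ} (hγ : 1 / 3 < γ) (hS : 0 ≤ S) : 0 ≤ fieldConst γ S := by
  have := compConst_nonneg hS
  have := integralConst_nonneg hγ hS
  unfold fieldConst
  positivity

/-- Since the loop is closed, the term `f_0 (Y_1 - Y_0)` of the germ on `[0, 1]` is zero. The bound
therefore contains only `M`, which controls the derivatives of `q` and not `q` itself. -/
theorem LoopFam.exists_conv [CompleteSpace G] (hγ : 1 / 3 < γ) {S M ε : ℝ} (hε : 0 ≤ ε)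
    (hS : 0 ≤ S) (hM : 0 ≤ M) {X : ι → RoughPath γ} {Y : ι → Param → Vec}
    {Y' : ι → Param → Vec →L[ℝ] Vec} (h : LoopFam S ε X Y Y')
    {L : E →L[ℝ] Vec →L[ℝ] G} (hL : ‖L‖ ≤ 1) {q : Vec → E} {q1 : Vec → Vec →L[ℝ] E}
    (hq : ∀ x, HasFDerivAt q (q1 x) x) (hb : ∀ x, ‖q1 x‖ ≤ M)
    (hl : ∀ x y, ‖q1 x - q1 y‖ ≤ M * ‖x - y‖) (h2 : ε = 0 ∨ TwoLip M q1) :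
    ∃ J : ι → G, (∀ i, HasConv (X i) (Y i) (Y' i) L q q1 (J i)) ∧
      Near (fieldConst γ S * M) ε J := by
  have hγ0 : 0 ≤ γ := by linarith
  have hc := compConst_nonneg hS
  have hsm : SmoothFam M ε (fun (_ : ι) z => L (q (-z))) (fun _ z => -(L.comp (q1 (-z)))) := by
    have hLc : ∀ K : Vec →L[ℝ] E, ‖L.comp K‖ ≤ ‖K‖ := fun K =>
      (L.opNorm_comp_le K).trans (mul_le_of_le_one_left (norm_nonneg _) hL)
    refine ⟨fun _ x => ?_, fun _ x => ?_, fun _ x y => ?_, h2.imp id fun h2 _ => ?_,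
      fun _ _ x => ?_, fun _ _ x y => ?_⟩
    · have h1 : HasFDerivAt (fun z : Vec => -z) (-ContinuousLinearMap.id ℝ Vec) x :=
        (hasFDerivAt_id x).neg
      have := L.hasFDerivAt.comp x ((hq (-x)).comp x h1)
      have e : -(L.comp (q1 (-x))) = L.comp ((q1 (-x)).comp (-ContinuousLinearMap.id ℝ Vec)) := by
        ext v
        simp
      rw [e]
      exact this
    · rw [norm_neg]; exact (hLc _).trans (hb _)
    · rw [neg_sub_neg, ← ContinuousLinearMap.comp_sub]
      refine (hLc _).trans ((hl _ _).trans (le_of_eq ?_))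
      rw [neg_sub_neg]
    · intro a b a' b'
      have e : -(L.comp (q1 (-a))) - -(L.comp (q1 (-b)))
          - (-(L.comp (q1 (-a'))) - -(L.comp (q1 (-b'))))
          = -(L.comp (q1 (-a) - q1 (-b) - (q1 (-a') - q1 (-b')))) := by
        simp only [ContinuousLinearMap.comp_sub]; abel
      rw [e, norm_neg]
      refine (hLc _).trans ((h2 _ _ _ _).trans (le_of_eq ?_))
      have e1 : -a - -b - (-a' - -b') = -(a - b - (a' - b')) := by abel
      have e2 : -a - -a' = -(a - a') := by abel
      have e3 : -b - -b' = -(b - b') := by abel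
      have e4 : -a' - -b' = -(a' - b') := by abel
      rw [e1, e2, e3, e4]
      simp only [norm_neg]
    · rw [sub_self, norm_zero]; positivity
    · simp only [sub_self, norm_zero]; positivity
  have hF := hsm.comp hγ0 hε hS hM h.rough h.ctrl h.sup
  obtain ⟨φ, hφ, hφ'⟩ := exists_roughIntegral hγ hε hS (mul_nonneg hc hM) h.rough hF h.ctrl
  refine ⟨fun i => φ i 1 - φ i 0, fun i => hφ i 0 1, ?_⟩
  have hw0 := wt_nonneg γ 0 1
  have hw1 := wt_le_one hγ0 0 1
  have T : Near (9 * (2 * S * (2 * (compConst S * M) * S))) ε fun i =>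
      roughTerm (X i).area (fun η => L (q (-Y i η)))
        (fun η => (-(L.comp (q1 (-Y i η)))).comp (Y' i η)) (Y i) (Y' i) 0 1 := by
    simp only [roughTerm, ← h.closed, sub_self, map_zero, zero_add]
    have T3 := fun k l => ((h.rough.area 0 1 k l).scale hε hS (pow_le_one₀ hw0 hw1)).smul
      (((hF.der 0).apply_unit (norm_stdVec k).le).clm_apply
        ((h.ctrl.der 0).apply_unit (norm_stdVec l).le))
    refine (Near.sum_three fun k => Near.sum_three fun l => T3 k l).mono hε (le_of_eq ?_)
    ring
  have := ((hφ' 0 1).scale hε (mul_nonneg (integralConst_nonneg hγ hS) (mul_nonneg hc hM))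
    (pow_le_one₀ hw0 hw1)).add T
  simp only [sub_add_cancel] at this
  refine this.mono hε (le_of_eq ?_)
  unfold fieldConst
  ring

/-- A kernel `A` with its first three derivatives and a bound for the first four. -/
structure FieldData (M : ℝ) (A : Vec → E) (A1 : Vec → Vec →L[ℝ] E)
    (A2 : Vec → Vec →L[ℝ] Vec →L[ℝ] E)
    (A3 : Vec → Vec →L[ℝ] Vec →L[ℝ] Vec →L[ℝ] E) : Prop where
  d0 : ∀ x, HasFDerivAt A (A1 x) x
  d1 : ∀ x, HasFDerivAt A1 (A2 x) x
  d2 : ∀ x, HasFDerivAt A2 (A3 x) x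
  b1 : ∀ x, ‖A1 x‖ ≤ M
  b2 : ∀ x, ‖A2 x‖ ≤ M
  b3 : ∀ x, ‖A3 x‖ ≤ M
  lip3 : ∀ x y, ‖A3 x - A3 y‖ ≤ M * ‖x - y‖
  symm1 : ∀ x h, HasFDerivAt (fun w => A1 w h) (A2 x h) x
  symm2 : ∀ x h, HasFDerivAt (fun w => A2 w h) (A3 x h) x

theorem hasFDerivAt_shift {g : Vec → E} {g1 : Vec → Vec →L[ℝ] E}
    (hg : ∀ x, HasFDerivAt g (g1 x) x) (x w : Vec) :
    HasFDerivAt (fun w => g (x + w)) (g1 (x + w)) w := by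
  have h1 : HasFDerivAt (fun w : Vec => x + w) (ContinuousLinearMap.id ℝ Vec) w :=
    (hasFDerivAt_id w).const_add x
  exact (hg (x + w)).comp w h1

/-- The constant in the bound of the velocity field. -/
def velConst (γ S : ℝ) : ℝ := 2 * fieldConst γ S

theorem velConst_nonneg {γ S : ℝ} (hγ : 1 / 3 < γ) (hS : 0 ≤ S) : 0 ≤ velConst γ S :=
  mul_nonneg zero_le_two (fieldConst_nonneg hγ hS)

theorem hasFDerivAt_of_norm_le_sq {g : Vec → E} {g1 : Vec →L[ℝ] E} {x : Vec} {C : ℝ}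
    (h : ∀ v, ‖g (x + v) - g x - g1 v‖ ≤ C * ‖v‖ ^ 2) : HasFDerivAt g g1 x := by
  rw [hasFDerivAt_iff_isLittleO_nhds_zero]
  refine (Asymptotics.IsBigO.of_bound C (Eventually.of_forall fun v => ?_)).trans_isLittleO
    (Asymptotics.isLittleO_norm_pow_id one_lt_two)
  rw [Real.norm_of_nonneg (by positivity)]
  exact h v

-- The gradient `V1` is the integral of `A1` with the direction of differentiation kept free. Each
-- property of `V` and `V1` reduces to the bound for the integral of a suitable difference of shifts
-- of `A` or `A1`, whose derivatives are as small as the property demands. The factor `2` in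
-- `velConst` comes from differences of two shifts.
set_option maxHeartbeats 1000000 in
theorem LoopFam.exists_convField {E0 : Type} [NormedAddCommGroup E0] [NormedSpace ℝ E0]
    (hγ : 1 / 3 < γ) {S M ε : ℝ} (hε : 0 ≤ ε)
    (hS : 0 ≤ S) {X : ι → RoughPath γ} {Y : ι → Param → Vec}
    {Y' : ι → Param → Vec →L[ℝ] Vec} (h : LoopFam S ε X Y Y')
    {A : Vec → E0} {A1 : Vec → Vec →L[ℝ] E0} {A2 : Vec → Vec →L[ℝ] Vec →L[ℝ] E0}
    {A3 : Vec → Vec →L[ℝ] Vec →L[ℝ] Vec →L[ℝ] E0} {Lid : E0 →L[ℝ] Vec →L[ℝ] Vec}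
    (nid : ‖Lid‖ ≤ 1) (hA : FieldData M A A1 A2 A3) (hstrong : ε = 0 ∨ TwoLip M A3) :
    ∃ (V : ι → Vec → Vec) (V1 : ι → Vec → Vec →L[ℝ] Vec),
      (∀ i x, HasConv (X i) (Y i) (Y' i) Lid (fun w => A (x + w)) (fun w => A1 (x + w))
        (V i x)) ∧
      (∀ x, Near (velConst γ S * M) ε fun i => V i x) ∧
      SmoothFam (velConst γ S * M) ε V V1 := by
  have hM : 0 ≤ M := (norm_nonneg _).trans (hA.b1 0)
  have hC := fieldConst_nonneg hγ hS
  set C := fieldConst γ S with hCdef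
  have lip1 : ∀ x y, ‖A1 x - A1 y‖ ≤ M * ‖x - y‖ := lip_of_hasFDerivAt hA.d1 hA.b2
  have lip2 : ∀ x y, ‖A2 x - A2 y‖ ≤ M * ‖x - y‖ := lip_of_hasFDerivAt hA.d2 hA.b3
  have two1 : TwoLip M A1 := twoLip_of_hasFDerivAt hA.d1 hA.b2 lip2
  have two2 : TwoLip M A2 := twoLip_of_hasFDerivAt hA.d2 hA.b3 hA.lip3
  -- `A1 w` takes the direction of differentiation first, but the integrator `dY` must be the first
  -- argument; the flip exchanges the two.
  set Lfl : (Vec →L[ℝ] E0) →L[ℝ] Vec →L[ℝ] (Vec →L[ℝ] Vec) :=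
    ((ContinuousLinearMap.flipₗᵢ ℝ Vec Vec Vec).toContinuousLinearEquiv :
      (Vec →L[ℝ] Vec →L[ℝ] Vec) →L[ℝ] Vec →L[ℝ] (Vec →L[ℝ] Vec)).comp
      (ContinuousLinearMap.compL ℝ Vec E0 (Vec →L[ℝ] Vec) Lid) with hLfl
  have nfl : ‖Lfl‖ ≤ 1 := by
    refine ContinuousLinearMap.opNorm_le_bound _ zero_le_one fun K => ?_
    rw [one_mul]
    refine (LinearIsometryEquiv.norm_map (ContinuousLinearMap.flipₗᵢ ℝ Vec Vec Vec)
      (Lid.comp K)).le.trans ?_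
    exact (Lid.opNorm_comp_le K).trans (mul_le_of_le_one_left (norm_nonneg _) nid)
  have flapp : ∀ (K : Vec →L[ℝ] E0) (u v : Vec), Lfl K u v = Lid (K v) u := fun K u v => rfl
  have bshift : ∀ {E' : Type} [NormedAddCommGroup E'] {g : Vec → E'}, TwoLip M g → ∀ x,
      TwoLip M (fun w => g (x + w)) := by
    intro E' _ g hg x a b a' b'
    have := hg (x + a) (x + b) (x + a') (x + b')
    simpa using this
  -- the velocity and its gradient
  have HV : ∀ x, ∃ J : ι → Vec, (∀ i, HasConv (X i) (Y i) (Y' i) Lid (fun w => A (x + w))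
      (fun w => A1 (x + w)) (J i)) ∧ Near (C * M) ε J := fun x =>
    h.exists_conv hγ hε hS hM nid (hasFDerivAt_shift hA.d0 x) (fun w => hA.b1 _)
      (fun w w' => by simpa using lip1 (x + w) (x + w')) (Or.inr (bshift two1 x))
  choose V0 hV0 hV0n using HV
  have HV1 : ∀ x, ∃ J : ι → Vec →L[ℝ] Vec, (∀ i, HasConv (X i) (Y i) (Y' i) Lfl
      (fun w => A1 (x + w)) (fun w => A2 (x + w)) (J i)) ∧ Near (C * M) ε J := fun x =>
    h.exists_conv hγ hε hS hM nfl (hasFDerivAt_shift hA.d1 x) (fun w => hA.b2 _)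
      (fun w w' => by simpa using lip2 (x + w) (x + w')) (Or.inr (bshift two2 x))
  choose W0 hW0 hW0n using HV1
  -- bounds for a single index
  have single : ∀ (i : ι) {E' G' : Type} [NormedAddCommGroup E'] [NormedSpace ℝ E']
      [NormedAddCommGroup G'] [NormedSpace ℝ G'] [CompleteSpace G']
      (L : E' →L[ℝ] Vec →L[ℝ] G'), ‖L‖ ≤ 1 → ∀ (q : Vec → E') (q1 : Vec → Vec →L[ℝ] E')
      (K : ℝ), 0 ≤ K → (∀ x, HasFDerivAt q (q1 x) x) → (∀ x, ‖q1 x‖ ≤ K) →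
      (∀ x y, ‖q1 x - q1 y‖ ≤ K * ‖x - y‖) → ∀ J, HasConv (X i) (Y i) (Y' i) L q q1 J →
      ‖J‖ ≤ C * K := by
    intro i E' G' _ _ _ _ _ L hL q q1 K hK hq hb hl J hJ
    obtain ⟨J', hJ', hn⟩ := (h.single i).exists_conv hγ le_rfl hS hK hL hq hb hl (Or.inl rfl)
    rw [hJ.unique (hJ' ())]
    exact (hn () ()).1
  have hCM : C * M ≤ velConst γ S * M := by
    rw [velConst, ← hCdef]; nlinarith [mul_nonneg hC hM]
  refine ⟨fun i x => V0 x i, fun i x => W0 x i, fun i x => hV0 x i,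
    fun x => (hV0n x).mono hε hCM, ?_⟩
  have diffd : ∀ x y w, HasFDerivAt (fun w => A1 (x + w) - A1 (y + w)) (A2 (x + w) - A2 (y + w)) w :=
    fun x y w => (hasFDerivAt_shift hA.d1 x w).sub (hasFDerivAt_shift hA.d1 y w)
  have diffb : ∀ x y w, ‖A2 (x + w) - A2 (y + w)‖ ≤ 2 * M * ‖x - y‖ := fun x y w => by
    have := lip2 (x + w) (y + w)
    rw [add_sub_add_right_eq_sub] at this
    nlinarith [mul_nonneg hM (norm_nonneg (x - y))]
  have diffp : ∀ {E' : Type} [NormedAddCommGroup E'] [NormedSpace ℝ E'] {g : Vec → E'},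
      TwoLip M g → ∀ x y w w',
      ‖g (x + w) - g (y + w) - (g (x + w') - g (y + w'))‖ ≤ 2 * M * ‖x - y‖ * ‖w - w'‖ := by
    intro E' _ _ g hg x y w w'
    have := hg.parallel (y + w) (y + w') (x - y)
    have e : ∀ w, y + w + (x - y) = x + w := fun w => by abel
    rwa [e, e, add_sub_add_left_eq_sub] at this
  have K0 : ∀ x y : Vec, 0 ≤ 2 * M * ‖x - y‖ := fun x y => by positivity
  refine ⟨fun i x => ?_, fun i x => ((hW0n x) i i).1.trans hCM, fun i x y => ?_, ?_,
    fun i j x => ((hW0n x).mono hε hCM i j).2, fun i j x y => ?_⟩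
  -- `V (x + v) - V x - W v` is the integral of the Taylor remainder of the kernel. That remainder
  -- has derivative bounded by `M * ‖v‖ ^ 2` and with the same Lipschitz constant.
  · refine hasFDerivAt_of_norm_le_sq (C := C * M) fun v => ?_
    have hv : HasConv (X i) (Y i) (Y' i) Lid (fun w => A1 (x + w) v) (fun w => A2 (x + w) v)
        (W0 x i v) := by
      have := HasSewing.clm (ContinuousLinearMap.apply ℝ Vec v) (hW0 x i)
      refine (iff_of_eq ?_).1 this
      refine congrArg₂ (fun Ξ J => HasSewing Ξ 0 1 J) ?_ rfl
      -- Symmetry of the second derivative makes the flipped derivative agree with the one that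
      -- `HasConv` prescribes for the kernel `A1 · v`.
      have hs : ∀ w u, A2 w u v = A2 w v u := fun w u => by
        have h1 : HasFDerivAt (fun w => A1 w v)
            ((ContinuousLinearMap.apply ℝ E0 v).comp (A2 w)) w :=
          (ContinuousLinearMap.apply ℝ E0 v).hasFDerivAt.comp w (hA.d1 w)
        have := h1.unique (hA.symm1 w v)
        exact DFunLike.congr_fun this u
      funext a b
      simp only [roughTerm, map_add, map_sum, map_smul, ContinuousLinearMap.apply_apply,
        ContinuousLinearMap.comp_apply, neg_apply, flapp, hs]
    have hconv := ((hV0 (x + v) i).sub (hV0 x i)).sub hv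
    have dq : ∀ w, HasFDerivAt (fun w => A (x + v + w) - A (x + w) - A1 (x + w) v)
        (A1 (x + v + w) - A1 (x + w) - A2 (x + w) v) w := fun w =>
      ((hasFDerivAt_shift hA.d0 (x + v) w).sub (hasFDerivAt_shift hA.d0 x w)).sub
        (hasFDerivAt_shift (fun w => hA.symm1 w v) x w)
    have dq1 : ∀ w, HasFDerivAt (fun w => A1 (x + v + w) - A1 (x + w) - A2 (x + w) v)
        (A2 (x + v + w) - A2 (x + w) - A3 (x + w) v) w := fun w =>
      ((hasFDerivAt_shift hA.d1 (x + v) w).sub (hasFDerivAt_shift hA.d1 x w)).sub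
        (hasFDerivAt_shift (fun w => hA.symm2 w v) x w)
    have e : ∀ w, x + v + w - (x + w) = v := fun w => by abel
    have bq1 : ∀ w, ‖A1 (x + v + w) - A1 (x + w) - A2 (x + w) v‖ ≤ M * ‖v‖ ^ 2 := fun w => by
      have := norm_taylor_le hA.d1 lip2 (x + v + w) (x + w)
      rwa [e] at this
    have bq2 : ∀ w, ‖A2 (x + v + w) - A2 (x + w) - A3 (x + w) v‖ ≤ M * ‖v‖ ^ 2 := fun w => by
      have := norm_taylor_le hA.d2 hA.lip3 (x + v + w) (x + w)
      rwa [e] at this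
    have := single i Lid nid _ _ (M * ‖v‖ ^ 2) (by positivity) dq bq1
      (lip_of_hasFDerivAt dq1 bq2) _ hconv
    rwa [← mul_assoc] at this
  · have := single i Lfl nfl _ _ _ (K0 x y) (diffd x y) (diffb x y) (diffp two2 x y) _
      ((hW0 x i).sub (hW0 y i))
    refine this.trans (le_of_eq ?_)
    rw [velConst]; ring
  · refine hstrong.imp id fun two3 i a b a' b' => ?_
    -- `K` bounds the derivative of the second difference of `A1` and, through `A3`, the Lipschitz
    -- constant of that derivative.
    set K := M * (‖a - b - (a' - b')‖ + (‖a - a'‖ + ‖b - b'‖) * ‖a' - b'‖) with hK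
    have dq : ∀ w, HasFDerivAt (fun w => A1 (a + w) - A1 (b + w) - (A1 (a' + w) - A1 (b' + w)))
        (A2 (a + w) - A2 (b + w) - (A2 (a' + w) - A2 (b' + w))) w := fun w =>
      (diffd a b w).sub (diffd a' b' w)
    have dq1 : ∀ w, HasFDerivAt (fun w => A2 (a + w) - A2 (b + w) - (A2 (a' + w) - A2 (b' + w)))
        (A3 (a + w) - A3 (b + w) - (A3 (a' + w) - A3 (b' + w))) w := fun w =>
      ((hasFDerivAt_shift hA.d2 a w).sub (hasFDerivAt_shift hA.d2 b w)).sub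
        ((hasFDerivAt_shift hA.d2 a' w).sub (hasFDerivAt_shift hA.d2 b' w))
    have bq1 : ∀ w, ‖A2 (a + w) - A2 (b + w) - (A2 (a' + w) - A2 (b' + w))‖ ≤ K := fun w => by
      simpa only [add_sub_add_right_eq_sub] using two2 (a + w) (b + w) (a' + w) (b' + w)
    have bq2 : ∀ w, ‖A3 (a + w) - A3 (b + w) - (A3 (a' + w) - A3 (b' + w))‖ ≤ K := fun w => by
      simpa only [add_sub_add_right_eq_sub] using two3 (a + w) (b + w) (a' + w) (b' + w)
    have := single i Lfl nfl _ _ K (by positivity) dq bq1 (lip_of_hasFDerivAt dq1 bq2) _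
      (((hW0 a i).sub (hW0 b i)).sub ((hW0 a' i).sub (hW0 b' i)))
    have hn : 0 ≤ C * K := by positivity
    refine this.trans ?_
    rw [velConst, mul_assoc]
    have : 2 * fieldConst γ S * K = C * K + C * K := by rw [hCdef]; ring
    rw [mul_assoc (2 : ℝ), ← hCdef] at *
    linarith
  -- Here the whole family is integrated against the small kernel `A1 (x + ·) - A1 (y + ·)`, so that
  -- the factors `ε` and `‖x - y‖` appear together.
  · have h2 : ε = 0 ∨ TwoLip (2 * M * ‖x - y‖) fun w => A2 (x + w) - A2 (y + w) := by
      refine hstrong.imp id fun two3 => ?_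
      refine twoLip_of_hasFDerivAt (g1 := fun w => A3 (x + w) - A3 (y + w))
        (fun w => (hasFDerivAt_shift hA.d2 x w).sub (hasFDerivAt_shift hA.d2 y w))
        (fun w => ?_) (diffp two3 x y)
      have := hA.lip3 (x + w) (y + w)
      rw [add_sub_add_right_eq_sub] at this
      nlinarith [mul_nonneg hM (norm_nonneg (x - y))]
    obtain ⟨J, hJ, hn⟩ := h.exists_conv hγ hε hS (K0 x y) nfl (diffd x y) (diffb x y)
      (diffp two2 x y) h2
    have e := fun i => (hJ i).unique ((hW0 x i).sub (hW0 y i))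
    have := (hn i j).2
    rw [e, e] at this
    have e' : W0 x i - W0 x j - (W0 y i - W0 y j) = W0 x i - W0 y i - (W0 x j - W0 y j) := by abel
    rw [e']
    refine this.trans (le_of_eq ?_)
    rw [velConst]; ring

theorem LoopFam.exists_velocity (hγ : 1 / 3 < γ) {S M ε : ℝ} (hε : 0 ≤ ε)
    (hS : 0 ≤ S) {X : ι → RoughPath γ} {Y : ι → Param → Vec}
    {Y' : ι → Param → Vec →L[ℝ] Vec} (h : LoopFam S ε X Y Y')
    {A : Vec → Vec →L[ℝ] Vec} {A1 A2 A3} (hA : FieldData M A A1 A2 A3)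
    (hstrong : ε = 0 ∨ TwoLip M A3) :
    ∃ (V : ι → Vec → Vec) (V1 : ι → Vec → Vec →L[ℝ] Vec),
      (∀ i x, IsVelocity A (X i).area (Y i) (Y' i) x (V i x)) ∧
      (∀ x, Near (velConst γ S * M) ε fun i => V i x) ∧
      SmoothFam (velConst γ S * M) ε V V1 := by
  obtain ⟨V, V1, h1, h2, h3⟩ := h.exists_convField hγ hε hS
    (Lid := ContinuousLinearMap.id ℝ (Vec →L[ℝ] Vec)) ContinuousLinearMap.norm_id_le hA hstrong
  refine ⟨V, V1, fun i x => ?_, h2, h3⟩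
  have := h1 i x
  unfold HasConv at this
  unfold IsVelocity
  simpa only [ContinuousLinearMap.id_apply, ContinuousLinearMap.id_comp,
    ContinuousLinearMap.neg_comp, ← sub_eq_add_neg, (hA.d0 _).fderiv] using this

end Velocity

/-! ### Kernels with bounded derivatives -/

section Kernel

variable {E : Type*} [NormedAddCommGroup E] [NormedSpace ℝ E]

theorem hasFDerivAt_apply_of_symm {g : Vec → E} {g1 : Vec → Vec →L[ℝ] E}
    {g2 : Vec → Vec →L[ℝ] Vec →L[ℝ] E} (h1 : ∀ x, HasFDerivAt g (g1 x) x)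
    (h2 : ∀ x, HasFDerivAt g1 (g2 x) x) (x h : Vec) :
    HasFDerivAt (fun w => g1 w h) (g2 x h) x := by
  have h3 : HasFDerivAt (fun w => g1 w h) ((ContinuousLinearMap.apply ℝ E h).comp (g2 x)) x :=
    (ContinuousLinearMap.apply ℝ E h).hasFDerivAt.comp x (h2 x)
  have e : (ContinuousLinearMap.apply ℝ E h).comp (g2 x) = g2 x h := by
    ext u
    exact second_derivative_symmetric h1 (h2 x) u h
  rwa [e] at h3

theorem norm_fderiv_eq_iteratedFDeriv (g : Vec → E) (x : Vec) :
    ‖fderiv ℝ g x‖ = ‖iteratedFDeriv ℝ 1 g x‖ := by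
  rw [← norm_iteratedFDeriv_fderiv, norm_iteratedFDeriv_zero]

theorem fieldData_of_contDiff {A : Vec → E} {M : ℝ} (hA : ContDiff ℝ 5 A)
    (h : ∀ k < 4, ∀ x, ‖iteratedFDeriv ℝ (k + 1) A x‖ ≤ M) :
    FieldData M A (fderiv ℝ A) (fderiv ℝ (fderiv ℝ A)) (fderiv ℝ (fderiv ℝ (fderiv ℝ A))) := by
  have c1 : ContDiff ℝ 4 (fderiv ℝ A) := hA.fderiv_right (by norm_num)
  have c2 : ContDiff ℝ 3 (fderiv ℝ (fderiv ℝ A)) := c1.fderiv_right (by norm_num)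
  have c3 : ContDiff ℝ 2 (fderiv ℝ (fderiv ℝ (fderiv ℝ A))) := c2.fderiv_right (by norm_num)
  have d0 : ∀ x, HasFDerivAt A (fderiv ℝ A x) x := fun x =>
    (hA.differentiable (by norm_num) x).hasFDerivAt
  have d1 : ∀ x, HasFDerivAt (fderiv ℝ A) (fderiv ℝ (fderiv ℝ A) x) x := fun x =>
    (c1.differentiable (by norm_num) x).hasFDerivAt
  have d2 : ∀ x, HasFDerivAt (fderiv ℝ (fderiv ℝ A)) (fderiv ℝ (fderiv ℝ (fderiv ℝ A)) x) x :=
    fun x => (c2.differentiable (by norm_num) x).hasFDerivAt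
  have d3 : ∀ x, HasFDerivAt (fderiv ℝ (fderiv ℝ (fderiv ℝ A)))
      (fderiv ℝ (fderiv ℝ (fderiv ℝ (fderiv ℝ A))) x) x :=
    fun x => (c3.differentiable (by norm_num) x).hasFDerivAt
  refine ⟨d0, d1, d2, fun x => ?_, fun x => ?_, fun x => ?_, lip_of_hasFDerivAt d3 fun x => ?_,
    hasFDerivAt_apply_of_symm d0 d1, hasFDerivAt_apply_of_symm d1 d2⟩
  · rw [norm_fderiv_eq_iteratedFDeriv]; exact h 0 (by norm_num) x
  · rw [norm_fderiv_eq_iteratedFDeriv, norm_iteratedFDeriv_fderiv]; exact h 1 (by norm_num) x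
  · rw [norm_fderiv_eq_iteratedFDeriv, norm_iteratedFDeriv_fderiv, norm_iteratedFDeriv_fderiv]
    exact h 2 (by norm_num) x
  · rw [norm_fderiv_eq_iteratedFDeriv, norm_iteratedFDeriv_fderiv, norm_iteratedFDeriv_fderiv,
      norm_iteratedFDeriv_fderiv]
    exact h 3 (by norm_num) x

/-- The bound on the fifth derivative of `A` enters only here. It is needed to compare two different
curves, which is why a priori bounds involve `‖∇A‖_3` and Lipschitz estimates `‖∇A‖_4`. -/
theorem twoLip_of_contDiff {A : Vec → E} {M : ℝ} (hA : ContDiff ℝ 5 A)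
    (h : ∀ k < 5, ∀ x, ‖iteratedFDeriv ℝ (k + 1) A x‖ ≤ M) :
    TwoLip M (fderiv ℝ (fderiv ℝ (fderiv ℝ A))) := by
  have c1 : ContDiff ℝ 4 (fderiv ℝ A) := hA.fderiv_right (by norm_num)
  have c2 : ContDiff ℝ 3 (fderiv ℝ (fderiv ℝ A)) := c1.fderiv_right (by norm_num)
  have c3 : ContDiff ℝ 2 (fderiv ℝ (fderiv ℝ (fderiv ℝ A))) := c2.fderiv_right (by norm_num)
  have c4 : ContDiff ℝ 1 (fderiv ℝ (fderiv ℝ (fderiv ℝ (fderiv ℝ A)))) :=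
    c3.fderiv_right (by norm_num)
  refine twoLip_of_hasFDerivAt (fun x => (c3.differentiable (by norm_num) x).hasFDerivAt)
    (fun x => ?_) (lip_of_hasFDerivAt
      (fun x => (c4.differentiable (by norm_num) x).hasFDerivAt) fun x => ?_)
  · rw [norm_fderiv_eq_iteratedFDeriv, norm_iteratedFDeriv_fderiv, norm_iteratedFDeriv_fderiv,
      norm_iteratedFDeriv_fderiv]
    exact h 3 (by norm_num) x
  · rw [norm_fderiv_eq_iteratedFDeriv, norm_iteratedFDeriv_fderiv, norm_iteratedFDeriv_fderiv,
      norm_iteratedFDeriv_fderiv, norm_iteratedFDeriv_fderiv]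
    exact h 4 (by norm_num) x

theorem norm_iteratedFDeriv_le_of_gradNorm {A : Vec → Vec →L[ℝ] Vec} {n : ℕ} {M : ℝ≥0}
    (h : gradNorm A n ≤ M) {k : ℕ} (hk : k < n + 1) (x : Vec) :
    ‖iteratedFDeriv ℝ (k + 1) A x‖ ≤ M := by
  have h1 : ENNReal.ofReal ‖iteratedFDeriv ℝ (k + 1) A x‖ ≤ M :=
    ((le_iSup (fun x => ENNReal.ofReal ‖iteratedFDeriv ℝ (k + 1) A x‖) x).trans
      (Finset.single_le_sum (f := fun k => ⨆ x : Vec, ENNReal.ofReal ‖iteratedFDeriv ℝ (k + 1) A x‖)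
        (fun _ _ => zero_le) (Finset.mem_range.2 hk))).trans h
  have := ENNReal.toReal_mono ENNReal.coe_ne_top h1
  rwa [ENNReal.toReal_ofReal (norm_nonneg _), ENNReal.coe_toReal] at this

end Kernel

/-! ### The velocity and its gradient -/

/-- The velocity `∫_0^1 A(x-Y_η) dY_η` (zero if the integral does not exist). -/
def vel {γ : ℝ} (A : Vec → Vec →L[ℝ] Vec) (X : RoughPath γ) (Y : Param → Vec)
    (Y' : Param → Vec →L[ℝ] Vec) (x : Vec) : Vec :=
  open Classical in if h : ∃ u, IsVelocity A X.area Y Y' x u then h.choose else 0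

theorem IsVelocity.vel_eq {γ : ℝ} {A : Vec → Vec →L[ℝ] Vec} {X : RoughPath γ} {Y : Param → Vec}
    {Y' : Param → Vec →L[ℝ] Vec} {x u : Vec} (h : IsVelocity A X.area Y Y' x u) :
    vel A X Y Y' x = u := by
  have hex : ∃ u, IsVelocity A X.area Y Y' x u := ⟨u, h⟩
  rw [vel, dif_pos hex]
  exact HasSewing.unique hex.choose_spec h

/-- The gradient of the velocity. -/
def dvel {γ : ℝ} (A : Vec → Vec →L[ℝ] Vec) (X : RoughPath γ) (Y : Param → Vec)
    (Y' : Param → Vec →L[ℝ] Vec) (x : Vec) : Vec →L[ℝ] Vec :=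
  fderiv ℝ (vel A X Y Y') x

/-- The constant in the bound of the velocity along a loop. -/
def evoConst (γ S : ℝ) : ℝ := compConst S * velConst γ S + velConst γ S * (1 + S)

theorem evoConst_nonneg {γ S : ℝ} (hγ : 1 / 3 < γ) (hS : 0 ≤ S) : 0 ≤ evoConst γ S := by
  have := velConst_nonneg hγ hS
  have := compConst_nonneg hS
  unfold evoConst
  positivity

section Evo

variable {ι : Type*} {γ : ℝ} {S M ε : ℝ} {X : ι → RoughPath γ} {Y : ι → Param → Vec}
  {Y' : ι → Param → Vec →L[ℝ] Vec} {A : Vec → Vec →L[ℝ] Vec}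

theorem LoopFam.vel (hγ : 1 / 3 < γ) (hε : 0 ≤ ε) (hS : 0 ≤ S) (h : LoopFam S ε X Y Y')
    {A1 A2 A3} (hA : FieldData M A A1 A2 A3) (hstrong : ε = 0 ∨ TwoLip M A3) :
    (∀ i x, IsVelocity A (X i).area (Y i) (Y' i) x (vel A (X i) (Y i) (Y' i) x)) ∧
    (∀ x, Near (velConst γ S * M) ε fun i => vel A (X i) (Y i) (Y' i) x) ∧
    SmoothFam (velConst γ S * M) ε (fun i => vel A (X i) (Y i) (Y' i))
      (fun i => dvel A (X i) (Y i) (Y' i)) := by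
  obtain ⟨V, V1, h1, h2, h3⟩ := h.exists_velocity hγ hε hS hA hstrong
  have e : ∀ i, VortexFilament.vel A (X i) (Y i) (Y' i) = V i := fun i =>
    funext fun x => (h1 i x).vel_eq
  have e1 : ∀ i, dvel A (X i) (Y i) (Y' i) = V1 i := fun i => funext fun x => by
    rw [dvel, e]; exact (h3.hasFDeriv i x).fderiv
  simp only [e, e1]
  exact ⟨h1, h2, h3⟩

/-- The central estimate: the velocity evaluated on the loop is again controlled by `X`. A single
loop gives the bound of the vector field of the evolution, a pair of loops its Lipschitz estimate.
-/
theorem LoopFam.evo (hγ : 1 / 3 < γ) (hε : 0 ≤ ε) (hS : 0 ≤ S) (h : LoopFam S ε X Y Y')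
    {A1 A2 A3} (hA : FieldData M A A1 A2 A3) (hstrong : ε = 0 ∨ TwoLip M A3) :
    CtrlFam γ (evoConst γ S * M) ε (fun i => (X i).path)
      (fun i ξ => VortexFilament.vel A (X i) (Y i) (Y' i) (Y i ξ))
      (fun i ξ => (dvel A (X i) (Y i) (Y' i) (Y i ξ)).comp (Y' i ξ)) ∧
    ∀ ξ, Near (evoConst γ S * M) ε fun i => VortexFilament.vel A (X i) (Y i) (Y' i) (Y i ξ) := by
  obtain ⟨_, h2, h3⟩ := h.vel hγ hε hS hA hstrong
  have hM : 0 ≤ M := (norm_nonneg _).trans (hA.b1 0)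
  have hc := velConst_nonneg hγ hS
  have hk := compConst_nonneg hS
  refine ⟨(h3.comp (by linarith) hε hS (mul_nonneg hc hM) h.rough h.ctrl h.sup).mono hε ?_,
    fun ξ i j => ⟨?_, ?_⟩⟩
  · have : 0 ≤ velConst γ S * (1 + S) * M := by positivity
    rw [evoConst]; linarith
  · refine (h2 _ i i).1.trans ?_
    have : 0 ≤ compConst S * velConst γ S * M := by positivity
    have : 0 ≤ velConst γ S * S * M := by positivity
    rw [evoConst]; linarith
  · have h4 := (h2 (Y j ξ) i j).2
    have h5 := (lip_of_hasFDerivAt (h3.hasFDeriv i) (h3.bound i) (Y i ξ) (Y j ξ)).trans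
      (mul_le_mul_of_nonneg_left (h.sup i j ξ) (mul_nonneg hc hM))
    have h6 := norm_add_le (VortexFilament.vel A (X i) (Y i) (Y' i) (Y i ξ)
      - VortexFilament.vel A (X i) (Y i) (Y' i) (Y j ξ))
      (VortexFilament.vel A (X i) (Y i) (Y' i) (Y j ξ)
        - VortexFilament.vel A (X j) (Y j) (Y' j) (Y j ξ))
    rw [sub_add_sub_cancel] at h6
    have : 0 ≤ compConst S * velConst γ S * M * ε := by positivity
    rw [evoConst]
    beta_reduce at h4
    linarith

end Evo

/-! ### Hölder suprema as bounds -/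

theorem holderSup_le {α C : ℝ} (hC : 0 ≤ C) {N : Param → Param → ℝ}
    (h : ∀ ξ η, N ξ η ≤ C * dist ξ η ^ α) : holderSup α N ≤ ENNReal.ofReal C := by
  refine iSup_le fun ξ => iSup_le fun η => ENNReal.div_le_of_le_mul ?_
  rw [← ENNReal.ofReal_mul hC]
  exact ENNReal.ofReal_le_ofReal (h ξ η)

theorem le_of_holderSup_le {α C : ℝ} (hC : 0 ≤ C) {N : Param → Param → ℝ}
    (h : holderSup α N ≤ ENNReal.ofReal C) (ξ η : Param) : N ξ η ≤ C * dist ξ η ^ α := by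
  have h1 : ENNReal.ofReal (N ξ η) / ENNReal.ofReal (dist ξ η ^ α) ≤ ENNReal.ofReal C :=
    (le_iSup₂ (f := fun ξ η : Param => ENNReal.ofReal (N ξ η) / ENNReal.ofReal (dist ξ η ^ α))
      ξ η).trans h
  have hd : 0 ≤ dist ξ η ^ α := Real.rpow_nonneg dist_nonneg _
  -- When the weight vanishes, the convention `c / 0 = ∞` for `c > 0` forces `N ξ η ≤ 0`.
  rcases hd.eq_or_lt with h0 | h0
  · rw [← h0, mul_zero]
    by_contra hN
    rw [not_le] at hN
    rw [← h0, ENNReal.ofReal_zero, ENNReal.div_zero (ENNReal.ofReal_pos.2 hN).ne', top_le_iff] at h1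
    exact ENNReal.ofReal_ne_top h1
  · rw [ENNReal.div_le_iff (ENNReal.ofReal_pos.2 h0).ne' ENNReal.ofReal_ne_top,
      ← ENNReal.ofReal_mul hC] at h1
    exact (ENNReal.ofReal_le_ofReal_iff (by positivity)).1 h1

theorem abs_le_matNorm (m : Matrix (Fin 3) (Fin 3) ℝ) (k l : Fin 3) : |m k l| ≤ matNorm m :=
  (Finset.single_le_sum (f := fun l => |m k l|) (fun _ _ => abs_nonneg _) (Finset.mem_univ l)).trans
    (Finset.single_le_sum (f := fun k => ∑ l, |m k l|)
      (fun _ _ => Finset.sum_nonneg fun _ _ => abs_nonneg _) (Finset.mem_univ k))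

theorem matNorm_le {m : Matrix (Fin 3) (Fin 3) ℝ} {C : ℝ} (h : ∀ k l, |m k l| ≤ C) :
    matNorm m ≤ 9 * C := by
  simp only [matNorm, Fin.sum_univ_three]
  linarith [h 0 0, h 0 1, h 0 2, h 1 0, h 1 1, h 1 2, h 2 0, h 2 1, h 2 2]

section RoughInterface

variable {γ : ℝ}

theorem roughDist_bounds {X Z : RoughPath γ} {δ : ℝ} (hδ : 0 ≤ δ)
    (h : roughDist X Z ≤ ENNReal.ofReal δ) (ξ η : Param) :
    ‖X.path η - X.path ξ - (Z.path η - Z.path ξ)‖ ≤ δ * wt γ ξ η ∧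
    ∀ k l, |X.area ξ η k l - Z.area ξ η k l| ≤ δ * wt γ ξ η ^ 2 := by
  constructor
  · have := le_of_holderSup_le hδ (le_self_add.trans h) η ξ
    beta_reduce at this
    rw [dist_comm] at this
    beta_reduce at this ⊢
    refine (le_of_eq ?_).trans this
    congr 1
    abel
  · intro k l
    have := le_of_holderSup_le hδ (le_add_self.trans h) ξ η
    rw [wt_sq] at this
    exact (abs_le_matNorm _ k l).trans this

/-- The `10` counts one for the path and nine for the entries of the area. -/
theorem roughDist_le {X Z : RoughPath γ} {δ : ℝ} (hδ : 0 ≤ δ)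
    (h1 : ∀ ξ η, ‖X.path η - X.path ξ - (Z.path η - Z.path ξ)‖ ≤ δ * wt γ ξ η)
    (h2 : ∀ ξ η k l, |X.area ξ η k l - Z.area ξ η k l| ≤ δ * wt γ ξ η ^ 2) :
    roughDist X Z ≤ ENNReal.ofReal (10 * δ) := by
  have e : (10 : ℝ) * δ = δ + 9 * δ := by ring
  rw [e, ENNReal.ofReal_add hδ (by positivity)]
  refine add_le_add (holderSup_le hδ fun ξ η => ?_) (holderSup_le (by positivity) fun ξ η => ?_)
  · have := h1 η ξ
    rw [wt, dist_comm] at this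
    beta_reduce at this ⊢
    refine (le_of_eq ?_).trans this
    congr 1
    abel
  · rw [wt_sq, mul_assoc]
    exact matNorm_le fun k l => by simpa using h2 ξ η k l

theorem roughDist_comm (X Z : RoughPath γ) : roughDist X Z = roughDist Z X := by
  unfold roughDist holderSeminorm holderSup matNorm
  congr 1
  · refine iSup_congr fun ξ => iSup_congr fun η => ?_
    beta_reduce
    rw [← norm_neg]
    congr 3
    abel
  · refine iSup_congr fun ξ => iSup_congr fun η => ?_
    congr 2
    refine Finset.sum_congr rfl fun k _ => Finset.sum_congr rfl fun l _ => ?_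
    simp only [Matrix.sub_apply]
    exact abs_sub_comm _ _

theorem holderSup_le_add {α : ℝ} {N N₁ N₂ : Param → Param → ℝ}
    (h : ∀ ξ η, N ξ η ≤ N₁ ξ η + N₂ ξ η) :
    holderSup α N ≤ holderSup α N₁ + holderSup α N₂ := by
  refine iSup_le fun ξ => iSup_le fun η => ?_
  have h1 := le_iSup₂ (f := fun ξ η : Param => ENNReal.ofReal (N₁ ξ η)
    / ENNReal.ofReal (dist ξ η ^ α)) ξ η
  have h2 := le_iSup₂ (f := fun ξ η : Param => ENNReal.ofReal (N₂ ξ η)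
    / ENNReal.ofReal (dist ξ η ^ α)) ξ η
  refine le_trans ?_ (add_le_add h1 h2)
  rw [← ENNReal.add_div]
  exact ENNReal.div_le_div_right ((ENNReal.ofReal_le_ofReal (h ξ η)).trans
    ENNReal.ofReal_add_le) _

theorem roughDist_triangle (X Y Z : RoughPath γ) :
    roughDist X Z ≤ roughDist X Y + roughDist Y Z := by
  unfold roughDist
  rw [add_add_add_comm]
  refine add_le_add (holderSup_le_add fun ξ η => ?_) (holderSup_le_add fun ξ η => ?_)
  · beta_reduce
    refine (le_of_eq ?_).trans (norm_add_le _ _)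
    congr 1
    abel
  · unfold matNorm
    rw [← Finset.sum_add_distrib]
    refine Finset.sum_le_sum fun k _ => ?_
    rw [← Finset.sum_add_distrib]
    refine Finset.sum_le_sum fun l _ => ?_
    simp only [Matrix.sub_apply]
    exact abs_sub_le _ _ _

theorem roughBall_bounds {r : ℝ} {X : RoughPath γ} (hr : 0 ≤ r) (hX : X ∈ roughBall γ r)
    (ξ η : Param) : ‖X.path η - X.path ξ‖ ≤ r * wt γ ξ η ∧
    ∀ k l, |X.area ξ η k l| ≤ r * wt γ ξ η ^ 2 := by
  have := roughDist_bounds hr (le_of_lt hX) ξ η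
  simpa [RoughPath.trivial] using this

theorem roughDist_lt_top (X Z : RoughPath γ) : roughDist X Z < ⊤ := by
  have h : ∀ X : RoughPath γ, roughDist X (RoughPath.trivial γ) < ⊤ := fun X => by
    refine ENNReal.add_lt_top.2 ⟨?_, ?_⟩
    · simpa [RoughPath.trivial] using X.path_holder
    · simpa [RoughPath.trivial] using X.area_holder
  refine (roughDist_triangle X (RoughPath.trivial γ) Z).trans_lt (ENNReal.add_lt_top.2 ⟨h X, ?_⟩)
  rw [roughDist_comm]
  exact h Z

theorem Near.pair {E : Type*} [NormedAddCommGroup E] {S ε : ℝ} {p : Bool → E}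
    (h : ∀ b, ‖p b‖ ≤ S) (hd : ‖p false - p true‖ ≤ S * ε) : Near S ε p := by
  intro i j
  refine ⟨h i, ?_⟩
  have h0 : 0 ≤ S * ε := (norm_nonneg _).trans hd
  cases i <;> cases j
  · simpa using h0
  · exact hd
  · rw [norm_sub_rev]; exact hd
  · simpa using h0

theorem roughFam_pair {r S δ : ℝ} (hr : 0 ≤ r) (hrS : r ≤ S) (hS : 1 ≤ S) (hδ : 0 ≤ δ)
    {X : Bool → RoughPath γ}
    (hX : ∀ b, X b ∈ roughBall γ r) (h : roughDist (X false) (X true) ≤ ENNReal.ofReal δ) :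
    RoughFam S δ X := by
  refine ⟨fun ξ η => Near.pair (fun b => ?_) ?_, fun ξ η k l => Near.pair (fun b => ?_) ?_⟩
  · exact (roughBall_bounds hr (hX b) ξ η).1.trans
      (mul_le_mul_of_nonneg_right hrS (wt_nonneg _ _ _))
  · refine (roughDist_bounds hδ h ξ η).1.trans ?_
    nlinarith [mul_nonneg hδ (wt_nonneg γ ξ η)]
  · exact ((roughBall_bounds hr (hX b) ξ η).2 k l).trans
      (mul_le_mul_of_nonneg_right hrS (sq_nonneg _))
  · refine ((roughDist_bounds hδ h ξ η).2 k l).trans ?_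
    nlinarith [mul_nonneg hδ (sq_nonneg (wt γ ξ η))]

theorem roughFam_const {ι : Type*} {r S ε : ℝ} (hr : 0 ≤ r) (hrS : r ≤ S) (hε : 0 ≤ ε)
    {X : RoughPath γ} (hX : X ∈ roughBall γ r) : RoughFam S ε (fun _ : ι => X) :=
  ⟨fun ξ η => Near.const ((roughBall_bounds hr hX ξ η).1.trans
      (mul_le_mul_of_nonneg_right hrS (wt_nonneg _ _ _))) hε,
    fun ξ η k l => Near.const (((roughBall_bounds hr hX ξ η).2 k l).trans
      (mul_le_mul_of_nonneg_right hrS (sq_nonneg _))) hε⟩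

end RoughInterface

/-! ### Bounds of controlled paths -/

section CtrlInterface

variable {γ : ℝ}

/-- The bounds expressed by the norm `‖·‖_D`. -/
structure CtrlBound (γ S : ℝ) (x Y : Param → Vec) (Y' : Param → Vec →L[ℝ] Vec) : Prop where
  der : ∀ ξ, ‖Y' ξ‖ ≤ S
  inc : ∀ ξ η, ‖Y' η - Y' ξ‖ ≤ S * wt γ ξ η
  rem : ∀ ξ η, ‖Y η - Y ξ - Y' ξ (x η - x ξ)‖ ≤ S * wt γ ξ η ^ 2

theorem CtrlBound.mono {S S' : ℝ} {x Y : Param → Vec} {Y' : Param → Vec →L[ℝ] Vec}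
    (h : CtrlBound γ S x Y Y') (hS : S ≤ S') : CtrlBound γ S' x Y Y' :=
  ⟨fun ξ => (h.der ξ).trans hS,
    fun ξ η => (h.inc ξ η).trans (mul_le_mul_of_nonneg_right hS (wt_nonneg _ _ _)),
    fun ξ η => (h.rem ξ η).trans (mul_le_mul_of_nonneg_right hS (sq_nonneg _))⟩

theorem CtrlBound.nonneg {S : ℝ} {x Y : Param → Vec} {Y' : Param → Vec →L[ℝ] Vec}
    (h : CtrlBound γ S x Y Y') : 0 ≤ S := (norm_nonneg _).trans (h.der 0)

theorem CtrlFam.ctrlBound {ι : Type*} {S ε : ℝ} {x : ι → Param → Vec} {Y : ι → Param → Vec}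
    {Y' : ι → Param → Vec →L[ℝ] Vec} (h : CtrlFam γ S ε x Y Y') (i : ι) :
    CtrlBound γ S (x i) (Y i) (Y' i) :=
  ⟨fun ξ => (h.der ξ i i).1, fun ξ η => (h.inc ξ η i i).1, fun ξ η => (h.rem ξ η i i).1⟩

theorem ctrlNorm_le {S : ℝ} {x Y : Param → Vec} {Y' : Param → Vec →L[ℝ] Vec}
    (h : CtrlBound γ S x Y Y') : ctrlNorm γ x Y Y' ≤ ENNReal.ofReal (3 * S) := by
  have hS := h.nonneg
  have e : (3 : ℝ) * S = S + S + S := by ring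
  rw [e, ENNReal.ofReal_add (by positivity) hS, ENNReal.ofReal_add hS hS]
  refine add_le_add (add_le_add (holderSup_le hS fun ξ η => ?_) (holderSup_le hS fun ξ η => ?_))
    (iSup_le fun ξ => ENNReal.ofReal_le_ofReal (h.der ξ))
  · rw [dist_comm]; exact h.inc η ξ
  · rw [wt_sq]; exact h.rem ξ η

theorem ctrlBound_of_ctrlNorm_le {S : ℝ} (hS : 0 ≤ S) {x Y : Param → Vec}
    {Y' : Param → Vec →L[ℝ] Vec} (h : ctrlNorm γ x Y Y' ≤ ENNReal.ofReal S) :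
    CtrlBound γ S x Y Y' := by
  refine ⟨fun ξ => ?_, fun ξ η => ?_, fun ξ η => ?_⟩
  · exact (ENNReal.ofReal_le_ofReal_iff hS).1
      ((le_iSup (fun ξ => ENNReal.ofReal ‖Y' ξ‖) ξ).trans (le_add_self.trans h))
  · have := le_of_holderSup_le hS ((le_self_add.trans le_self_add).trans h) η ξ
    rwa [dist_comm] at this
  · have := le_of_holderSup_le hS ((le_add_self.trans le_self_add).trans h) ξ η
    rwa [wt_sq] at this

theorem ctrlFam_pair {S ε : ℝ} {x : Bool → Param → Vec} {Y : Bool → Param → Vec}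
    {Y' : Bool → Param → Vec →L[ℝ] Vec} (h : ∀ b, CtrlBound γ S (x b) (Y b) (Y' b))
    (h1 : ∀ ξ, ‖Y' false ξ - Y' true ξ‖ ≤ S * ε)
    (h2 : ∀ ξ η, ‖Y' false η - Y' false ξ - (Y' true η - Y' true ξ)‖ ≤ S * wt γ ξ η * ε)
    (h3 : ∀ ξ η, ‖Y false η - Y false ξ - Y' false ξ (x false η - x false ξ)
      - (Y true η - Y true ξ - Y' true ξ (x true η - x true ξ))‖ ≤ S * wt γ ξ η ^ 2 * ε) :
    CtrlFam γ S ε x Y Y' :=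
  ⟨fun ξ => Near.pair (fun b => (h b).der ξ) (h1 ξ),
    fun ξ η => Near.pair (fun b => (h b).inc ξ η) (h2 ξ η),
    fun ξ η => Near.pair (fun b => (h b).rem ξ η) (h3 ξ η)⟩

/-- Over a common path `x` the remainder is linear in `(Y, Y')`, so the difference of two controlled
paths is controlled by `x`. -/
theorem ctrlFam_pair_same {S ε : ℝ} {x : Param → Vec} {Y : Bool → Param → Vec}
    {Y' : Bool → Param → Vec →L[ℝ] Vec} (h : ∀ b, CtrlBound γ S x (Y b) (Y' b))
    (hd : CtrlBound γ (S * ε) x (Y false - Y true) (Y' false - Y' true)) :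
    CtrlFam γ S ε (fun _ => x) Y Y' := by
  refine ctrlFam_pair h hd.der (fun ξ η => ?_) (fun ξ η => ?_)
  · have := hd.inc ξ η
    simp only [Pi.sub_apply] at this
    rw [sub_sub_sub_comm, mul_right_comm]
    exact this
  · have := hd.rem ξ η
    simp only [Pi.sub_apply, sub_apply] at this
    rw [mul_right_comm]
    beta_reduce at this ⊢
    refine (le_of_eq ?_).trans this
    congr 1
    abel

theorem CtrlFam.ctrlBound_sub {ι : Type*} {S ε : ℝ} {x : Param → Vec} {Y : ι → Param → Vec}
    {Y' : ι → Param → Vec →L[ℝ] Vec} (h : CtrlFam γ S ε (fun _ => x) Y Y') (i j : ι) :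
    CtrlBound γ (S * ε) x (Y i - Y j) (Y' i - Y' j) := by
  refine ⟨fun ξ => (h.der ξ i j).2, fun ξ η => ?_, fun ξ η => ?_⟩
  · have := (h.inc ξ η i j).2
    simp only [Pi.sub_apply]
    rw [mul_right_comm, sub_sub_sub_comm]
    exact this
  · have := (h.rem ξ η i j).2
    simp only [Pi.sub_apply, sub_apply]
    rw [mul_right_comm]
    beta_reduce at this ⊢
    refine (le_of_eq ?_).trans this
    congr 1
    abel

end CtrlInterface

/-! ### The Banach space of controlled loops -/

section CtrlSpace

variable {γ : ℝ} {x : Param → Vec}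

/-- Bounded functions on a set. -/
abbrev Bdd (ι E : Type) [NormedAddCommGroup E] : Type := lp (fun _ : ι => E) ∞

/-- Bounded paths, derivatives, and normalized increments and remainders. -/
abbrev CtrlAmbient : Type :=
  Bdd Param Vec × Bdd Param (Vec →L[ℝ] Vec) × Bdd (Param × Param) (Vec →L[ℝ] Vec) ×
    Bdd (Param × Param) Vec

/-- The loops controlled by `x`. -/
def ctrlSpace (γ : ℝ) (x : Param → Vec) : Submodule ℝ CtrlAmbient where
  carrier := {z | z.1 0 = z.1 1 ∧ ∀ ξ η, z.2.1 η - z.2.1 ξ = wt γ ξ η • z.2.2.1 (ξ, η) ∧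
    z.1 η - z.1 ξ - z.2.1 ξ (x η - x ξ) = wt γ ξ η ^ 2 • z.2.2.2 (ξ, η)}
  zero_mem' := ⟨rfl, fun ξ η => ⟨by
    change (0 : Vec →L[ℝ] Vec) - 0 = wt γ ξ η • 0
    rw [sub_zero, smul_zero], by
    change (0 : Vec) - 0 - (0 : Vec →L[ℝ] Vec) (x η - x ξ) = wt γ ξ η ^ 2 • 0
    simp⟩⟩
  add_mem' := by
    rintro a b ⟨ha, ha'⟩ ⟨hb, hb'⟩
    refine ⟨by simp [ha, hb], fun ξ η => ⟨?_, ?_⟩⟩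
    · simp only [Prod.snd_add, Prod.fst_add, lp.coeFn_add, Pi.add_apply, smul_add,
        ← (ha' ξ η).1, ← (hb' ξ η).1]
      abel
    · simp only [Prod.snd_add, Prod.fst_add, lp.coeFn_add, Pi.add_apply, smul_add, add_apply,
        ← (ha' ξ η).2, ← (hb' ξ η).2]
      abel
  smul_mem' := by
    rintro c a ⟨ha, ha'⟩
    refine ⟨by simp [ha], fun ξ η => ⟨?_, ?_⟩⟩
    · simp only [Prod.smul_snd, Prod.smul_fst, lp.coeFn_smul, Pi.smul_apply, ← smul_sub,
        (ha' ξ η).1]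
      rw [smul_comm]
    · simp only [Prod.smul_snd, Prod.smul_fst, lp.coeFn_smul, Pi.smul_apply, ← smul_sub,
        smul_apply, (ha' ξ η).2]
      rw [smul_comm]

theorem continuous_bdd_eval {ι E : Type} [NormedAddCommGroup E] (i : ι) :
    Continuous fun f : Bdd ι E => f i :=
  (lp.lipschitzWith_one_eval ∞ i).continuous

/-- Normalized increments and remainders are stored as separate bounded functions, so that the sup
norm of the product controls the whole norm `‖·‖*_D`. The compatibility conditions and closedness
involve only continuous evaluations and define a closed subspace. -/
instance : CompleteSpace (ctrlSpace γ x) := by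
  refine IsClosed.completeSpace_coe (hs := ?_)
  have e1 : ∀ ξ, Continuous fun z : CtrlAmbient => z.1 ξ := fun ξ =>
    (continuous_bdd_eval ξ).comp continuous_fst
  have e2 : ∀ ξ, Continuous fun z : CtrlAmbient => z.2.1 ξ := fun ξ =>
    (continuous_bdd_eval ξ).comp (continuous_fst.comp continuous_snd)
  have e3 : ∀ p, Continuous fun z : CtrlAmbient => z.2.2.1 p := fun p =>
    (continuous_bdd_eval p).comp (continuous_fst.comp (continuous_snd.comp continuous_snd))
  have e4 : ∀ p, Continuous fun z : CtrlAmbient => z.2.2.2 p := fun p =>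
    (continuous_bdd_eval p).comp (continuous_snd.comp (continuous_snd.comp continuous_snd))
  have hc : ((ctrlSpace γ x : Submodule ℝ CtrlAmbient) : Set CtrlAmbient)
      = {z | z.1 0 = z.1 1} ∩ ⋂ ξ, ⋂ η, ({z | z.2.1 η - z.2.1 ξ = wt γ ξ η • z.2.2.1 (ξ, η)} ∩
        {z | z.1 η - z.1 ξ - z.2.1 ξ (x η - x ξ) = wt γ ξ η ^ 2 • z.2.2.2 (ξ, η)}) := by
    ext z
    simp only [mem_inter_iff, mem_iInter, mem_ofPred_eq]
    rfl
  rw [hc]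
  refine (isClosed_eq (e1 0) (e1 1)).inter (isClosed_iInter fun ξ => isClosed_iInter fun η =>
    IsClosed.inter (isClosed_eq ((e2 η).sub (e2 ξ))
        ((continuous_const_smul (wt γ ξ η)).comp (e3 (ξ, η))))
      (isClosed_eq (((e1 η).sub (e1 ξ)).sub ?_)
        ((continuous_const_smul (wt γ ξ η ^ 2)).comp (e4 (ξ, η)))))
  exact (e2 ξ).clm_apply continuous_const

/-- The element of `ctrlSpace` with components `Y`, `Y'`. -/
structure IsCtrlElem (e : ctrlSpace γ x) (Y : Param → Vec) (Y' : Param → Vec →L[ℝ] Vec) :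
    Prop where
  path : ∀ ξ, e.1.1 ξ = Y ξ
  der : ∀ ξ, e.1.2.1 ξ = Y' ξ
  inc : ∀ ξ η, e.1.2.2.1 (ξ, η) = (wt γ ξ η)⁻¹ • (Y' η - Y' ξ)
  rem : ∀ ξ η, e.1.2.2.2 (ξ, η) = (wt γ ξ η ^ 2)⁻¹ • (Y η - Y ξ - Y' ξ (x η - x ξ))

theorem norm_inv_smul_le {E : Type*} [NormedAddCommGroup E] [NormedSpace ℝ E] {w C : ℝ} {v : E}
    (hw : 0 ≤ w) (hC : 0 ≤ C) (h : ‖v‖ ≤ C * w) : ‖w⁻¹ • v‖ ≤ C := by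
  rw [norm_smul, norm_inv, Real.norm_of_nonneg hw]
  rcases hw.eq_or_lt with h0 | h0
  · rw [← h0]; simpa using hC
  · rw [inv_mul_le_iff₀ h0, mul_comm]; exact h

/-- At weight zero the bound forces `v = 0`, so dividing by the weight loses nothing. -/
theorem smul_inv_smul_of_norm_le {E : Type*} [NormedAddCommGroup E] [NormedSpace ℝ E] {w C : ℝ}
    {v : E} (h : ‖v‖ ≤ C * w) : w • w⁻¹ • v = v := by
  rcases eq_or_ne w 0 with h0 | h0
  · rw [h0, mul_zero] at h
    rw [norm_le_zero_iff.1 h, smul_zero, smul_zero]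
  · exact smul_inv_smul₀ h0 v

theorem exists_isCtrlElem {C : ℝ} {Y : Param → Vec} {Y' : Param → Vec →L[ℝ] Vec}
    (h : CtrlBound γ C x Y Y') (hs : ∀ ξ, ‖Y ξ‖ ≤ C) (hc : Y 0 = Y 1) :
    ∃ e : ctrlSpace γ x, IsCtrlElem e Y Y' := by
  have mem : ∀ {ι E : Type} [NormedAddCommGroup E] (f : ι → E), (∀ i, ‖f i‖ ≤ C) →
      Memℓp (E := fun _ : ι => E) f ∞ := fun f hf =>
    memℓp_infty ⟨C, by rintro _ ⟨i, rfl⟩; exact hf i⟩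
  have h3 : ∀ p : Param × Param, ‖(wt γ p.1 p.2)⁻¹ • (Y' p.2 - Y' p.1)‖ ≤ C := fun p =>
    norm_inv_smul_le (wt_nonneg _ _ _) h.nonneg (h.inc p.1 p.2)
  have h4 : ∀ p : Param × Param,
      ‖(wt γ p.1 p.2 ^ 2)⁻¹ • (Y p.2 - Y p.1 - Y' p.1 (x p.2 - x p.1))‖ ≤ C := fun p =>
    norm_inv_smul_le (sq_nonneg _) h.nonneg (h.rem p.1 p.2)
  refine ⟨⟨(⟨Y, mem Y hs⟩, ⟨Y', mem Y' h.der⟩, ⟨_, mem _ h3⟩, ⟨_, mem _ h4⟩), hc, fun ξ η =>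
    ⟨?_, ?_⟩⟩, fun _ => rfl, fun _ => rfl, fun _ _ => rfl, fun _ _ => rfl⟩
  · exact (smul_inv_smul_of_norm_le (h.inc ξ η)).symm
  · exact (smul_inv_smul_of_norm_le (h.rem ξ η)).symm

theorem IsCtrlElem.norm_sub_le {e e' : ctrlSpace γ x} {Y Z : Param → Vec}
    {Y' Z' : Param → Vec →L[ℝ] Vec} (he : IsCtrlElem e Y Y') (he' : IsCtrlElem e' Z Z') {C : ℝ}
    (h : CtrlBound γ C x (Y - Z) (Y' - Z')) (hs : ∀ ξ, ‖Y ξ - Z ξ‖ ≤ C) : ‖e - e'‖ ≤ C := by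
  have hC := h.nonneg
  change ‖e.1 - e'.1‖ ≤ C
  refine norm_prod_le_iff.2 ⟨lp.norm_le_of_forall_le hC fun ξ => ?_,
    norm_prod_le_iff.2 ⟨lp.norm_le_of_forall_le hC fun ξ => ?_,
    norm_prod_le_iff.2 ⟨lp.norm_le_of_forall_le hC fun p => ?_,
      lp.norm_le_of_forall_le hC fun p => ?_⟩⟩⟩
  · change ‖e.1.1 ξ - e'.1.1 ξ‖ ≤ C
    rw [he.path, he'.path]; exact hs ξ
  · change ‖e.1.2.1 ξ - e'.1.2.1 ξ‖ ≤ C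
    rw [he.der, he'.der]; exact h.der ξ
  · change ‖e.1.2.2.1 (p.1, p.2) - e'.1.2.2.1 (p.1, p.2)‖ ≤ C
    rw [he.inc, he'.inc, ← smul_sub]
    refine norm_inv_smul_le (wt_nonneg _ _ _) hC ?_
    have := h.inc p.1 p.2
    simp only [Pi.sub_apply] at this
    rwa [sub_sub_sub_comm]
  · change ‖e.1.2.2.2 (p.1, p.2) - e'.1.2.2.2 (p.1, p.2)‖ ≤ C
    rw [he.rem, he'.rem, ← smul_sub]
    refine norm_inv_smul_le (sq_nonneg _) hC ?_
    have := h.rem p.1 p.2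
    simp only [Pi.sub_apply, sub_apply] at this
    refine (le_of_eq ?_).trans this
    congr 1
    abel

theorem isCtrlElem_zero : IsCtrlElem (0 : ctrlSpace γ x) 0 0 :=
  ⟨fun _ => rfl, fun _ => rfl, fun _ _ => by simp, fun _ _ => by simp⟩

theorem IsCtrlElem.norm_le {e : ctrlSpace γ x} {Y : Param → Vec}
    {Y' : Param → Vec →L[ℝ] Vec} (he : IsCtrlElem e Y Y') {C : ℝ}
    (h : CtrlBound γ C x Y Y') (hs : ∀ ξ, ‖Y ξ‖ ≤ C) : ‖e‖ ≤ C := by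
  have := he.norm_sub_le isCtrlElem_zero (C := C) (by simpa using h) (by simpa using hs)
  rwa [sub_zero] at this

theorem bdd_norm_apply_le {ι E : Type} [NormedAddCommGroup E] (f : Bdd ι E) (i : ι) :
    ‖f i‖ ≤ ‖f‖ := lp.norm_apply_le_norm ENNReal.top_ne_zero f i

theorem ctrlSpace_bounds (e : ctrlSpace γ x) :
    CtrlBound γ ‖e‖ x e.1.1 e.1.2.1 ∧ (∀ ξ, ‖e.1.1 ξ‖ ≤ ‖e‖) ∧ e.1.1 0 = e.1.1 1 := by
  have n1 : ‖e.1.1‖ ≤ ‖e‖ := norm_fst_le e.1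
  have n2 : ‖e.1.2‖ ≤ ‖e‖ := norm_snd_le e.1
  have n21 : ‖e.1.2.1‖ ≤ ‖e‖ := (norm_fst_le e.1.2).trans n2
  have n22 : ‖e.1.2.2‖ ≤ ‖e‖ := (norm_snd_le e.1.2).trans n2
  have n3 : ‖e.1.2.2.1‖ ≤ ‖e‖ := (norm_fst_le e.1.2.2).trans n22
  have n4 : ‖e.1.2.2.2‖ ≤ ‖e‖ := (norm_snd_le e.1.2.2).trans n22
  refine ⟨⟨fun ξ => (bdd_norm_apply_le _ _).trans n21, fun ξ η => ?_, fun ξ η => ?_⟩,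
    fun ξ => (bdd_norm_apply_le _ _).trans n1, e.2.1⟩
  · rw [(e.2.2 ξ η).1, norm_smul, Real.norm_of_nonneg (wt_nonneg _ _ _), mul_comm]
    exact mul_le_mul_of_nonneg_right ((bdd_norm_apply_le _ _).trans n3) (wt_nonneg _ _ _)
  · rw [(e.2.2 ξ η).2, norm_smul, Real.norm_of_nonneg (sq_nonneg _), mul_comm]
    exact mul_le_mul_of_nonneg_right ((bdd_norm_apply_le _ _).trans n4) (sq_nonneg _)

/-- Evaluation of the path. -/
def evalPath (ξ : Param) : ctrlSpace γ x →L[ℝ] Vec :=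
  LinearMap.mkContinuous
    { toFun := fun e => e.1.1 ξ
      map_add' := fun _ _ => rfl
      map_smul' := fun _ _ => rfl } 1 fun e => by
    rw [one_mul]; exact (ctrlSpace_bounds e).2.1 ξ

/-- Evaluation of the derivative. -/
def evalDer (ξ : Param) : ctrlSpace γ x →L[ℝ] Vec →L[ℝ] Vec :=
  LinearMap.mkContinuous
    { toFun := fun e => e.1.2.1 ξ
      map_add' := fun _ _ => rfl
      map_smul' := fun _ _ => rfl } 1 fun e => by
    rw [one_mul]; exact (ctrlSpace_bounds e).1.der ξ

end CtrlSpace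

/-! ### Local existence -/

theorem RoughPath.bounded {γ : ℝ} (X : RoughPath γ) : ∃ C, ∀ ξ, ‖X.path ξ‖ ≤ C := by
  obtain ⟨C, hC⟩ := (isCompact_range X.path_continuous).isBounded.exists_norm_le
  exact ⟨C, fun ξ => hC _ (mem_range_self ξ)⟩

theorem ctrlBound_initial (γ : ℝ) (x : Param → Vec) :
    CtrlBound γ 1 x x (fun _ => ContinuousLinearMap.id ℝ Vec) :=
  ⟨fun _ => ContinuousLinearMap.norm_id_le, fun _ _ => by
    simpa using wt_nonneg _ _ _, fun _ _ => by simpa using sq_nonneg _⟩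

theorem CtrlBound.add {γ S S' : ℝ} {x Y Z : Param → Vec} {Y' Z' : Param → Vec →L[ℝ] Vec}
    (h : CtrlBound γ S x Y Y') (h' : CtrlBound γ S' x Z Z') :
    CtrlBound γ (S + S') x (Y + Z) (Y' + Z') := by
  refine ⟨fun ξ => (norm_add_le _ _).trans (add_le_add (h.der ξ) (h'.der ξ)), fun ξ η => ?_,
    fun ξ η => ?_⟩
  · simp only [Pi.add_apply]
    rw [add_sub_add_comm, add_mul]
    exact (norm_add_le _ _).trans (add_le_add (h.inc ξ η) (h'.inc ξ η))
  · simp only [Pi.add_apply, add_apply]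
    rw [add_mul]
    refine (le_of_eq ?_).trans ((norm_add_le _ _).trans (add_le_add (h.rem ξ η) (h'.rem ξ η)))
    congr 1
    abel

theorem integral_eq_of_hasDerivWithinAt {E : Type*} [NormedAddCommGroup E] [NormedSpace ℝ E]
    [CompleteSpace E] {T : ℝ} {f f' : ℝ → E}
    (hf : ∀ t ∈ Icc 0 T, HasDerivWithinAt f (f' t) (Icc 0 T) t) (hf' : ContinuousOn f' (Icc 0 T))
    {t : ℝ} (ht : t ∈ Icc 0 T) :
    IntervalIntegrable f' volume 0 t ∧ f t = f 0 + ∫ s in (0 : ℝ)..t, f' s := by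
  have hsub : Icc 0 t ⊆ Icc 0 T := Icc_subset_Icc_right ht.2
  have hi : IntervalIntegrable f' volume 0 t :=
    (hf'.mono (by rw [uIcc_of_le ht.1]; exact hsub)).intervalIntegrable
  refine ⟨hi, ?_⟩
  rw [intervalIntegral.integral_eq_sub_of_hasDeriv_right_of_le ht.1
    (fun s hs => (hf s (hsub hs)).continuousWithinAt.mono hsub) (fun s hs => ?_) hi]
  · abel
  · refine ((hf s (hsub (Ioo_subset_Icc_self hs))).mono_of_mem_nhdsWithin ?_)
    exact mem_nhdsWithin_of_mem_nhds (Icc_mem_nhds hs.1 (hs.2.trans_le ht.2))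

/-- The speed bound `C` and the radius one limit the time by `C * T ≤ 1`; the Lipschitz constant
plays no role. The mean value inequality keeps the trajectory in the ball. -/
theorem exists_flow {E : Type*} [NormedAddCommGroup E] [NormedSpace ℝ E] [CompleteSpace E]
    (f : E → E) (z₀ : E) {C L T : ℝ} (hC : 0 ≤ C) (hT : 0 ≤ T) (hCT : C * T ≤ 1)
    (hlip : LipschitzOnWith L.toNNReal f (Metric.closedBall z₀ 1)) (hf : ∀ z, ‖f z‖ ≤ C) :
    ∃ α : ℝ → E, α 0 = z₀ ∧ (∀ t ∈ Icc 0 T, HasDerivWithinAt α (f (α t)) (Icc 0 T) t) ∧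
      ∀ t ∈ Icc 0 T, α t ∈ Metric.closedBall z₀ 1 := by
  have hPL : IsPicardLindelof (fun _ => f) (⟨0, le_rfl, hT⟩ : Icc 0 T) z₀ 1 0
      C.toNNReal L.toNNReal := by
    refine ⟨fun _ _ => hlip, fun _ _ => continuousOn_const, fun _ _ z _ => ?_, ?_⟩
    · rw [Real.coe_toNNReal _ hC]; exact hf z
    · rw [Real.coe_toNNReal _ hC]
      simp only [sub_zero, sub_self, max_eq_left hT, NNReal.coe_one, NNReal.coe_zero]
      exact hCT
  obtain ⟨α, hα0, hα⟩ := hPL.exists_eq_forall_mem_Icc_hasDerivWithinAt₀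
  simp only at hα0
  refine ⟨α, hα0, hα, fun t ht => ?_⟩
  rw [mem_closedBall_iff_norm, ← hα0]
  refine (norm_image_sub_le_of_norm_deriv_le_segment' hα (fun s _ => hf _) t ht).trans ?_
  rw [sub_zero]
  exact (mul_le_mul_of_nonneg_left ht.2 hC).trans hCT

theorem tendsto_ofReal_norm_sub {E : Type*} [NormedAddCommGroup E] {α : ℝ → E} {s : Set ℝ}
    {t : ℝ} (h : ContinuousWithinAt α s t) (c : ℝ) :
    Tendsto (fun u => ENNReal.ofReal (c * ‖α u - α t‖)) (𝓝[s] t) (𝓝 0) := by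
  have h1 : Tendsto (fun u => c * ‖α u - α t‖) (𝓝[s] t) (𝓝 (c * ‖α t - α t‖)) :=
    ((h.tendsto.sub_const (α t)).norm).const_mul c
  have := ENNReal.tendsto_ofReal h1
  simpa using this

-- The equation for `(Y, Y')` is an autonomous ordinary differential equation in `ctrlSpace`,
-- started at `(X, Id)`. Two bounds on `A` appear because `M` fixes the time, whereas `M'`, with the
-- second differences of `A3`, is used only for the Lipschitz property.
set_option maxHeartbeats 1000000 in
theorem exists_roughSolution {γ r : ℝ} (hγ : 1 / 3 < γ) (hr : 0 ≤ r) (M : ℝ≥0)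
    {A : Vec → Vec →L[ℝ] Vec} {M' : ℝ} {A1 A2 A3} (hA : FieldData (M : ℝ) A A1 A2 A3)
    (hA' : FieldData M' A A1 A2 A3) (h2 : TwoLip M' A3) {X : RoughPath γ}
    (hX : X ∈ roughBall γ r) :
    ∃ (Y : ℝ → Param → Vec) (Y' : ℝ → Param → Vec →L[ℝ] Vec),
      IsRoughSolution A X (1 / (evoConst γ (max r 2) * M + 1)) Y Y' ∧
      ∀ t ∈ Icc 0 (1 / (evoConst γ (max r 2) * M + 1)), CtrlBound γ 2 X.path (Y t) (Y' t) := by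
  classical
  -- The initial pair has bound one and the ball has radius one, so every loop in the ball has bound
  -- `2`; the data have size `r`.
  set S := max r 2 with hS
  have hS2 : 2 ≤ S := le_max_right _ _
  have hS0 : 0 ≤ S := by linarith
  have hK := evoConst_nonneg hγ hS0
  have hM' : 0 ≤ M' := (norm_nonneg _).trans (hA'.b1 0)
  set K := evoConst γ S with hKdef
  set T := 1 / (K * M + 1) with hT
  have hKM : 0 ≤ K * M := by positivity
  have hT0 : 0 < T := by positivity
  obtain ⟨CX, hCX⟩ := X.bounded
  have hCXm : ∀ ξ, ‖X.path ξ‖ ≤ max 1 CX := fun ξ => (hCX ξ).trans (le_max_right _ _)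
  obtain ⟨z₀, hz₀⟩ := exists_isCtrlElem
    ((ctrlBound_initial γ X.path).mono (le_max_left 1 CX)) hCXm X.path_closed
  -- bounds on the ball
  have hball : ∀ z ∈ Metric.closedBall z₀ 1, CtrlBound γ 2 X.path z.1.1 z.1.2.1 := by
    intro z hz
    rw [mem_closedBall_iff_norm] at hz
    have h1 := (ctrlBound_initial γ X.path).add ((ctrlSpace_bounds (z - z₀)).1.mono hz)
    have e1 : X.path + ((z - z₀).1.1 : Param → Vec) = z.1.1 := by
      funext ξ
      change X.path ξ + (z.1.1 ξ - z₀.1.1 ξ) = z.1.1 ξ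
      rw [hz₀.path]; abel
    have e2 : (fun _ : Param => ContinuousLinearMap.id ℝ Vec)
        + ((z - z₀).1.2.1 : Param → Vec →L[ℝ] Vec)
        = z.1.2.1 := by
      funext ξ
      change ContinuousLinearMap.id ℝ Vec + (z.1.2.1 ξ - z₀.1.2.1 ξ) = z.1.2.1 ξ
      rw [hz₀.der]; abel
    rw [e1, e2] at h1
    exact h1.mono (by norm_num)
  have hloop : ∀ z ∈ Metric.closedBall z₀ 1, ∀ z' ∈ Metric.closedBall z₀ 1,
      LoopFam S ‖z - z'‖ (fun _ : Bool => X) (fun b => (bif b then z' else z).1.1)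
        (fun b => (bif b then z' else z).1.2.1) := by
    intro z hz z' hz'
    have hn : ‖z - z'‖ ≤ S * ‖z - z'‖ := by nlinarith [norm_nonneg (z - z')]
    have hb := ctrlSpace_bounds (z - z')
    refine ⟨roughFam_const hr (le_max_left _ _) (norm_nonneg _) hX,
      ctrlFam_pair_same (fun b => ?_) (hb.1.mono hn), fun b => ?_, fun i j ξ => ?_⟩
    · cases b
      · exact (hball z hz).mono hS2
      · exact (hball z' hz').mono hS2
    · cases b
      · exact z.2.1
      · exact z'.2.1
    · cases i <;> cases j
      · rw [sub_self, norm_zero]; exact mul_nonneg hS0 (norm_nonneg _)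
      · exact (hb.2.1 ξ).trans hn
      · rw [norm_sub_rev]; exact (hb.2.1 ξ).trans hn
      · rw [sub_self, norm_zero]; exact mul_nonneg hS0 (norm_nonneg _)
  set W : ctrlSpace γ X.path → Param → Vec := fun z ξ => vel A X z.1.1 z.1.2.1 (z.1.1 ξ) with hW
  set W' : ctrlSpace γ X.path → Param → Vec →L[ℝ] Vec := fun z ξ =>
    (dvel A X z.1.1 z.1.2.1 (z.1.1 ξ)).comp (z.1.2.1 ξ) with hW'
  have hWb : ∀ z ∈ Metric.closedBall z₀ 1, CtrlBound γ (K * M) X.path (W z) (W' z) ∧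
      ∀ ξ, ‖W z ξ‖ ≤ K * M := by
    intro z hz
    have h1 := ((hloop z hz z hz).single false).evo hγ le_rfl hS0 hA (Or.inl rfl)
    exact ⟨h1.1.ctrlBound (), fun ξ => (h1.2 ξ () ()).1⟩
  have hWd : ∀ z ∈ Metric.closedBall z₀ 1, ∀ z' ∈ Metric.closedBall z₀ 1,
      CtrlBound γ (K * M' * ‖z - z'‖) X.path (W z - W z') (W' z - W' z') ∧
      ∀ ξ, ‖W z ξ - W z' ξ‖ ≤ K * M' * ‖z - z'‖ := by
    intro z hz z' hz'
    have h1 := (hloop z hz z' hz').evo hγ (norm_nonneg _) hS0 hA' (Or.inr h2)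
    exact ⟨h1.1.ctrlBound_sub false true, fun ξ => (h1.2 ξ false true).2⟩
  have hex : ∀ z ∈ Metric.closedBall z₀ 1, ∃ e : ctrlSpace γ X.path, IsCtrlElem e (W z) (W' z) :=
    fun z hz => exists_isCtrlElem (hWb z hz).1 (hWb z hz).2 (by
      simp only [hW]; rw [z.2.1])
  -- The value zero outside the ball makes the bound on `f` global, as `exists_flow` asks;
  -- trajectories never leave the ball.
  set f : ctrlSpace γ X.path → ctrlSpace γ X.path := fun z =>
    if h : z ∈ Metric.closedBall z₀ 1 then (hex z h).choose else 0 with hf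
  have hfe : ∀ z ∈ Metric.closedBall z₀ 1, IsCtrlElem (f z) (W z) (W' z) := fun z hz => by
    simp only [hf, dif_pos hz]; exact (hex z hz).choose_spec
  have hfn : ∀ z, ‖f z‖ ≤ K * M := fun z => by
    by_cases hz : z ∈ Metric.closedBall z₀ 1
    · exact (hfe z hz).norm_le (hWb z hz).1 (hWb z hz).2
    · simp only [hf, dif_neg hz, norm_zero]; exact hKM
  have hlip : LipschitzOnWith (Real.toNNReal (K * M')) f (Metric.closedBall z₀ 1) := by
    refine LipschitzOnWith.of_dist_le_mul fun z hz z' hz' => ?_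
    rw [dist_eq_norm, dist_eq_norm, Real.coe_toNNReal _ (by positivity)]
    exact (hfe z hz).norm_sub_le (hfe z' hz') (hWd z hz z' hz').1 (hWd z hz z' hz').2
  have hTK : K * M * T ≤ 1 := by
    rw [hT, mul_one_div]
    exact div_le_one_of_le₀ (by linarith) (by linarith)
  obtain ⟨α, hα0, hα, hαb⟩ := exists_flow f z₀ hKM hT0.le hTK hlip hfn
  have hαc : ContinuousOn α (Icc 0 T) := fun t ht => (hα t ht).continuousWithinAt
  have hfc : ContinuousOn (fun t => f (α t)) (Icc 0 T) :=
    hlip.continuousOn.comp hαc hαb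
  refine ⟨fun t => (α t).1.1, fun t => (α t).1.2.1, ⟨fun t ht => ?_, fun t ht => ?_, ?_⟩,
    fun t ht => hball _ (hαb t ht)⟩
  · have hb := ctrlSpace_bounds (α t)
    refine ⟨hb.2.2, ENNReal.add_lt_top.2 ⟨(ctrlNorm_le hb.1).trans_lt ENNReal.ofReal_lt_top,
      (iSup_le fun ξ => ENNReal.ofReal_le_ofReal (hb.2.1 ξ)).trans_lt ENNReal.ofReal_lt_top⟩⟩
  · have hlim := tendsto_ofReal_norm_sub (hαc t ht) 4
    refine tendsto_of_tendsto_of_tendsto_of_le_of_le tendsto_const_nhds hlim (fun _ => zero_le)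
      fun s => ?_
    have hb := ctrlSpace_bounds (α s - α t)
    have e : 4 * ‖α s - α t‖ = 3 * ‖α s - α t‖ + ‖α s - α t‖ := by ring
    rw [e, ENNReal.ofReal_add (by positivity) (norm_nonneg _)]
    exact add_le_add (ctrlNorm_le hb.1) (iSup_le fun ξ => ENNReal.ofReal_le_ofReal (hb.2.1 ξ))
  · refine ⟨fun s => vel A X (α s).1.1 (α s).1.2.1, fun s => dvel A X (α s).1.1 (α s).1.2.1,
      fun s hs x => ?_, fun s hs x => ?_, fun t ht ξ => ?_⟩
    · exact (((hloop _ (hαb s hs) _ (hαb s hs)).single false).vel hγ le_rfl hS0 hA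
        (Or.inl rfl)).1 () x
    · exact (((hloop _ (hαb s hs) _ (hαb s hs)).single false).vel hγ le_rfl hS0 hA
        (Or.inl rfl)).2.2.hasFDeriv () x
    -- The pointwise integral equations follow by applying the continuous evaluations at `ξ` to the
    -- equation in `ctrlSpace`.
    · have c1 : ContinuousOn (fun s => W (α s) ξ) (Icc 0 T) :=
        ((evalPath ξ).continuous.comp_continuousOn hfc).congr fun s hs =>
          ((hfe _ (hαb s hs)).path ξ).symm
      have c2 : ContinuousOn (fun s => W' (α s) ξ) (Icc 0 T) :=
        ((evalDer ξ).continuous.comp_continuousOn hfc).congr fun s hs =>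
          ((hfe _ (hαb s hs)).der ξ).symm
      have d1 : ∀ s ∈ Icc 0 T, HasDerivWithinAt (fun s => (α s).1.1 ξ) (W (α s) ξ) (Icc 0 T) s :=
        fun s hs => by
          have := (evalPath ξ).hasFDerivAt.comp_hasDerivWithinAt s (hα s hs)
          rwa [show evalPath ξ (f (α s)) = W (α s) ξ from (hfe _ (hαb s hs)).path ξ] at this
      have d2 : ∀ s ∈ Icc 0 T,
          HasDerivWithinAt (fun s => (α s).1.2.1 ξ) (W' (α s) ξ) (Icc 0 T) s :=
        fun s hs => by
          have := (evalDer ξ).hasFDerivAt.comp_hasDerivWithinAt s (hα s hs)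
          rwa [show evalDer ξ (f (α s)) = W' (α s) ξ from (hfe _ (hαb s hs)).der ξ] at this
      obtain ⟨i1, j1⟩ := integral_eq_of_hasDerivWithinAt d1 c1 ht
      obtain ⟨i2, j2⟩ := integral_eq_of_hasDerivWithinAt d2 c2 ht
      refine ⟨i1, ?_, i2, ?_⟩
      · rw [hα0, hz₀.path] at j1; exact j1
      · rw [hα0, hz₀.der] at j2; exact j2

theorem exists_existenceTime {γ : ℝ} (hγ : 1 / 3 < γ) {r : ℝ} (hr : 0 < r) (M : ℝ≥0) :
    ∃ T₀ : ℝ, 0 < T₀ ∧ ∃ B : ℝ≥0, ∀ A : Vec → Vec →L[ℝ] Vec,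
      ContDiff ℝ 5 A → gradNorm A 4 < ⊤ → gradNorm A 3 ≤ M → IsExistenceTime γ r A T₀ B := by
  have hK := evoConst_nonneg hγ (S := max r 2) (le_max_of_le_left hr.le)
  -- The bound `6` is three summands of `‖·‖_D`, each at most `2`.
  refine ⟨1 / (evoConst γ (max r 2) * M + 1), by positivity, 6, fun A hA h4 h3 X hX => ?_⟩
  have h4' : gradNorm A 4 ≤ (gradNorm A 4).toNNReal := (ENNReal.coe_toNNReal h4.ne).ge
  have b4 : ∀ k < 5, ∀ x, ‖iteratedFDeriv ℝ (k + 1) A x‖ ≤ (gradNorm A 4).toNNReal :=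
    fun k hk x => norm_iteratedFDeriv_le_of_gradNorm h4' hk x
  obtain ⟨Y, Y', h, hb⟩ := exists_roughSolution hγ hr.le M
    (fieldData_of_contDiff hA fun k hk x => norm_iteratedFDeriv_le_of_gradNorm h3 hk x)
    (fieldData_of_contDiff hA fun k hk x => b4 k (by omega) x) (twoLip_of_contDiff hA b4) hX
  refine ⟨Y, Y', h, fun t ht => (ctrlNorm_le (hb t ht)).trans ?_⟩
  norm_num

/-! ### Integrals in time -/

section Accum

variable {E F : Type*} [NormedAddCommGroup E] [NormedSpace ℝ E] [NormedAddCommGroup F]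
  [NormedSpace ℝ F]

/-- `v` is the integral of the integrable function `q` over `[0,t]`. -/
structure Accum (q : ℝ → E) (t : ℝ) (v : E) : Prop where
  int : IntervalIntegrable q volume 0 t
  eq : v = ∫ s in (0 : ℝ)..t, q s

theorem Accum.sub {q q' : ℝ → E} {t : ℝ} {v v' : E} (h : Accum q t v) (h' : Accum q' t v') :
    Accum (fun s => q s - q' s) t (v - v') :=
  ⟨h.int.sub h'.int, by rw [h.eq, h'.eq, intervalIntegral.integral_sub h.int h'.int]⟩

theorem Accum.clm [CompleteSpace E] [CompleteSpace F] {q : ℝ → E} {t : ℝ} {v : E}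
    (h : Accum q t v) (L : E →L[ℝ] F) : Accum (fun s => L (q s)) t (L v) := by
  refine ⟨⟨L.integrable_comp h.int.1, L.integrable_comp h.int.2⟩, ?_⟩
  rw [h.eq, L.intervalIntegral_comp_comm h.int]

theorem Accum.congr {q q' : ℝ → E} {t : ℝ} {v : E} (h : Accum q t v) (ht : 0 ≤ t)
    (hq : ∀ s ∈ Icc 0 t, q s = q' s) : Accum q' t v := by
  have hq' : EqOn q q' (uIcc 0 t) := by rw [uIcc_of_le ht]; exact hq
  refine ⟨h.int.congr (hq'.mono uIoc_subset_uIcc), ?_⟩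
  rw [h.eq]
  exact intervalIntegral.integral_congr hq'

theorem integral_exp_le {l : ℝ} (hl : 0 < l) (t : ℝ) :
    ∫ s in (0 : ℝ)..t, Real.exp (l * s) ≤ Real.exp (l * t) / l := by
  have hd : ∀ s ∈ uIcc 0 t, HasDerivAt (fun s => Real.exp (l * s) / l) (Real.exp (l * s)) s := by
    intro s _
    have := (((hasDerivAt_id s).const_mul l).exp).div_const l
    simpa [hl.ne'] using this
  rw [intervalIntegral.integral_eq_sub_of_hasDerivAt hd
    (Continuous.intervalIntegrable (by fun_prop) _ _)]
  have : 0 < Real.exp (l * 0) / l := by positivity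
  linarith

/-- Integrating in time against the weight `exp (l * s)` gains the factor `1 / l`; large `l` turns
Lipschitz bounds into contractions on any time interval. -/
theorem Accum.norm_le {q : ℝ → E} {t c l : ℝ} {v : E} (h : Accum q t v)
    (ht : 0 ≤ t) (hc : 0 ≤ c) (hl : 0 < l)
    (hq : ∀ s ∈ Icc 0 t, ‖q s‖ ≤ c * Real.exp (l * s)) :
    ‖v‖ ≤ c / l * Real.exp (l * t) := by
  rw [h.eq]
  refine (intervalIntegral.norm_integral_le_of_norm_le (g := fun s => c * Real.exp (l * s)) ht
    (ae_of_all _ fun s hs => hq s (Ioc_subset_Icc_self hs))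
    (Continuous.intervalIntegrable (by fun_prop) _ _)).trans ?_
  rw [intervalIntegral.integral_const_mul, div_mul_eq_mul_div, mul_div_assoc]
  exact mul_le_mul_of_nonneg_left (integral_exp_le hl t) hc

end Accum

/-! ### Solutions with uniform bounds -/

section Flow

variable {γ : ℝ}

/-- A solution on `[0,T]` bounded by `S`. -/
structure BddFlow (A : Vec → Vec →L[ℝ] Vec) (S : ℝ) (X : RoughPath γ) (T : ℝ)
    (Y : ℝ → Param → Vec) (Y' : ℝ → Param → Vec →L[ℝ] Vec) : Prop where
  bound : ∀ t ∈ Icc 0 T, CtrlBound γ S X.path (Y t) (Y' t)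
  closed : ∀ t ∈ Icc 0 T, Y t 0 = Y t 1
  path : ∀ t ∈ Icc 0 T, ∀ ξ,
    Accum (fun s => vel A X (Y s) (Y' s) (Y s ξ)) t (Y t ξ - X.path ξ)
  der : ∀ t ∈ Icc 0 T, ∀ ξ, Accum (fun s => (dvel A X (Y s) (Y' s) (Y s ξ)).comp (Y' s ξ)) t
    (Y' t ξ - ContinuousLinearMap.id ℝ Vec)

theorem BddFlow.loopFam {A : Vec → Vec →L[ℝ] Vec} {S r : ℝ} {X : RoughPath γ} {T : ℝ}
    {Y : ℝ → Param → Vec} {Y' : ℝ → Param → Vec →L[ℝ] Vec} (hr : 0 ≤ r) (hrS : r ≤ S)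
    (hX : X ∈ roughBall γ r) (h : BddFlow A S X T Y Y') {s : ℝ} (hs : s ∈ Icc 0 T) :
    LoopFam S 0 (fun _ : Unit => X) (fun _ => Y s) (fun _ => Y' s) :=
  ⟨roughFam_const hr hrS le_rfl hX,
    ⟨fun ξ _ _ => ⟨(h.bound s hs).der ξ, by simp⟩,
      fun ξ η _ _ => ⟨(h.bound s hs).inc ξ η, by simp⟩,
      fun ξ η _ _ => ⟨(h.bound s hs).rem ξ η, by simp⟩⟩,
    fun _ => h.closed s hs, fun _ _ _ => by simp⟩

/-- Rough integrals and derivatives are unique, so the unspecified `v` and `dv` of a solution are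
the canonical `vel` and `dvel`. -/
theorem IsRoughSolution.bddFlow {A : Vec → Vec →L[ℝ] Vec} {S : ℝ} {X : RoughPath γ} {T : ℝ}
    {Y : ℝ → Param → Vec} {Y' : ℝ → Param → Vec →L[ℝ] Vec} (h : IsRoughSolution A X T Y Y')
    (hS : ∀ t ∈ Icc 0 T, CtrlBound γ S X.path (Y t) (Y' t)) : BddFlow A S X T Y Y' := by
  obtain ⟨v, dv, hv, hdv, he⟩ := h.equation
  have ev : ∀ s ∈ Icc 0 T, vel A X (Y s) (Y' s) = v s := fun s hs =>
    funext fun x => (hv s hs x).vel_eq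
  have ed : ∀ s ∈ Icc 0 T, dvel A X (Y s) (Y' s) = dv s := fun s hs => funext fun x => by
    rw [dvel, ev s hs]; exact (hdv s hs x).fderiv
  refine ⟨hS, fun t ht => (h.controlled t ht).1, fun t ht ξ => ?_, fun t ht ξ => ?_⟩
  · refine Accum.congr ⟨(he t ht ξ).1, ?_⟩ ht.1 fun s hs => by
      rw [ev s ⟨hs.1, hs.2.trans ht.2⟩]
    rw [(he t ht ξ).2.1]; abel
  · refine Accum.congr ⟨(he t ht ξ).2.2.1, ?_⟩ ht.1 fun s hs => by
      rw [ed s ⟨hs.1, hs.2.trans ht.2⟩]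
    rw [(he t ht ξ).2.2.2]; abel

theorem IsControlled.exists_ctrlBound {x Y : Param → Vec} {Y' : Param → Vec →L[ℝ] Vec}
    (h : IsControlled γ x Y Y') : ∃ S, CtrlBound γ S x Y Y' := by
  have h1 : ctrlNorm γ x Y Y' < ⊤ := lt_of_le_of_lt le_self_add h.2
  refine ⟨(ctrlNorm γ x Y Y').toReal, ctrlBound_of_ctrlNorm_le ENNReal.toReal_nonneg ?_⟩
  rw [ENNReal.ofReal_toReal h1.ne]

/-- A solution is close to its value at `t` near `t`. -/
theorem IsRoughSolution.eventually_ctrlBound {A : Vec → Vec →L[ℝ] Vec} {X : RoughPath γ} {T : ℝ}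
    {Y : ℝ → Param → Vec} {Y' : ℝ → Param → Vec →L[ℝ] Vec} (h : IsRoughSolution A X T Y Y')
    {t ε : ℝ} (ht : t ∈ Icc 0 T) (hε : 0 < ε) :
    ∀ᶠ s in 𝓝[Icc 0 T] t, CtrlBound γ ε X.path (Y s - Y t) (Y' s - Y' t) := by
  filter_upwards [(h.continuous_curve t ht).eventually_lt_const
    (ENNReal.ofReal_pos.2 hε)] with s hs
  exact ctrlBound_of_ctrlNorm_le hε.le (le_self_add.trans hs.le)

/-- Continuity in time gives a bound near each time, and compactness of `[0, T]` a uniform one.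
Uniqueness is thereby available without an a priori bound. -/
theorem IsRoughSolution.exists_bound {A : Vec → Vec →L[ℝ] Vec} {X : RoughPath γ} {T : ℝ}
    {Y : ℝ → Param → Vec} {Y' : ℝ → Param → Vec →L[ℝ] Vec} (h : IsRoughSolution A X T Y Y') :
    ∃ S, ∀ t ∈ Icc 0 T, CtrlBound γ S X.path (Y t) (Y' t) := by
  refine isCompact_Icc.induction_on (p := fun s => ∃ S, ∀ t ∈ s, CtrlBound γ S X.path (Y t) (Y' t))
    ⟨0, by simp⟩ (fun s u hsu ⟨S, hS⟩ => ⟨S, fun t ht => hS t (hsu ht)⟩)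
    (fun s u ⟨S, hS⟩ ⟨S', hS'⟩ => ⟨max S S', ?_⟩) fun t ht => ?_
  · rintro t (h | h)
    · exact (hS t h).mono (le_max_left _ _)
    · exact (hS' t h).mono (le_max_right _ _)
  · obtain ⟨S, hS⟩ := (h.controlled t ht).exists_ctrlBound
    refine ⟨_, h.eventually_ctrlBound ht one_pos, 1 + S, fun s hs => ?_⟩
    have := CtrlBound.add hs hS
    rwa [sub_add_cancel, sub_add_cancel] at this

/-! ### Translations -/

/-- Translation of a rough path. -/
def RoughPath.translate (X : RoughPath γ) (c : Vec) : RoughPath γ where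
  path := fun ξ => X.path ξ + c
  area := X.area
  path_continuous := X.path_continuous.add continuous_const
  path_closed := by rw [X.path_closed]
  path_holder := by simpa [holderSeminorm] using X.path_holder
  area_continuous := X.area_continuous
  area_compat := by simpa using X.area_compat
  area_holder := X.area_holder

/-- Only `x - Y` and increments of `Y` enter. Translations are used because `roughDist` does not see
the base point of a path. -/
theorem isVelocity_translate {A : Vec → Vec →L[ℝ] Vec}
    {XX : Param → Param → Matrix (Fin 3) (Fin 3) ℝ} {Y : Param → Vec}
    {Y' : Param → Vec →L[ℝ] Vec} (c x u : Vec) :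
    IsVelocity A XX (fun ξ => Y ξ + c) Y' x u ↔ IsVelocity A XX Y Y' (x - c) u := by
  have e : ∀ η, x - (Y η + c) = x - c - Y η := fun η => by abel
  have e2 : ∀ a b, Y b + c - (Y a + c) = Y b - Y a := fun a b => by abel
  simp only [IsVelocity, HasRoughIntegral, roughTerm, e, e2]

theorem vel_translate (A : Vec → Vec →L[ℝ] Vec) (X : RoughPath γ) (Y : Param → Vec)
    (Y' : Param → Vec →L[ℝ] Vec) (c : Vec) :
    vel A (X.translate c) (fun ξ => Y ξ + c) Y' = fun x => vel A X Y Y' (x - c) := by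
  funext x
  have e : IsVelocity A (X.translate c).area (fun ξ => Y ξ + c) Y' x
      = IsVelocity A X.area Y Y' (x - c) :=
    funext fun u => propext (isVelocity_translate c x u)
  unfold vel
  rw [e]

theorem dvel_translate (A : Vec → Vec →L[ℝ] Vec) (X : RoughPath γ) (Y : Param → Vec)
    (Y' : Param → Vec →L[ℝ] Vec) (c x : Vec) :
    dvel A (X.translate c) (fun ξ => Y ξ + c) Y' x = dvel A X Y Y' (x - c) := by
  rw [dvel, vel_translate, dvel]
  exact fderiv_comp_sub c

theorem BddFlow.translate {A : Vec → Vec →L[ℝ] Vec} {S : ℝ} {X : RoughPath γ} {T : ℝ}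
    {Y : ℝ → Param → Vec} {Y' : ℝ → Param → Vec →L[ℝ] Vec} (h : BddFlow A S X T Y Y') (c : Vec) :
    BddFlow A S (X.translate c) T (fun t ξ => Y t ξ + c) Y' := by
  refine ⟨fun t ht => ⟨(h.bound t ht).der, (h.bound t ht).inc, fun ξ η => ?_⟩, fun t ht => by
    rw [h.closed t ht], fun t ht ξ => ?_, fun t ht ξ => ?_⟩
  · have := (h.bound t ht).rem ξ η
    simpa [RoughPath.translate] using this
  · have := h.path t ht ξ
    simp only [vel_translate, add_sub_cancel_right]
    convert this using 1
    simp [RoughPath.translate]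
  · have := h.der t ht ξ
    simp only [dvel_translate, add_sub_cancel_right]
    exact this

theorem translate_mem_roughBall {X : RoughPath γ} {r : ℝ} (hX : X ∈ roughBall γ r) (c : Vec) :
    X.translate c ∈ roughBall γ r := by
  have e : ∀ a b, X.path a + c - (X.path b + c) = X.path a - X.path b := fun a b => by abel
  simpa [roughBall, roughDist, RoughPath.translate, holderSeminorm, RoughPath.trivial, e] using hX

theorem roughDist_translate (X Z : RoughPath γ) (c c' : Vec) :
    roughDist (X.translate c) (Z.translate c') = roughDist X Z := by
  have e : ∀ a b, X.path a + c - (Z.path a + c') - (X.path b + c - (Z.path b + c'))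
    = X.path a - Z.path a - (X.path b - Z.path b) := fun a b => by abel
  simp only [roughDist, RoughPath.translate, holderSeminorm, e]

/-! ### Differences of solutions -/

theorem CtrlFam.congr_diff {S ε : ℝ} {x : Bool → Param → Vec} {Y : Bool → Param → Vec}
    {Y' : Bool → Param → Vec →L[ℝ] Vec} (h : CtrlFam γ S ε x Y Y') :
    (∀ ξ, ‖Y' false ξ - Y' true ξ‖ ≤ S * ε) ∧
    (∀ ξ η, ‖Y' false η - Y' false ξ - (Y' true η - Y' true ξ)‖ ≤ S * wt γ ξ η * ε) ∧
    ∀ ξ η, ‖Y false η - Y false ξ - Y' false ξ (x false η - x false ξ)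
      - (Y true η - Y true ξ - Y' true ξ (x true η - x true ξ))‖ ≤ S * wt γ ξ η ^ 2 * ε :=
  ⟨fun ξ => (h.der ξ false true).2, fun ξ η => (h.inc ξ η false true).2,
    fun ξ η => (h.rem ξ η false true).2⟩

variable {A : Vec → Vec →L[ℝ] Vec} {S T : ℝ}

theorem BddFlow.inc {X : RoughPath γ} {Y : ℝ → Param → Vec} {Y' : ℝ → Param → Vec →L[ℝ] Vec}
    (h : BddFlow A S X T Y Y') {t : ℝ} (ht : t ∈ Icc 0 T) (ξ η : Param) :
    Accum (fun s => (dvel A X (Y s) (Y' s) (Y s η)).comp (Y' s η)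
      - (dvel A X (Y s) (Y' s) (Y s ξ)).comp (Y' s ξ)) t (Y' t η - Y' t ξ) := by
  have := (h.der t ht η).sub (h.der t ht ξ)
  rwa [sub_sub_sub_cancel_right] at this

/-- The increment of `X` does not depend on time, so the remainder of the solution is the time
integral of the remainder of the velocity. At time zero it vanishes. -/
theorem BddFlow.rem {X : RoughPath γ} {Y : ℝ → Param → Vec} {Y' : ℝ → Param → Vec →L[ℝ] Vec}
    (h : BddFlow A S X T Y Y') {t : ℝ} (ht : t ∈ Icc 0 T) (ξ η : Param) :
    Accum (fun s => vel A X (Y s) (Y' s) (Y s η) - vel A X (Y s) (Y' s) (Y s ξ)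
      - (dvel A X (Y s) (Y' s) (Y s ξ)).comp (Y' s ξ) (X.path η - X.path ξ)) t
      (Y t η - Y t ξ - Y' t ξ (X.path η - X.path ξ)) := by
  have := ((h.path t ht η).sub (h.path t ht ξ)).sub ((h.der t ht ξ).clm
    (ContinuousLinearMap.apply ℝ Vec (X.path η - X.path ξ)))
  have e : Y t η - Y t ξ - Y' t ξ (X.path η - X.path ξ) = Y t η - X.path η - (Y t ξ - X.path ξ)
    - (Y' t ξ (X.path η - X.path ξ) - (X.path η - X.path ξ)) := by abel
  rw [e]
  exact this

/-- The iteration that improves a bound on the distance of two solutions. -/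
theorem BddFlow.near_step (hγ : 1 / 3 < γ) {r M δ a : ℝ} (hr : 0 ≤ r) (hrS : r ≤ S) (hS : 1 ≤ S)
    {A1 A2 A3} (hA : FieldData M A A1 A2 A3) (h2 : TwoLip M A3) {X : Bool → RoughPath γ}
    (hX : ∀ b, X b ∈ roughBall γ r) (hδ : 0 ≤ δ)
    (hd : roughDist (X false) (X true) ≤ ENNReal.ofReal δ)
    (h0 : ∀ ξ, ‖(X false).path ξ - (X true).path ξ‖ ≤ δ)
    {Y : Bool → ℝ → Param → Vec} {Y' : Bool → ℝ → Param → Vec →L[ℝ] Vec}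
    (h : ∀ b, BddFlow A S (X b) T (Y b) (Y' b)) (ha : δ ≤ a) {l : ℝ} (hl : 0 < l)
    (hlK : 2 * (evoConst γ S * M) ≤ S * l)
    (hQ : ∀ t ∈ Icc 0 T, CtrlFam γ S (a * Real.exp (l * t)) (fun b => (X b).path)
      (fun b => Y b t) (fun b => Y' b t) ∧
      ∀ ξ, ‖Y false t ξ - Y true t ξ‖ ≤ S * (a * Real.exp (l * t))) :
    ∀ t ∈ Icc 0 T, CtrlFam γ S ((δ + a / 2) * Real.exp (l * t)) (fun b => (X b).path)
      (fun b => Y b t) (fun b => Y' b t) ∧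
      ∀ ξ, ‖Y false t ξ - Y true t ξ‖ ≤ S * ((δ + a / 2) * Real.exp (l * t)) := by
  intro t ht
  have hS0 : 0 ≤ S := by linarith
  have ha0 : 0 ≤ a := hδ.trans ha
  have hM : 0 ≤ M := (norm_nonneg _).trans (hA.b1 0)
  set K := evoConst γ S * M with hK
  have hK0 : 0 ≤ K := mul_nonneg (evoConst_nonneg hγ hS0) hM
  have hexp : ∀ s ∈ Icc 0 t, 1 ≤ Real.exp (l * s) := fun s hs =>
    Real.one_le_exp (mul_nonneg hl.le hs.1)
  -- Data and curves form a loop family at distance `a * exp (l * s)` at each earlier time, because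
  -- `δ ≤ a` and the exponential is at least one.
  have hevo := fun s (hs : s ∈ Icc 0 t) => by
    have hsT : s ∈ Icc 0 T := ⟨hs.1, hs.2.trans ht.2⟩
    have hε : 0 ≤ a * Real.exp (l * s) := by positivity
    have hloop : LoopFam S (a * Real.exp (l * s)) X (fun b => Y b s) (fun b => Y' b s) := by
      refine ⟨(roughFam_pair hr hrS hS hδ hX hd).mono_eps ?_, (hQ s hsT).1,
        fun b => (h b).closed s hsT, fun i j ξ => ?_⟩
      · nlinarith [hexp s hs]
      · cases i <;> cases j
        · rw [sub_self, norm_zero]; positivity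
        · exact (hQ s hsT).2 ξ
        · rw [norm_sub_rev]; exact (hQ s hsT).2 ξ
        · rw [sub_self, norm_zero]; positivity
    exact hloop.evo hγ hε hS0 hA (Or.inr h2)
  -- the time integral of a quantity of distance `K w a exp(ls)`
  have key : ∀ {E : Type} [NormedAddCommGroup E] [NormedSpace ℝ E] {q : ℝ → E} {v : E} {w : ℝ},
      0 ≤ w → Accum q t v → (∀ s ∈ Icc 0 t, ‖q s‖ ≤ K * w * (a * Real.exp (l * s))) →
      ‖v‖ ≤ S * w * (a / 2 * Real.exp (l * t)) := by
    intro E _ _ q v w hw hq hb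
    refine (hq.norm_le (c := K * w * a) ht.1 (by positivity) hl fun s hs => ?_).trans ?_
    · rw [mul_assoc]; exact hb s hs
    · rw [← mul_assoc]
      refine mul_le_mul_of_nonneg_right ?_ (Real.exp_nonneg _)
      rw [div_le_iff₀ hl]
      nlinarith [mul_nonneg hw ha0]
  have hmono : a / 2 * Real.exp (l * t) ≤ (δ + a / 2) * Real.exp (l * t) :=
    mul_le_mul_of_nonneg_right (by linarith) (Real.exp_nonneg _)
  -- Derivative, increment and remainder start from the same values for both solutions, so only the
  -- halved `a` remains. The initial difference adds `δ` to the last bound alone, where it is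
  -- absorbed using `1 ≤ S`.
  refine ⟨ctrlFam_pair (fun b => (h b).bound t ht) (fun ξ => ?_) (fun ξ η => ?_)
    (fun ξ η => ?_), fun ξ => ?_⟩
  · have := key zero_le_one (((h false).der t ht ξ).sub ((h true).der t ht ξ)) fun s hs => by
      rw [mul_one]; exact ((hevo s hs).1.der ξ false true).2
    rw [sub_sub_sub_cancel_right, mul_one] at this
    exact this.trans (mul_le_mul_of_nonneg_left hmono hS0)
  · have := key (wt_nonneg γ ξ η) (((h false).inc ht ξ η).sub ((h true).inc ht ξ η)) fun s hs =>
      ((hevo s hs).1.inc ξ η false true).2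
    exact this.trans (mul_le_mul_of_nonneg_left hmono (mul_nonneg hS0 (wt_nonneg _ _ _)))
  · have := key (sq_nonneg (wt γ ξ η)) (((h false).rem ht ξ η).sub ((h true).rem ht ξ η))
      fun s hs => ((hevo s hs).1.rem ξ η false true).2
    exact this.trans (mul_le_mul_of_nonneg_left hmono (mul_nonneg hS0 (sq_nonneg _)))
  · have := key zero_le_one (((h false).path t ht ξ).sub ((h true).path t ht ξ)) fun s hs => by
      rw [mul_one]; exact ((hevo s hs).2 ξ false true).2
    rw [sub_sub_sub_comm, mul_one] at this
    have h3 := norm_add_le (Y false t ξ - Y true t ξ - ((X false).path ξ - (X true).path ξ))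
      ((X false).path ξ - (X true).path ξ)
    rw [sub_add_cancel] at h3
    have h4 : 1 ≤ S * Real.exp (l * t) := by
      nlinarith [hexp t ⟨ht.1, le_rfl⟩]
    nlinarith [h0 ξ, mul_le_mul_of_nonneg_left h4 hδ]

theorem le_mul_of_forall_add {x S b e : ℝ} (h : ∀ n : ℕ, x ≤ S * ((b + e / 2 ^ n))) :
    x ≤ S * b := by
  have h1 : Tendsto (fun n : ℕ => S * (b + e / 2 ^ n)) atTop (𝓝 (S * (b + 0))) := by
    refine Tendsto.const_mul _ (Tendsto.const_add _ ?_)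
    have := (tendsto_pow_atTop_nhds_zero_of_lt_one (r := (1 / 2 : ℝ)) (by norm_num)
      (by norm_num)).const_mul e
    simpa [div_eq_mul_inv] using this
  rw [add_zero] at h1
  exact ge_of_tendsto' h1 h

/-- Two solutions of neighbouring data are close. -/
theorem BddFlow.near (hγ : 1 / 3 < γ) {r M δ : ℝ} (hr : 0 ≤ r) (hrS : r ≤ S) (hS : 1 ≤ S)
    {A1 A2 A3} (hA : FieldData M A A1 A2 A3) (h2 : TwoLip M A3) {X : Bool → RoughPath γ}
    (hX : ∀ b, X b ∈ roughBall γ r) (hδ : 0 ≤ δ)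
    (hd : roughDist (X false) (X true) ≤ ENNReal.ofReal δ)
    (h0 : ∀ ξ, ‖(X false).path ξ - (X true).path ξ‖ ≤ δ)
    {Y : Bool → ℝ → Param → Vec} {Y' : Bool → ℝ → Param → Vec →L[ℝ] Vec}
    (h : ∀ b, BddFlow A S (X b) T (Y b) (Y' b)) {l : ℝ} (hl : 0 < l)
    (hlK : 2 * (evoConst γ S * M) ≤ S * l) :
    ∀ t ∈ Icc 0 T, CtrlFam γ S (2 * δ * Real.exp (l * t)) (fun b => (X b).path)
      (fun b => Y b t) (fun b => Y' b t) ∧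
      ∀ ξ, ‖Y false t ξ - Y true t ξ‖ ≤ S * (2 * δ * Real.exp (l * t)) := by
  have hS0 : 0 ≤ S := by linarith
  have hM : 0 ≤ M := (norm_nonneg _).trans (hA.b1 0)
  -- a crude bound
  have hcrude : ∀ t ∈ Icc 0 T, ∀ b ξ, ‖Y b t ξ - (X b).path ξ‖ ≤ S * Real.exp (l * t) := by
    intro t ht b ξ
    have hK0 : 0 ≤ evoConst γ S * M := mul_nonneg (evoConst_nonneg hγ hS0) hM
    refine (((h b).path t ht ξ).norm_le (c := evoConst γ S * M) ht.1 hK0 hl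
      fun s hs => ?_).trans ?_
    · have hsT : s ∈ Icc 0 T := ⟨hs.1, hs.2.trans ht.2⟩
      refine ((((h b).loopFam hr hrS (hX b) hsT).evo hγ le_rfl hS0 hA
        (Or.inl rfl)).2 ξ () ()).1.trans ?_
      exact le_mul_of_one_le_right hK0 (Real.one_le_exp (mul_nonneg hl.le hs.1))
    · refine mul_le_mul_of_nonneg_right ?_ (Real.exp_nonneg _)
      rw [div_le_iff₀ hl]
      linarith
  -- The step `a ↦ δ + a / 2` has the fixed point `2 * δ`, and the deviation from it halves each
  -- time.
  have hiter : ∀ n : ℕ, ∀ t ∈ Icc 0 T,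
      CtrlFam γ S ((2 * δ + (2 + δ) / 2 ^ n) * Real.exp (l * t)) (fun b => (X b).path)
      (fun b => Y b t) (fun b => Y' b t) ∧
      ∀ ξ, ‖Y false t ξ - Y true t ξ‖ ≤ S * ((2 * δ + (2 + δ) / 2 ^ n) * Real.exp (l * t)) := by
    intro n
    induction n with
    | zero =>
      intro t ht
      have he : 1 ≤ Real.exp (l * t) := Real.one_le_exp (mul_nonneg hl.le ht.1)
      rw [pow_zero, div_one]
      -- Two vectors of norm at most `c` differ by at most `2 * c`, so the iteration can start from
      -- the bare size bounds.
      have h2e : 2 ≤ (2 * δ + (2 + δ)) * Real.exp (l * t) := by nlinarith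
      have triv : ∀ {E : Type} [NormedAddCommGroup E] {u v : E} {c : ℝ}, ‖u‖ ≤ c → ‖v‖ ≤ c →
          ‖u - v‖ ≤ c * ((2 * δ + (2 + δ)) * Real.exp (l * t)) := fun {E} _ u v c hu hv => by
        have := norm_sub_le u v
        nlinarith [(norm_nonneg u).trans hu]
      have hb := fun b => (h b).bound t ht
      refine ⟨ctrlFam_pair hb (fun ξ => triv ((hb _).der ξ) ((hb _).der ξ))
        (fun ξ η => triv ((hb _).inc ξ η) ((hb _).inc ξ η))
        (fun ξ η => triv ((hb _).rem ξ η) ((hb _).rem ξ η)), fun ξ => ?_⟩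
      have h1 := norm_sub_le (Y false t ξ - (X false).path ξ) (Y true t ξ - (X true).path ξ)
      have h3 := norm_add_le (Y false t ξ - (X false).path ξ - (Y true t ξ - (X true).path ξ))
        ((X false).path ξ - (X true).path ξ)
      have e : Y false t ξ - (X false).path ξ - (Y true t ξ - (X true).path ξ)
        + ((X false).path ξ - (X true).path ξ) = Y false t ξ - Y true t ξ := by abel
      rw [e] at h3
      have h5 : 1 ≤ S * Real.exp (l * t) := by nlinarith
      nlinarith [h0 ξ, hcrude t ht false ξ, hcrude t ht true ξ, mul_le_mul_of_nonneg_left h5 hδ]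
    | succ n ih =>
      have h3 : 0 ≤ (2 + δ) / 2 ^ n := by positivity
      have := BddFlow.near_step hγ hr hrS hS hA h2 hX hδ hd h0 h (a := 2 * δ + (2 + δ) / 2 ^ n)
        (by linarith) hl hlK ih
      have e : δ + (2 * δ + (2 + δ) / 2 ^ n) / 2 = 2 * δ + (2 + δ) / 2 ^ (n + 1) := by
        rw [pow_succ]; field_simp; ring
      rwa [e] at this
  intro t ht
  have e : ∀ n : ℕ, (2 * δ + (2 + δ) / 2 ^ n) * Real.exp (l * t)
      = 2 * δ * Real.exp (l * t) + (2 + δ) * Real.exp (l * t) / 2 ^ n := fun n => by ring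
  have hit := fun n => hiter n t ht
  simp only [e] at hit
  exact ⟨ctrlFam_pair (fun b => (h b).bound t ht)
    (fun ξ => le_mul_of_forall_add fun n => (hit n).1.congr_diff.1 ξ)
    (fun ξ η => le_mul_of_forall_add fun n => (hit n).1.congr_diff.2.1 ξ η)
    (fun ξ η => le_mul_of_forall_add fun n => (hit n).1.congr_diff.2.2 ξ η),
    fun ξ => le_mul_of_forall_add fun n => (hit n).2 ξ⟩

/-- The rate in the stability estimate. -/
def growthRate (γ S M : ℝ) : ℝ := 2 * (evoConst γ S * M) + 1

theorem growthRate_pos (hγ : 1 / 3 < γ) {M : ℝ} (hS : 0 ≤ S) (hM : 0 ≤ M) :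
    0 < growthRate γ S M := by
  have := mul_nonneg (evoConst_nonneg hγ hS) hM
  unfold growthRate
  linarith

theorem two_mul_le_growthRate (hγ : 1 / 3 < γ) {M : ℝ} (hS : 1 ≤ S) (hM : 0 ≤ M) :
    2 * (evoConst γ S * M) ≤ S * growthRate γ S M := by
  have := growthRate_pos hγ (zero_le_one.trans hS) hM
  unfold growthRate at *
  nlinarith

/-- Stability of solutions as controlled paths. -/
theorem BddFlow.ctrlFam (hγ : 1 / 3 < γ) {r M δ : ℝ} (hr : 0 ≤ r) (hrS : r ≤ S) (hS : 1 ≤ S)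
    {A1 A2 A3} (hA : FieldData M A A1 A2 A3) (h2 : TwoLip M A3) {X : Bool → RoughPath γ}
    (hX : ∀ b, X b ∈ roughBall γ r) (hδ : 0 ≤ δ)
    (hd : roughDist (X false) (X true) ≤ ENNReal.ofReal δ)
    {Y : Bool → ℝ → Param → Vec} {Y' : Bool → ℝ → Param → Vec →L[ℝ] Vec}
    (h : ∀ b, BddFlow A S (X b) T (Y b) (Y' b)) {t : ℝ} (ht : t ∈ Icc 0 T) :
    CtrlFam γ S (2 * δ * Real.exp (growthRate γ S M * T)) (fun b => (X b).path)
      (fun b => Y b t) (fun b => Y' b t) := by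
  have hM : 0 ≤ M := (norm_nonneg _).trans (hA.b1 0)
  have hl := growthRate_pos hγ (zero_le_one.trans hS) hM
  have hγ0 : 0 ≤ γ := by linarith
  -- Both paths are moved to start at the origin. Then the uniform distance of the data is at most
  -- `δ`, while the quantities in `CtrlFam` are unchanged.
  have h1 := (BddFlow.near hγ hr hrS hS hA h2
    (X := fun b => (X b).translate (-(X b).path 0))
    (fun b => translate_mem_roughBall (hX b) _) hδ (by rw [roughDist_translate]; exact hd)
    (fun ξ => by
      have := (roughDist_bounds hδ hd 0 ξ).1
      refine (le_of_eq ?_).trans (this.trans (mul_le_of_le_one_right hδ (wt_le_one hγ0 _ _)))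
      simp only [RoughPath.translate]
      congr 1)
    (fun b => (h b).translate (-(X b).path 0)) hl (two_mul_le_growthRate hγ hS hM) t ht).1
  have h3 : CtrlFam γ S (2 * δ * Real.exp (growthRate γ S M * t)) (fun b => (X b).path)
      (fun b => Y b t) (fun b => Y' b t) := by
    refine ⟨h1.der, h1.inc, fun ξ η => ?_⟩
    have := h1.rem ξ η
    simpa [RoughPath.translate] using this
  refine h3.mono_eps (mul_le_mul_of_nonneg_left (Real.exp_le_exp.2
    (mul_le_mul_of_nonneg_left ht.2 hl.le)) (by positivity))

/-- Solutions are unique. -/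
theorem IsRoughSolution.unique (hγ : 1 / 3 < γ) {r M : ℝ} (hr : 0 ≤ r)
    {A1 A2 A3} (hA : FieldData M A A1 A2 A3) (h2 : TwoLip M A3) {X : RoughPath γ}
    (hX : X ∈ roughBall γ r) {Y Z : ℝ → Param → Vec} {Y' Z' : ℝ → Param → Vec →L[ℝ] Vec}
    (hY : IsRoughSolution A X T Y Y') (hZ : IsRoughSolution A X T Z Z') :
    ∀ t ∈ Icc 0 T, Y t = Z t ∧ Y' t = Z' t := by
  intro t ht
  have hM : 0 ≤ M := (norm_nonneg _).trans (hA.b1 0)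
  obtain ⟨S₁, h1⟩ := hY.exists_bound
  obtain ⟨S₂, h2'⟩ := hZ.exists_bound
  set S := max (max S₁ S₂) (max r 1)
  have hS : 1 ≤ S := (le_max_right _ _).trans (le_max_right _ _)
  have b1 := hY.bddFlow fun t ht => (h1 t ht).mono
    (show S₁ ≤ S from (le_max_left _ _).trans (le_max_left _ _))
  have b2 := hZ.bddFlow fun t ht => (h2' t ht).mono
    (show S₂ ≤ S from (le_max_right _ _).trans (le_max_left _ _))
  -- Stability with `δ = 0`: both solutions start from the same data.
  have := BddFlow.near hγ hr (show r ≤ S from (le_max_left _ _).trans (le_max_right _ _)) hS hA h2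
    (X := fun _ => X) (fun _ => hX) le_rfl (by simp [roughDist, holderSeminorm, holderSup, matNorm])
    (by simp) (Y := fun b => bif b then Z else Y) (Y' := fun b => bif b then Z' else Y')
    (fun b => by cases b; exacts [b1, b2]) (growthRate_pos hγ (zero_le_one.trans hS) hM)
    (two_mul_le_growthRate hγ hS hM) t ht
  refine ⟨funext fun ξ => ?_, funext fun ξ => ?_⟩
  · have := this.2 ξ
    simpa [sub_eq_zero] using this
  · have := this.1.congr_diff.1 ξ
    simpa [sub_eq_zero] using this

end Flow

/-! ### Lifts of controlled paths -/

section Lift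

variable {ι : Type*} {γ : ℝ} {E G : Type*} [NormedAddCommGroup E] [NormedSpace ℝ E]
  [NormedAddCommGroup G] [NormedSpace ℝ G]

theorem CtrlFam.map_unit {S ε : ℝ} {x : ι → Param → Vec} {Y : ι → Param → E}
    {Y' : ι → Param → Vec →L[ℝ] E} (h : CtrlFam γ S ε x Y Y') (L : E →L[ℝ] G) (hL : ‖L‖ ≤ 1) :
    CtrlFam γ S ε x (fun i ξ => L (Y i ξ)) (fun i ξ => L.comp (Y' i ξ)) := by
  have hC : ‖ContinuousLinearMap.compL ℝ Vec E G L‖ ≤ 1 :=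
    ContinuousLinearMap.opNorm_le_bound _ zero_le_one fun K => by
      rw [one_mul]
      exact (L.opNorm_comp_le K).trans (mul_le_of_le_one_left (norm_nonneg _) hL)
  refine ⟨fun ξ => (h.der ξ).map_unit _ hC, fun ξ η => ?_, fun ξ η => ?_⟩
  · have := (h.inc ξ η).map_unit _ hC
    simp only [map_sub] at this
    exact this
  · have := (h.rem ξ η).map_unit _ hL
    simp only [map_sub] at this
    simpa using this

/-- The bilinear form `(u, v) ↦ u_a v_b`. -/
def coordForm (a b : Fin 3) : Vec →L[ℝ] Vec →L[ℝ] ℝ :=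
  (EuclideanSpace.proj a : Vec →L[ℝ] ℝ).smulRight (EuclideanSpace.proj b : Vec →L[ℝ] ℝ)

theorem coordForm_apply (a b : Fin 3) (u v : Vec) : coordForm a b u v = u a * v b := rfl

theorem norm_proj_le (a : Fin 3) : ‖(EuclideanSpace.proj a : Vec →L[ℝ] ℝ)‖ ≤ 1 :=
  ContinuousLinearMap.opNorm_le_bound _ zero_le_one fun v => by
    rw [one_mul]; exact PiLp.norm_apply_le v a

theorem norm_coordForm_le (a b : Fin 3) : ‖coordForm a b‖ ≤ 1 := by
  rw [coordForm, ContinuousLinearMap.norm_smulRight_apply]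
  exact mul_le_one₀ (norm_proj_le a) (norm_nonneg _) (norm_proj_le b)

theorem continuous_of_wt {f : Param → E} (hγ : 0 < γ) (C : Param → ℝ)
    (h : ∀ p q, ‖f q - f p‖ ≤ C p * wt γ p q) : Continuous f := by
  refine continuous_iff_continuousAt.2 fun p => tendsto_iff_norm_sub_tendsto_zero.2 ?_
  have h1 : Tendsto (fun q => C p * wt γ p q) (𝓝 p) (𝓝 (C p * wt γ p p)) := by
    refine Tendsto.const_mul _ (Continuous.tendsto ?_ p)
    exact (continuous_const.dist continuous_id).rpow_const fun _ => Or.inr hγ.le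
  rw [wt, dist_self, Real.zero_rpow hγ.ne', mul_zero] at h1
  exact squeeze_zero (fun _ => norm_nonneg _) (h p) h1

theorem CtrlBound.norm_increment_le {S : ℝ} (hγ : 0 ≤ γ) {X : RoughPath γ} {Y : Param → Vec}
    {Y' : Param → Vec →L[ℝ] Vec} (hX : ∀ ξ η, ‖X.path η - X.path ξ‖ ≤ S * wt γ ξ η)
    (h : CtrlBound γ S X.path Y Y') (ξ η : Param) :
    ‖Y η - Y ξ‖ ≤ (2 * S + 1) * S * wt γ ξ η := by
  have h1 := (Y' ξ).le_of_opNorm_le_of_le (h.der ξ) (hX ξ η)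
  have h2 := norm_add_le (Y η - Y ξ - Y' ξ (X.path η - X.path ξ)) (Y' ξ (X.path η - X.path ξ))
  rw [sub_add_cancel] at h2
  have hw := wt_nonneg γ ξ η
  have hw1 := wt_le_one hγ ξ η
  have hS := h.nonneg
  nlinarith [h.rem ξ η, mul_nonneg hS (mul_nonneg hw (sub_nonneg.2 hw1)),
    mul_nonneg (mul_nonneg hS hS) hw]

/-- The constant in the bounds of lifts. -/
def liftConst (γ S : ℝ) : ℝ := integralConst γ S * S + 36 * S ^ 3 + (2 * S + 1) * S

theorem liftConst_nonneg {S : ℝ} (hγ : 1 / 3 < γ) (hS : 0 ≤ S) : 0 ≤ liftConst γ S := by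
  have := integralConst_nonneg hγ hS
  unfold liftConst
  positivity

/-- The area of the lift in terms of the primitives `φ a b` of `Y_a dY_b`. -/
def liftArea (Y : Param → Vec) (φ : Fin 3 → Fin 3 → Param → ℝ) (ρ ξ : Param) :
    Matrix (Fin 3) (Fin 3) ℝ := fun a b => φ a b ξ - φ a b ρ - Y ρ a * (Y ξ b - Y ρ b)

/-- The first term of the germ of `∫ Y_a dY_b` is exactly `Y_ρ a * (Y_ξ b - Y_ρ b)`. Subtracting it
leaves the sewing error, of order three in the weight, and the area term, of order two. -/
theorem near_liftArea (hγ : 1 / 3 < γ) {S ε : ℝ} (hε : 0 ≤ ε) (hS : 0 ≤ S)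
    {X : ι → RoughPath γ} (hX : RoughFam S ε X) {Y : ι → Param → Vec}
    {Y' : ι → Param → Vec →L[ℝ] Vec} (h : CtrlFam γ S ε (fun i => (X i).path) Y Y')
    {φ : ι → Param → ℝ} {a b : Fin 3} (ρ ξ : Param)
    (hφ : Near (integralConst γ S * S * wt γ ρ ξ ^ 3) ε fun i => φ i ξ - φ i ρ -
      roughTerm (X i).area (fun η => coordForm a b (Y i η)) (fun η => (coordForm a b).comp (Y' i η))
        (Y i) (Y' i) ρ ξ) :
    Near (liftConst γ S * wt γ ρ ξ ^ 2) ε fun i =>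
      φ i ξ - φ i ρ - Y i ρ a * (Y i ξ b - Y i ρ b) := by
  have hw := wt_nonneg γ ρ ξ
  have hw1 := wt_le_one (by linarith : 0 ≤ γ) ρ ξ
  have hI := integralConst_nonneg hγ hS
  have hsum := Near.sum_three fun k => Near.sum_three fun l => (hX.area ρ ξ k l).smul
    (((((h.der ρ).apply_unit (norm_stdVec k).le).map_unit (coordForm a b)
      (norm_coordForm_le a b))).clm_apply ((h.der ρ).apply_unit (norm_stdVec l).le))
  have := (hφ.add hsum).mono (S' := liftConst γ S * wt γ ρ ξ ^ 2) hε ?_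
  · convert this using 2 with i
    simp only [roughTerm, coordForm_apply, PiLp.sub_apply, ContinuousLinearMap.comp_apply]
    ring
  · have h3 : wt γ ρ ξ ^ 3 ≤ wt γ ρ ξ ^ 2 := pow_le_pow_of_le_one hw hw1 (by norm_num)
    have h4 := mul_le_mul_of_nonneg_left h3 (mul_nonneg hI hS)
    unfold liftConst
    have h5 : 0 ≤ (2 * S + 1) * S * wt γ ρ ξ ^ 2 := by positivity
    nlinarith

/-- Controlled loops have lifts, which depend continuously on the data. -/
theorem exists_lift (hγ : 1 / 3 < γ) {S ε : ℝ} (hε : 0 ≤ ε) (hS : 0 ≤ S)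
    {X : ι → RoughPath γ} (hX : RoughFam S ε X) {Y : ι → Param → Vec}
    {Y' : ι → Param → Vec →L[ℝ] Vec} (h : CtrlFam γ S ε (fun i => (X i).path) Y Y')
    (hc : ∀ i, Y i 0 = Y i 1) :
    ∃ Z : ι → RoughPath γ, (∀ i, IsLift (X i) (Y i) (Y' i) (Z i)) ∧
      ∀ ρ ξ a b, Near (liftConst γ S * wt γ ρ ξ ^ 2) ε fun i => (Z i).area ρ ξ a b := by
  have hγ0 : 0 < γ := by linarith
  have hC := liftConst_nonneg hγ hS
  have hex := fun a b => exists_roughIntegral hγ hε hS hS hX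
    (h.map_unit (coordForm a b) (norm_coordForm_le a b)) h
  choose φ hφ hφ' using hex
  have hnear : ∀ a b ρ ξ, Near (liftConst γ S * wt γ ρ ξ ^ 2) ε fun i =>
      liftArea (Y i) (fun a b => φ a b i) ρ ξ a b := fun a b ρ ξ =>
    near_liftArea hγ hε hS hX h ρ ξ (hφ' a b ρ ξ)
  have hinc : ∀ i ξ η, ‖Y i η - Y i ξ‖ ≤ (2 * S + 1) * S * wt γ ξ η := fun i =>
    (h.ctrlBound i).norm_increment_le hγ0.le fun ξ η => (hX.path ξ η i i).1
  have hYc : ∀ i, Continuous (Y i) := fun i => continuous_of_wt hγ0 _ (hinc i)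
  -- The Hölder constant may depend on the base point `p` through `|Y i p a|`; continuity needs no
  -- more.
  have hφc : ∀ i a b, Continuous (φ a b i) := fun i a b => by
    refine continuous_of_wt hγ0
      (fun p => liftConst γ S + |Y i p a| * ((2 * S + 1) * S)) fun p q => ?_
    have h1 := (hnear a b p q i i).1
    have h2 : |Y i q b - Y i p b| ≤ (2 * S + 1) * S * wt γ p q :=
      (PiLp.norm_apply_le (Y i q - Y i p) b).trans (hinc i p q)
    have hw := wt_nonneg γ p q
    have hw1 := wt_le_one hγ0.le p q
    have e : φ a b i q - φ a b i p = liftArea (Y i) (fun a b => φ a b i) p q a b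
      + Y i p a * (Y i q b - Y i p b) := by simp only [liftArea]; ring
    rw [e]
    refine (norm_add_le _ _).trans ?_
    rw [norm_mul, Real.norm_eq_abs (Y i p a), Real.norm_eq_abs (Y i q b - Y i p b)]
    nlinarith [mul_le_mul_of_nonneg_left h2 (abs_nonneg (Y i p a)),
      mul_nonneg hC (mul_nonneg hw (sub_nonneg.2 hw1))]
  refine ⟨fun i => ⟨Y i, liftArea (Y i) fun a b => φ a b i, hYc i, hc i, ?_, ?_, ?_, ?_⟩,
    fun i => ⟨rfl, fun ρ ξ a b => ?_⟩, fun ρ ξ a b => hnear a b ρ ξ⟩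
  · refine (holderSup_le (C := (2 * S + 1) * S) (by positivity) fun ξ η => ?_).trans_lt
      ENNReal.ofReal_lt_top
    rw [norm_sub_rev]
    exact hinc i ξ η
  · have hcoord : ∀ b, Continuous fun ξ => Y i ξ b := fun b =>
      (EuclideanSpace.proj b : Vec →L[ℝ] ℝ).continuous.comp (hYc i)
    refine continuous_matrix fun a b => ?_
    simp only [liftArea]
    have := hφc i a b
    have := hcoord a
    have := hcoord b
    fun_prop
  · intro ξ η ρ a b
    simp only [liftArea]
    ring
  · refine (holderSup_le (C := 9 * liftConst γ S) (by positivity) fun ξ η => ?_).trans_lt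
      ENNReal.ofReal_lt_top
    rw [wt_sq, mul_assoc]
    exact matNorm_le fun k l => (hnear k l ξ η i i).1
  -- One primitive of `Y_a dY_b` serves all base points `ρ`: passing to the integrand `Y_a - Y_ρ a`
  -- subtracts an exactly additive germ.
  · have h1 : HasSewing (fun p q => Y i ρ a * (Y i q b - Y i p b)) ρ ξ
        (Y i ρ a * Y i ξ b - Y i ρ a * Y i ρ b) :=
      hasSewing_of_additive (φ := fun q => Y i ρ a * Y i q b) (C := 0) (θ := 2) (by norm_num)
        (fun p q => by rw [mul_sub, sub_self, norm_zero, zero_mul]) ρ ξ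
    have h2 := HasSewing.sub (hφ a b i ρ ξ) h1
    have e : liftArea (Y i) (fun a b => φ a b i) ρ ξ a b
        = φ a b i ξ - φ a b i ρ - (Y i ρ a * Y i ξ b - Y i ρ a * Y i ρ b) := by
      simp only [liftArea]; ring
    change HasSewing _ ρ ξ (liftArea (Y i) (fun a b => φ a b i) ρ ξ a b)
    rw [e]
    convert h2 using 1
    funext p q
    simp only [roughTerm, coordForm_apply, PiLp.sub_apply, ContinuousLinearMap.comp_apply,
      ContinuousLinearMap.smulRight_apply, smul_apply, smul_eq_mul, EuclideanSpace.coe_proj]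
    ring

theorem IsLift.unique {X : RoughPath γ} {Y : Param → Vec} {Y' : Param → Vec →L[ℝ] Vec}
    {Z W : RoughPath γ} (hZ : IsLift X Y Y' Z) (hW : IsLift X Y Y' W) : Z = W := by
  refine RoughPath.ext (hZ.1.trans hW.1.symm) ?_
  funext ρ ξ
  ext i j
  exact HasSewing.unique (hZ.2 ρ ξ i j) (hW.2 ρ ξ i j)

/-- Uniqueness of lifts identifies `Z` with the lifts built in `exists_lift`, which carry the
estimates. -/
theorem IsLift.roughDist_le (hγ : 1 / 3 < γ) {S ε : ℝ} (hε : 0 ≤ ε) (hS : 0 ≤ S)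
    {X : Bool → RoughPath γ} (hX : RoughFam S ε X) {Y : Bool → Param → Vec}
    {Y' : Bool → Param → Vec →L[ℝ] Vec} (h : CtrlFam γ S ε (fun i => (X i).path) Y Y')
    (hc : ∀ i, Y i 0 = Y i 1) {Z : Bool → RoughPath γ}
    (hZ : ∀ i, IsLift (X i) (Y i) (Y' i) (Z i)) :
    roughDist (Z false) (Z true) ≤ ENNReal.ofReal (10 * (liftConst γ S * ε)) := by
  obtain ⟨W, hW, hn⟩ := exists_lift hγ hε hS hX h hc
  have hWZ : W = Z := funext fun i => (hW i).unique (hZ i)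
  subst hWZ
  have hI := integralConst_nonneg hγ hS
  refine VortexFilament.roughDist_le (mul_nonneg (liftConst_nonneg hγ hS) hε) (fun ξ η => ?_)
    fun ξ η k l => ?_
  · rw [(hW false).1, (hW true).1]
    refine (h.increment (by linarith) hε hS hX ξ η false true).2.trans ?_
    rw [mul_right_comm]
    refine mul_le_mul_of_nonneg_right (mul_le_mul_of_nonneg_right ?_ hε) (wt_nonneg _ _ _)
    unfold liftConst
    have : 0 ≤ integralConst γ S * S + 36 * S ^ 3 := by positivity
    linarith
  · refine (hn ξ η k l false true).2.trans (le_of_eq ?_)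
    ring

end Lift

/-! ### The solution map -/

section SolutionMap

variable {γ : ℝ} {A : Vec → Vec →L[ℝ] Vec} {T : ℝ}

theorem IsRoughSolution.exists_isLift (hγ : 1 / 3 < γ) {r : ℝ} (hr : 0 ≤ r) {X : RoughPath γ}
    (hX : X ∈ roughBall γ r) {Y : ℝ → Param → Vec} {Y' : ℝ → Param → Vec →L[ℝ] Vec}
    (h : IsRoughSolution A X T Y Y') {t : ℝ} (ht : t ∈ Icc 0 T) :
    ∃ Z, IsLift X (Y t) (Y' t) Z := by
  obtain ⟨S, hS⟩ := (h.controlled t ht).exists_ctrlBound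
  have hb := hS.mono (le_max_left S r)
  obtain ⟨Z, hZ, -⟩ := exists_lift hγ le_rfl (hS.nonneg.trans (le_max_left S r))
    (roughFam_const (ι := Unit) hr (le_max_right S r) le_rfl hX)
    (Y := fun _ => Y t) (Y' := fun _ => Y' t)
    ⟨fun ξ _ _ => ⟨hb.der ξ, by simp⟩, fun ξ η _ _ => ⟨hb.inc ξ η, by simp⟩,
      fun ξ η _ _ => ⟨hb.rem ξ η, by simp⟩⟩ fun _ => (h.controlled t ht).1
  exact ⟨Z (), hZ ()⟩

/-- The map sending the data to the lifted solution. -/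
theorem exists_solutionMap (hγ : 1 / 3 < γ) {r : ℝ} (hr : 0 ≤ r) {B : ℝ≥0}
    (h : IsExistenceTime γ r A T B) :
    ∃ Γ : RoughPath γ → ℝ → RoughPath γ, ∀ X ∈ roughBall γ r,
      ∃ (Y : ℝ → Param → Vec) (Y' : ℝ → Param → Vec →L[ℝ] Vec), IsRoughSolution A X T Y Y' ∧
        (∀ t ∈ Icc 0 T, CtrlBound γ B X.path (Y t) (Y' t)) ∧
        ∀ t ∈ Icc 0 T, IsLift X (Y t) (Y' t) (Γ X t) := by
  have hex : ∀ X : RoughPath γ, ∃ W : ℝ → RoughPath γ, X ∈ roughBall γ r →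
      ∃ (Y : ℝ → Param → Vec) (Y' : ℝ → Param → Vec →L[ℝ] Vec), IsRoughSolution A X T Y Y' ∧
        (∀ t ∈ Icc 0 T, CtrlBound γ B X.path (Y t) (Y' t)) ∧
        ∀ t ∈ Icc 0 T, IsLift X (Y t) (Y' t) (W t) := by
    intro X
    by_cases hX : X ∈ roughBall γ r
    · obtain ⟨Y, Y', hY, hB⟩ := h X hX
      have hl : ∀ t, ∃ Z, t ∈ Icc 0 T → IsLift X (Y t) (Y' t) Z := fun t => by
        by_cases ht : t ∈ Icc 0 T
        · obtain ⟨Z, hZ⟩ := hY.exists_isLift hγ hr hX ht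
          exact ⟨Z, fun _ => hZ⟩
        · exact ⟨X, fun h => (ht h).elim⟩
      choose W hW using hl
      refine ⟨W, fun _ => ⟨Y, Y', hY, fun t ht => ctrlBound_of_ctrlNorm_le B.2 ?_, hW⟩⟩
      have := hB t ht
      rwa [← ENNReal.ofReal_coe_nnreal] at this
    · exact ⟨fun _ => X, fun h => (hX h).elim⟩
  choose Γ hΓ using hex
  exact ⟨Γ, hΓ⟩

/-- The Lipschitz estimate for lifts, applied to the values of one solution at two times over the
same `X`. -/
theorem IsLift.isContinuousCurve (hγ : 1 / 3 < γ) {r : ℝ} (hr : 0 ≤ r) {X : RoughPath γ}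
    (hX : X ∈ roughBall γ r) {Y : ℝ → Param → Vec} {Y' : ℝ → Param → Vec →L[ℝ] Vec}
    (h : IsRoughSolution A X T Y Y') {Z : ℝ → RoughPath γ}
    (hZ : ∀ t ∈ Icc 0 T, IsLift X (Y t) (Y' t) (Z t)) : IsContinuousCurve T Z := by
  intro t ht
  obtain ⟨S₀, hS₀⟩ := h.exists_bound
  set S := max S₀ (max r 1)
  have hS1 : 1 ≤ S := (le_max_right _ _).trans (le_max_right _ _)
  have hS : 0 < S := by linarith
  have hC := liftConst_nonneg hγ hS.le
  refine ENNReal.tendsto_nhds_zero.2 fun e he => ?_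
  obtain ⟨e', he'0, he'⟩ : ∃ e' : ℝ, 0 < e' ∧ ENNReal.ofReal e' ≤ e := by
    rcases eq_or_ne e ⊤ with rfl | htop
    · exact ⟨1, one_pos, le_top⟩
    · exact ⟨e.toReal, ENNReal.toReal_pos he.ne' htop, (ENNReal.ofReal_toReal htop).le⟩
  set ε := e' / (10 * (liftConst γ S + 1)) with hε
  have hε0 : 0 < ε := by positivity
  filter_upwards [h.eventually_ctrlBound ht (mul_pos hS hε0), self_mem_nhdsWithin] with s hs hsT
  refine (IsLift.roughDist_le hγ hε0.le hS.le (X := fun _ => X)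
    (roughFam_const hr ((le_max_left _ _).trans (le_max_right _ _)) hε0.le hX)
    (Y := fun b => bif b then Y t else Y s) (Y' := fun b => bif b then Y' t else Y' s)
    (ctrlFam_pair_same (fun b => ?_) hs) (fun b => ?_) (Z := fun b => bif b then Z t else Z s)
    fun b => ?_).trans ?_
  · cases b
    · exact (hS₀ s hsT).mono (le_max_left _ _)
    · exact (hS₀ t ht).mono (le_max_left _ _)
  · cases b
    · exact (h.controlled s hsT).1
    · exact (h.controlled t ht).1
  · cases b
    · exact hZ s hsT
    · exact hZ t ht
  · refine (ENNReal.ofReal_le_ofReal ?_).trans he'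
    rw [hε, mul_div_assoc', mul_div_assoc', div_le_iff₀ (by positivity)]
    nlinarith

/-- The Lipschitz constant of the solution map. -/
def stabConst (γ S M T : ℝ) : ℝ :=
  10 * (liftConst γ S * (2 * Real.exp (growthRate γ S M * T)))

/-- Stability of controlled paths followed by stability of lifts, with `δ` the actual distance of
the data, which is finite. -/
theorem BddFlow.uniformDist_le (hγ : 1 / 3 < γ) {r M S : ℝ} (hr : 0 ≤ r) (hrS : r ≤ S)
    (hS : 1 ≤ S) (hT : 0 ≤ T) {A1 A2 A3} (hA : FieldData M A A1 A2 A3) (h2 : TwoLip M A3)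
    {X : Bool → RoughPath γ} (hX : ∀ b, X b ∈ roughBall γ r)
    {Y : Bool → ℝ → Param → Vec} {Y' : Bool → ℝ → Param → Vec →L[ℝ] Vec}
    (h : ∀ b, BddFlow A S (X b) T (Y b) (Y' b)) {Z : Bool → ℝ → RoughPath γ}
    (hZ : ∀ b, ∀ t ∈ Icc 0 T, IsLift (X b) (Y b t) (Y' b t) (Z b t)) :
    uniformDist T (Z false) (Z true)
      ≤ (stabConst γ S M T).toNNReal * roughDist (X false) (X true) := by
  have hS0 : 0 ≤ S := by linarith
  have hM : 0 ≤ M := (norm_nonneg _).trans (hA.b1 0)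
  have hC := liftConst_nonneg hγ hS0
  set δ := (roughDist (X false) (X true)).toReal with hδ
  have hδ0 : 0 ≤ δ := ENNReal.toReal_nonneg
  have e : roughDist (X false) (X true) = ENNReal.ofReal δ :=
    (ENNReal.ofReal_toReal (roughDist_lt_top _ _).ne).symm
  have h1 : 1 ≤ Real.exp (growthRate γ S M * T) :=
    Real.one_le_exp (mul_nonneg (growthRate_pos hγ hS0 hM).le hT)
  refine iSup₂_le fun t ht => ?_
  refine (IsLift.roughDist_le hγ (by positivity) hS0
    ((roughFam_pair hr hrS hS hδ0 hX e.le).mono_eps ?_)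
    (BddFlow.ctrlFam hγ hr hrS hS hA h2 hX hδ0 e.le h ht) (fun b => (h b).closed t ht)
    (Z := fun b => Z b t) fun b => hZ b t ht).trans ?_
  · nlinarith
  · rw [e, ← ENNReal.ofReal, ← ENNReal.ofReal_mul (by unfold stabConst; positivity)]
    refine ENNReal.ofReal_le_ofReal (le_of_eq ?_)
    unfold stabConst
    ring

end SolutionMap

/-! ### Differentiable curves -/

section Curves

variable {F : Type*} [NormedAddCommGroup F] [NormedSpace ℝ F]

theorem endExtend_coe (f : Param → F) (ξ : Param) : endExtend f ξ = f ξ :=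
  IccExtend_val zero_le_one f ξ

theorem endExtend_apply (f : Param → F) (η : ℝ) :
    endExtend f η = f (projIcc 0 1 zero_le_one η) := rfl

theorem continuous_endExtend {f : Param → F} (hf : Continuous f) : Continuous (endExtend f) :=
  hf.Icc_extend'

theorem dist_projIcc_le (a : Param) (η : ℝ) : dist a (projIcc 0 1 zero_le_one η) ≤ |η - a| := by
  have := (LipschitzWith.projIcc (zero_le_one' ℝ)).dist_le_mul (a : ℝ) η
  rw [projIcc_val, NNReal.coe_one, one_mul, dist_comm (a : ℝ), Real.dist_eq] at this
  exact this

theorem dist_param (a b : Param) : dist a b = |(b : ℝ) - a| := by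
  rw [Subtype.dist_eq, Real.dist_eq, abs_sub_comm]

theorem uIcc_param_subset (a b : Param) : uIcc (a : ℝ) b ⊆ Icc 0 1 :=
  uIcc_subset_Icc a.2 b.2

theorem integral_of_hasDerivWithinAt [CompleteSpace F] {f f' : ℝ → F}
    (h : ∀ x ∈ Icc (0 : ℝ) 1, HasDerivWithinAt f (f' x) (Icc 0 1) x) (hc : Continuous f')
    (a b : Param) : ∫ x in (a : ℝ)..b, f' x = f b - f a := by
  refine intervalIntegral.integral_eq_sub_of_hasDeriv_right
    (fun x hx => (h x (uIcc_param_subset a b hx)).continuousWithinAt.mono (uIcc_param_subset a b))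
    (fun x hx => ?_) (hc.intervalIntegrable _ _)
  have hx0 : 0 < x := (le_min a.2.1 b.2.1).trans_lt hx.1
  have hx1 : x < 1 := hx.2.trans_le (max_le a.2.2 b.2.2)
  exact (h x ⟨hx0.le, hx1.le⟩).mono_of_mem_nhdsWithin
    (mem_nhdsWithin_of_mem_nhds (Icc_mem_nhds hx0 hx1))

theorem IsDerivOf.hasDerivWithinAt {f df : Param → Vec} (h : IsDerivOf f df) :
    ∀ x ∈ Icc (0 : ℝ) 1, HasDerivWithinAt (endExtend f) (endExtend df x) (Icc 0 1) x := by
  intro x hx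
  have := h ⟨x, hx⟩
  rwa [← endExtend_coe df] at this

theorem IsDerivOf.integral {f df : Param → Vec} (h : IsDerivOf f df) (hc : Continuous df)
    (a b : Param) : ∫ x in (a : ℝ)..b, endExtend df x = f b - f a := by
  rw [integral_of_hasDerivWithinAt h.hasDerivWithinAt (continuous_endExtend hc), endExtend_coe,
    endExtend_coe]

theorem exists_norm_le_of_continuous {f : Param → F} (hf : Continuous f) :
    ∃ C, 0 ≤ C ∧ ∀ ξ, ‖f ξ‖ ≤ C := by
  obtain ⟨C, hC⟩ := (isCompact_range hf).isBounded.exists_norm_le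
  exact ⟨C, (norm_nonneg _).trans (hC _ (mem_range_self 0)), fun ξ => hC _ (mem_range_self ξ)⟩

theorem IsDerivOf.norm_sub_le {f df : Param → Vec} (h : IsDerivOf f df) {L : ℝ}
    (hL : ∀ ξ, ‖df ξ‖ ≤ L) (a b : Param) : ‖f b - f a‖ ≤ L * dist a b := by
  have := (convex_Icc (0 : ℝ) 1).norm_image_sub_le_of_norm_hasDerivWithin_le
    h.hasDerivWithinAt (fun x _ => hL _) a.2 b.2
  rwa [endExtend_coe, endExtend_coe, Real.norm_eq_abs, ← dist_param] at this

theorem IsDerivOf.unique {f df df' : Param → Vec} (h : IsDerivOf f df) (h' : IsDerivOf f df') :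
    df = df' :=
  funext fun ξ => (uniqueDiffOn_Icc zero_lt_one ξ ξ.2).eq_deriv _ (h ξ) (h' ξ)

theorem norm_integral_le_sq {g : ℝ → F} {C : ℝ} (hC : 0 ≤ C) {a b : ℝ}
    (h : ∀ η, ‖g η‖ ≤ C * |η - a|) : ‖∫ η in a..b, g η‖ ≤ C * |b - a| ^ 2 := by
  refine (intervalIntegral.norm_integral_le_of_norm_le_const (C := C * |b - a|)
    fun η hη => (h η).trans (mul_le_mul_of_nonneg_left ?_ hC)).trans (le_of_eq (by ring))
  exact abs_sub_left_of_mem_uIcc (uIoc_subset_uIcc hη)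

/-- For continuously differentiable data the rough integral is the classical one. -/
theorem hasRoughIntegral_of_isDerivOf [CompleteSpace F]
    {XX : Param → Param → Matrix (Fin 3) (Fin 3) ℝ} {C : ℝ} (hC : 0 ≤ C)
    (hXX : ∀ a b k l, |XX a b k l| ≤ C * dist a b ^ 2) {f : Param → Vec →L[ℝ] F}
    (hfc : ∀ a b, ‖f b - f a‖ ≤ C * dist a b) {f' : Param → Vec →L[ℝ] Vec →L[ℝ] F}
    (hf' : ∀ a, ‖f' a‖ ≤ C) {Y dY : Param → Vec} (hY : IsDerivOf Y dY) (hdY : Continuous dY)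
    (hdYC : ∀ a, ‖dY a‖ ≤ C) {Y' : Param → Vec →L[ℝ] Vec} (hY' : ∀ a, ‖Y' a‖ ≤ C) (a b : Param) :
    HasRoughIntegral XX f f' Y Y' a b (∫ η in (a : ℝ)..b, endExtend f η (endExtend dY η)) := by
  have hfcont : Continuous f :=
    (LipschitzWith.of_dist_le_mul (K := C.toNNReal) fun a b => by
      rw [dist_eq_norm, Real.coe_toNNReal _ hC, dist_comm]; exact hfc b a).continuous
  have hcont : Continuous fun η => endExtend f η (endExtend dY η) :=
    (continuous_endExtend hfcont).clm_apply (continuous_endExtend hdY)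
  have hint := fun u v : ℝ => hcont.intervalIntegrable (μ := volume) u v
  -- The ordinary integral is sewn from the same germ with exponent `θ = 2`: replacing `f` by its
  -- left value costs a quadratic error because `f` is Lipschitz, and the area term is quadratic by
  -- assumption.
  have key := hasSewing_of_additive (Ξ := roughTerm XX f f' Y Y')
    (φ := fun p : Param => ∫ η in (0 : ℝ)..p, endExtend f η (endExtend dY η))
    (C := C * C + 9 * (C * (C * C))) (θ := 2) (by norm_num) (fun p q => ?_) a b
  · rwa [intervalIntegral.integral_interval_sub_left (hint _ _) (hint _ _)] at key
  · rw [intervalIntegral.integral_interval_sub_left (hint _ _) (hint _ _), Real.rpow_two]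
    have e : f p (Y q - Y p) = ∫ η in (p : ℝ)..q, f p (endExtend dY η) := by
      rw [← hY.integral hdY]
      exact ((f p).intervalIntegral_comp_comm
        ((continuous_endExtend hdY).intervalIntegrable _ _)).symm
    have h1 : ‖(∫ η in (p : ℝ)..q, endExtend f η (endExtend dY η)) - f p (Y q - Y p)‖
        ≤ C * C * dist p q ^ 2 := by
      have hi : IntervalIntegrable (fun η => f p (endExtend dY η)) volume p q :=
        ((f p).continuous.comp (continuous_endExtend hdY)).intervalIntegrable _ _
      rw [e, ← intervalIntegral.integral_sub (hint _ _) hi, dist_param]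
      refine norm_integral_le_sq (mul_nonneg hC hC) fun η => ?_
      rw [← sub_apply]
      refine (ContinuousLinearMap.le_of_opNorm_le_of_le _ ((hfc _ _).trans
        (mul_le_mul_of_nonneg_left (dist_projIcc_le p η) hC)) (hdYC _)).trans (le_of_eq (by ring))
    have h2 : ‖∑ k, ∑ l, XX p q k l • f' p (stdVec k) (Y' p (stdVec l))‖
        ≤ 9 * (C * (C * C)) * dist p q ^ 2 := by
      have h3 : ∀ k l, ‖XX p q k l • f' p (stdVec k) (Y' p (stdVec l))‖
          ≤ C * dist p q ^ 2 * (C * C) := fun k l => by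
        rw [norm_smul]
        refine mul_le_mul (hXX _ _ _ _) ?_ (norm_nonneg _) (by positivity)
        have h4 := (f' p).le_of_opNorm_le_of_le (hf' p) (norm_stdVec k).le
        have h5 := (Y' p).le_of_opNorm_le_of_le (hY' p) (norm_stdVec l).le
        have := ContinuousLinearMap.le_of_opNorm_le_of_le _ h4 h5
        simpa using this
      refine (norm_sum_le_of_le _ fun k _ => norm_sum_le_of_le _ fun l _ => h3 k l).trans
        (le_of_eq ?_)
      simp only [Finset.sum_const, Finset.card_univ, Fintype.card_fin, nsmul_eq_mul]
      push_cast
      ring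
    rw [roughTerm, ← sub_sub, add_mul]
    exact (norm_sub_le _ _).trans (add_le_add h1 h2)

/-! ### Geometric lifts of continuously differentiable loops -/

variable {γ : ℝ}

theorem IsGeometricLift.area_le {X : RoughPath γ} (h : IsGeometricLift X) :
    ∃ C, 0 ≤ C ∧ ∀ ξ η k l, |X.area ξ η k l| ≤ C * dist ξ η ^ 2 := by
  obtain ⟨dX, hc, hd, ha⟩ := h
  obtain ⟨L, hL0, hL⟩ := exists_norm_le_of_continuous hc
  refine ⟨L * L, mul_nonneg hL0 hL0, fun ξ η k l => ?_⟩
  rw [ha, dist_param, ← Real.norm_eq_abs]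
  refine norm_integral_le_sq (mul_nonneg hL0 hL0) fun ρ => ?_
  rw [norm_mul]
  have h1 : ‖endExtend X.path ρ k - X.path ξ k‖ ≤ L * |ρ - ξ| :=
    (PiLp.norm_apply_le (endExtend X.path ρ - X.path ξ) k).trans ((hd.norm_sub_le hL _ _).trans
      (mul_le_mul_of_nonneg_left (dist_projIcc_le ξ ρ) hL0))
  have h2 : ‖endExtend dX ρ l‖ ≤ L := (PiLp.norm_apply_le (endExtend dX ρ) l).trans (hL _)
  refine (mul_le_mul h1 h2 (norm_nonneg _) (by positivity)).trans (le_of_eq (by ring))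

/-- A geometric lift is determined by its path. -/
theorem IsGeometricLift.eq_of_path {Z W : RoughPath γ} (hZ : IsGeometricLift Z)
    (hW : IsGeometricLift W) (h : Z.path = W.path) : Z = W := by
  obtain ⟨dZ, -, hd, ha⟩ := hZ
  obtain ⟨dW, -, hd', ha'⟩ := hW
  rw [← h] at hd'
  have e := hd.unique hd'
  refine RoughPath.ext h ?_
  funext ξ η
  ext i j
  rw [ha, ha', h, e]

/-- The velocity of a controlled continuously differentiable loop. -/
theorem isVelocity_of_isDerivOf {A : Vec → Vec →L[ℝ] Vec} {M : ℝ}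
    {A1 : Vec → Vec →L[ℝ] Vec →L[ℝ] Vec}
    (hA : ∀ x, HasFDerivAt A (A1 x) x) (hb : ∀ x, ‖A1 x‖ ≤ M) {X : RoughPath γ}
    (hX : IsGeometricLift X) {Y dY : Param → Vec} (hY : IsDerivOf Y dY) (hdY : Continuous dY)
    {Y' : Param → Vec →L[ℝ] Vec} {S : ℝ} (hY' : ∀ a, ‖Y' a‖ ≤ S) (x : Vec) :
    IsVelocity A X.area Y Y' x (classicalVelocity A Y dY x) := by
  obtain ⟨C₁, h1, hC₁⟩ := hX.area_le
  obtain ⟨L, hL0, hL⟩ := exists_norm_le_of_continuous hdY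
  have hM : 0 ≤ M := (norm_nonneg _).trans (hb 0)
  have hS : 0 ≤ S := (norm_nonneg _).trans (hY' 0)
  set C := C₁ + L + S + M * L + M * S with hC
  have p1 := mul_nonneg hM hL0
  have p2 := mul_nonneg hM hS
  have hC0 : 0 ≤ C := by positivity
  exact hasRoughIntegral_of_isDerivOf (C := C) hC0
    (fun a b k l => (hC₁ a b k l).trans (mul_le_mul_of_nonneg_right (by linarith) (sq_nonneg _)))
    (fun a b => by
      refine (lip_of_hasFDerivAt hA hb _ _).trans ?_
      rw [sub_sub_sub_cancel_left, norm_sub_rev]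
      refine (mul_le_mul_of_nonneg_left (hY.norm_sub_le hL a b) hM).trans ?_
      rw [← mul_assoc]
      exact mul_le_mul_of_nonneg_right (by linarith) dist_nonneg)
    (fun a => by
      rw [norm_neg, (hA _).fderiv]
      refine (ContinuousLinearMap.opNorm_comp_le _ _).trans
        ((mul_le_mul (hb _) (hY' a) (norm_nonneg _) hM).trans (by linarith)))
    hY hdY (fun a => (hL a).trans (by linarith)) (fun a => (hY' a).trans (by linarith)) 0 1

/-- The lift of a continuously differentiable loop is geometric. -/
theorem IsLift.isGeometricLift {X : RoughPath γ} (hX : IsGeometricLift X) {Y dY : Param → Vec}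
    (hY : IsDerivOf Y dY) (hdY : Continuous dY) {Y' : Param → Vec →L[ℝ] Vec} {S : ℝ}
    (hY' : ∀ a, ‖Y' a‖ ≤ S) {Z : RoughPath γ} (hZ : IsLift X Y Y' Z) : IsGeometricLift Z := by
  obtain ⟨C₁, h1, hC₁⟩ := hX.area_le
  obtain ⟨L, hL0, hL⟩ := exists_norm_le_of_continuous hdY
  have hS : 0 ≤ S := (norm_nonneg _).trans (hY' 0)
  refine ⟨dY, hdY, by rw [hZ.1]; exact hY, fun ξ η i j => ?_⟩
  refine HasSewing.unique (hZ.2 ξ η i j) ?_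
  set C := C₁ + L + S with hC
  have hC0 : 0 ≤ C := by positivity
  have key := hasRoughIntegral_of_isDerivOf (C := C) hC0
    (fun a b k l => (hC₁ a b k l).trans (mul_le_mul_of_nonneg_right (by linarith) (sq_nonneg _)))
    (f := fun η => (Y η i - Y ξ i) • (EuclideanSpace.proj j : Vec →L[ℝ] ℝ))
    (f' := fun η => ((EuclideanSpace.proj i : Vec →L[ℝ] ℝ).comp (Y' η)).smulRight
        (EuclideanSpace.proj j : Vec →L[ℝ] ℝ))
    (fun a b => by
      rw [← sub_smul, sub_sub_sub_cancel_right, norm_smul]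
      have h3 : ‖Y b i - Y a i‖ ≤ L * dist a b :=
        (PiLp.norm_apply_le (Y b - Y a) i).trans (hY.norm_sub_le hL a b)
      refine (mul_le_mul h3 (norm_proj_le j) (norm_nonneg _) (by positivity)).trans ?_
      rw [mul_one]
      exact mul_le_mul_of_nonneg_right (by linarith) dist_nonneg)
    (fun a => by
      rw [ContinuousLinearMap.norm_smulRight_apply]
      refine (mul_le_mul ((ContinuousLinearMap.opNorm_comp_le _ _).trans
        (mul_le_mul (norm_proj_le i) (hY' a) (norm_nonneg _) zero_le_one)) (norm_proj_le j)
        (norm_nonneg _) (by positivity)).trans ?_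
      linarith)
    hY hdY (fun a => (hL a).trans (by linarith)) (fun a => (hY' a).trans (by linarith)) ξ η
  rw [hZ.1]
  exact key

/-- `X` is Lipschitz, so `Y - Y'_ξ X` varies near `ξ` by `O(|η - ξ|²)` and has derivative zero
there. -/
theorem isDerivOf_of_norm_le_sq {X dX Y : Param → Vec} {Y' : Param → Vec →L[ℝ] Vec}
    (hX : IsDerivOf X dX) (hc : Continuous dX) {C : ℝ} (hC : 0 ≤ C)
    (h : ∀ ξ η, ‖Y η - Y ξ - Y' ξ (X η - X ξ)‖ ≤ C * ‖X η - X ξ‖ ^ 2) :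
    IsDerivOf Y fun ξ => Y' ξ (dX ξ) := by
  intro ξ
  obtain ⟨L, hL0, hL⟩ := exists_norm_le_of_continuous hc
  have h1 : HasDerivWithinAt (fun η => Y' ξ (endExtend X η)) (Y' ξ (dX ξ)) (Icc 0 1) ξ :=
    (Y' ξ).hasFDerivAt.comp_hasDerivWithinAt (ξ : ℝ) (hX ξ)
  have h2 : HasDerivWithinAt (fun η => endExtend Y η - Y' ξ (endExtend X η)) 0 (Icc 0 1) ξ := by
    rw [hasDerivWithinAt_iff_isLittleO]
    refine Asymptotics.IsBigO.trans_isLittleO (g := fun η : ℝ => ‖η - ξ‖ ^ 2) ?_ ?_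
    · refine Asymptotics.IsBigO.of_bound (C * L ^ 2) (Eventually.of_forall fun η => ?_)
      have h3 := h ξ (projIcc 0 1 zero_le_one η)
      have h4 := (hX.norm_sub_le hL ξ (projIcc 0 1 zero_le_one η)).trans
        (mul_le_mul_of_nonneg_left (dist_projIcc_le ξ η) hL0)
      rw [endExtend_coe, endExtend_coe, smul_zero, sub_zero, norm_pow, norm_norm,
        Real.norm_eq_abs]
      refine (le_of_eq ?_).trans (h3.trans ((mul_le_mul_of_nonneg_left
        (pow_le_pow_left₀ (norm_nonneg _) h4 2) hC).trans (le_of_eq (by ring))))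
      rw [endExtend_apply, endExtend_apply, map_sub]
      congr 1
      abel
    · have : (fun η : ℝ => ‖η - ξ‖ ^ 2) =o[𝓝 (ξ : ℝ)] fun η => η - ξ := by
        have h5 := (Asymptotics.isLittleO_pow_sub_sub (ξ : ℝ) (m := 2) (by norm_num))
        simpa using h5
      exact this.mono nhdsWithin_le_nhds
  have := h2.add h1
  rw [zero_add] at this
  refine this.congr (fun η _ => ?_) ?_ <;> simp

end Curves

/-! ### Evolution of continuously differentiable loops -/

section Classical

/-- A Gronwall estimate for integral equations. -/
theorem norm_le_of_accum {κ E : Type*} [NormedAddCommGroup E] [NormedSpace ℝ E]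
    {q D : κ → ℝ → E} {c : κ → E} {T K d b B : ℝ} (hK : 0 ≤ K) (hd : 0 ≤ d) (hb : 0 ≤ b)
    (hB : 0 ≤ B) (hD : ∀ t ∈ Icc 0 T, ∀ i, Accum (q i) t (D i t - c i)) (hc : ∀ i, ‖c i‖ ≤ d)
    (hDB : ∀ t ∈ Icc 0 T, ∀ i, ‖D i t‖ ≤ B)
    (hq : ∀ s ∈ Icc 0 T, ∀ m, (∀ i, ‖D i s‖ ≤ m) → ∀ i, ‖q i s‖ ≤ b + K * m) :
    ∀ t ∈ Icc 0 T, ∀ i, ‖D i t‖ ≤ Real.exp ((2 * K + 1) * t) * (2 * (d + b)) := by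
  set l := 2 * K + 1 with hl
  have hl0 : 0 < l := by positivity
  -- With `l = 2 * K + 1` a bound `m` improves to `d + b + m / 2`. The fixed point of this map is `2
  -- * (d + b)`, and the crude bound `B` enters only through the vanishing deviation.
  have hiter : ∀ n : ℕ, ∀ t ∈ Icc 0 T, ∀ i,
      ‖D i t‖ ≤ Real.exp (l * t) * (2 * (d + b) + B / 2 ^ n) := by
    intro n
    induction n with
    | zero =>
      intro t ht i
      have he : 1 ≤ Real.exp (l * t) := Real.one_le_exp (mul_nonneg hl0.le ht.1)
      rw [pow_zero, div_one]
      nlinarith [hDB t ht i]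
    | succ n ih =>
      intro t ht i
      set m := 2 * (d + b) + B / 2 ^ n with hm
      have hm0 : 0 ≤ m := by positivity
      have he : 1 ≤ Real.exp (l * t) := Real.one_le_exp (mul_nonneg hl0.le ht.1)
      have h1 := (hD t ht i).norm_le (c := b + K * m) ht.1 (by positivity) hl0 fun s hs => by
        have hsT : s ∈ Icc 0 T := ⟨hs.1, hs.2.trans ht.2⟩
        have hes : 1 ≤ Real.exp (l * s) := Real.one_le_exp (mul_nonneg hl0.le hs.1)
        refine (hq s hsT _ (ih s hsT) i).trans ?_
        nlinarith
      have h2 : (b + K * m) / l ≤ b + m / 2 := by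
        rw [div_le_iff₀ hl0, hl]
        nlinarith [mul_nonneg hb hK]
      have h3 := norm_add_le (D i t - c i) (c i)
      rw [sub_add_cancel] at h3
      have e : 2 * (d + b) + B / 2 ^ (n + 1) = d + (b + m / 2) := by
        rw [hm, pow_succ]; field_simp; ring
      rw [e]
      nlinarith [hc i, mul_le_mul_of_nonneg_right h2 (Real.exp_nonneg (l * t))]
  exact fun t ht i => le_mul_of_forall_add fun n => hiter n t ht i

variable {γ : ℝ} {A : Vec → Vec →L[ℝ] Vec} {T : ℝ}

/-- The remainder of a solution is of second order in the increments of the initial curve. -/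
theorem BddFlow.rem_le_sq (hγ : 1 / 3 < γ) {r M S : ℝ} (hr : 0 ≤ r) (hrS : r ≤ S) {A1 A2 A3}
    (hA : FieldData M A A1 A2 A3) {X : RoughPath γ} (hX : X ∈ roughBall γ r)
    {Y : ℝ → Param → Vec} {Y' : ℝ → Param → Vec →L[ℝ] Vec} (h : BddFlow A S X T Y Y') :
    ∃ C, 0 ≤ C ∧ ∀ t ∈ Icc 0 T, ∀ ξ η, ‖Y t η - Y t ξ - Y' t ξ (X.path η - X.path ξ)‖
      ≤ C * ‖X.path η - X.path ξ‖ ^ 2 := by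
  have hS : 0 ≤ S := hr.trans hrS
  have hM : 0 ≤ M := (norm_nonneg _).trans (hA.b1 0)
  have hγ0 : 0 ≤ γ := by linarith
  set K := velConst γ S * M with hK
  have hK0 : 0 ≤ K := mul_nonneg (velConst_nonneg hγ hS) hM
  have hv := fun s (hs : s ∈ Icc 0 T) =>
    ((h.loopFam hr hrS hX hs).vel hγ le_rfl hS hA (Or.inl rfl)).2.2
  set E := Real.exp ((2 * K + 1) * T) with hE
  have hE0 : 0 < E := Real.exp_pos _
  have hmono : ∀ t ∈ Icc 0 T, Real.exp ((2 * K + 1) * t) ≤ E := fun t ht =>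
    Real.exp_le_exp.2 (mul_le_mul_of_nonneg_left ht.2 (by positivity))
  refine ⟨E * (2 * (K * (2 * E) ^ 2)), by positivity, fun t ht ξ η => ?_⟩
  set x := X.path η - X.path ξ with hx
  -- Gronwall for the increment of `Y`, which starts as the increment of `X` and moves with a
  -- Lipschitz velocity.
  have hinc : ∀ s ∈ Icc 0 T, ‖Y s η - Y s ξ‖ ≤ 2 * E * ‖x‖ := by
    intro s hs
    have := norm_le_of_accum (κ := Unit) (K := K) (d := ‖x‖) (b := 0)
      (B := (2 * S + 1) * S) (c := fun _ => x) (D := fun _ s => Y s η - Y s ξ)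
      (q := fun _ s => vel A X (Y s) (Y' s) (Y s η) - vel A X (Y s) (Y' s) (Y s ξ))
      hK0 (norm_nonneg _) le_rfl (by positivity) (fun t ht _ => by
        rw [hx, sub_sub_sub_comm]; exact (h.path t ht η).sub (h.path t ht ξ))
      (fun _ => le_rfl) (fun t ht _ => by
        refine ((h.bound t ht).norm_increment_le hγ0 (fun ξ η => ?_) ξ η).trans
          (mul_le_of_le_one_right (by positivity) (wt_le_one hγ0 _ _))
        exact (roughBall_bounds hr hX ξ η).1.trans
          (mul_le_mul_of_nonneg_right hrS (wt_nonneg _ _ _)))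
      (fun s hs m hm _ => by
        rw [zero_add]
        exact (lip_of_hasFDerivAt ((hv s hs).hasFDeriv ()) ((hv s hs).bound ()) _ _).trans
          (mul_le_mul_of_nonneg_left (hm ()) hK0)) s hs ()
    refine this.trans ?_
    rw [add_zero]
    nlinarith [mul_le_mul_of_nonneg_right (hmono s hs) (norm_nonneg x)]
  -- Gronwall for the remainder, which starts at zero. Its source is the Taylor remainder of the
  -- velocity, quadratic by `hinc`, plus a term linear in the remainder itself.
  have := norm_le_of_accum (κ := Unit) (K := K) (d := 0) (b := K * (2 * E * ‖x‖) ^ 2)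
    (B := S) (c := fun _ => 0) (D := fun _ s => Y s η - Y s ξ - Y' s ξ x)
    (q := fun _ s => vel A X (Y s) (Y' s) (Y s η) - vel A X (Y s) (Y' s) (Y s ξ)
      - (dvel A X (Y s) (Y' s) (Y s ξ)).comp (Y' s ξ) x)
    hK0 le_rfl (by positivity) hS (fun t ht _ => by rw [sub_zero]; exact h.rem ht ξ η)
    (fun _ => norm_zero.le) (fun t ht _ => ((h.bound t ht).rem ξ η).trans
      (mul_le_of_le_one_right hS (pow_le_one₀ (wt_nonneg _ _ _) (wt_le_one hγ0 _ _))))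
    (fun s hs m hm _ => by
      have h1 := norm_taylor_le ((hv s hs).hasFDeriv ()) ((hv s hs).lip ()) (Y s η) (Y s ξ)
      have h2 := (dvel A X (Y s) (Y' s) (Y s ξ)).le_of_opNorm_le_of_le ((hv s hs).bound () _)
        (hm ())
      refine (le_of_eq ?_).trans ((norm_add_le _ _).trans (add_le_add
        (h1.trans (mul_le_mul_of_nonneg_left (pow_le_pow_left₀ (norm_nonneg _) (hinc s hs) 2) hK0))
        h2))
      congr 1
      rw [map_sub _ (Y s η - Y s ξ), ContinuousLinearMap.comp_apply]
      abel) t ht ()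
  refine this.trans ?_
  rw [zero_add, mul_pow]
  have h3 : 0 ≤ 2 * (K * ((2 * E) ^ 2 * ‖x‖ ^ 2)) := by positivity
  refine (mul_le_mul_of_nonneg_right (hmono t ht) h3).trans (le_of_eq (by ring))

theorem continuousOn_uncurry_of_uniform {E : Type*} [NormedAddCommGroup E] {f : ℝ → Param → E}
    (hc : ∀ t ∈ Icc 0 T, Continuous (f t))
    (hu : ∀ t ∈ Icc 0 T, ∀ ε > 0, ∀ᶠ s in 𝓝[Icc 0 T] t, ∀ ξ, ‖f s ξ - f t ξ‖ ≤ ε) :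
    ContinuousOn (fun p : ℝ × Param => f p.1 p.2) (Icc 0 T ×ˢ univ) := by
  rintro ⟨t, ξ⟩ ⟨ht, -⟩
  rw [ContinuousWithinAt, Metric.tendsto_nhds, nhdsWithin_prod_eq, nhdsWithin_univ]
  intro ε hε
  have h1 := hu t ht (ε / 3) (by positivity)
  have h2 : ∀ᶠ η in 𝓝 ξ, dist (f t η) (f t ξ) < ε / 3 :=
    Metric.tendsto_nhds.1 ((hc t ht).tendsto ξ) _ (by positivity)
  filter_upwards [h1.prod_mk h2] with p hp
  have h3 := hp.1 p.2
  rw [← dist_eq_norm] at h3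
  have := dist_triangle (f p.1 p.2) (f t p.2) (f t ξ)
  have h4 := hp.2
  linarith

/-- Freezing time outside `[0, T]` gives a globally continuous function, to which continuity of
parametric integrals applies. -/
theorem continuous_projIcc_uncurry {E : Type*} [NormedAddCommGroup E] {f : ℝ → Param → E}
    (hT : 0 ≤ T) (hf : ContinuousOn (fun p : ℝ × Param => f p.1 p.2) (Icc 0 T ×ˢ univ)) :
    Continuous fun p : ℝ × Param => f (projIcc 0 T hT p.1) p.2 :=
  hf.comp_continuous (f := fun p : ℝ × Param => ((projIcc 0 T hT p.1 : ℝ), p.2))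
    ((continuous_subtype_val.comp (continuous_projIcc.comp continuous_fst)).prodMk continuous_snd)
    fun p => ⟨(projIcc 0 T hT p.1).2, mem_univ _⟩

theorem continuousOn_classicalVelocity (hA : Continuous A) (hT : 0 ≤ T)
    {f df : ℝ → Param → Vec}
    (hf : ContinuousOn (fun p : ℝ × Param => f p.1 p.2) (Icc 0 T ×ˢ univ))
    (hdf : ContinuousOn (fun p : ℝ × Param => df p.1 p.2) (Icc 0 T ×ˢ univ)) (ξ : Param) :
    ContinuousOn (fun s => classicalVelocity A (f s) (df s) (f s ξ)) (Icc 0 T) := by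
  have h1 := continuous_projIcc_uncurry hT hf
  have h2 := continuous_projIcc_uncurry hT hdf
  have hp : Continuous fun p : ℝ × ℝ => (p.1, projIcc (0 : ℝ) 1 zero_le_one p.2) :=
    continuous_fst.prodMk (continuous_projIcc.comp continuous_snd)
  have hx : Continuous fun p : ℝ × ℝ => (p.1, ξ) := continuous_fst.prodMk continuous_const
  have h3 : Continuous fun s : ℝ => classicalVelocity A (f (projIcc 0 T hT s))
      (df (projIcc 0 T hT s)) (f (projIcc 0 T hT s) ξ) := by
    unfold classicalVelocity
    refine intervalIntegral.continuous_parametric_intervalIntegral_of_continuous' ?_ 0 1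
    exact (hA.comp ((h1.comp hx).sub (h1.comp hp))).clm_apply (h2.comp hp)
  refine h3.continuousOn.congr fun s hs => ?_
  simp only [projIcc_of_mem hT hs]

theorem hasDerivWithinAt_of_accum {E : Type*} [NormedAddCommGroup E] [NormedSpace ℝ E]
    [CompleteSpace E] {D g : ℝ → E} {c : E} (hg : ContinuousOn g (Icc 0 T))
    (h : ∀ t ∈ Icc 0 T, Accum g t (D t - c)) {t : ℝ} (ht : t ∈ Icc 0 T) :
    HasDerivWithinAt D (g t) (Icc 0 T) t := by
  have : Fact (t ∈ Icc 0 T) := ⟨ht⟩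
  have h1 := intervalIntegral.integral_hasDerivWithinAt_right (h t ht).int
    (s := Icc 0 T) (t := Icc 0 T)
    (hg.stronglyMeasurableAtFilter_nhdsWithin measurableSet_Icc t) (hg t ht)
  refine (h1.const_add c).congr (fun s hs => ?_) ?_
  · rw [← (h s hs).eq]; abel
  · rw [← (h t ht).eq]; abel

theorem IsClassicalSolution.congr {x : Param → Vec} {y z : ℝ → Param → Vec} (hT : 0 ≤ T)
    (h : IsClassicalSolution A T x y) (hyz : ∀ t ∈ Icc 0 T, y t = z t) :
    IsClassicalSolution A T x z := by
  obtain ⟨dy, h1, h2, h3, h4⟩ := h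
  refine ⟨dy, h1.congr fun p hp => (congrFun (hyz p.1 hp.1) p.2).symm, h2,
    by rw [← hyz 0 ⟨le_rfl, hT⟩, h3], fun t ht => ?_⟩
  rw [← hyz t ht]
  refine ⟨(h4 t ht).1, (h4 t ht).2.1, fun ξ => ?_⟩
  exact ((h4 t ht).2.2 ξ).congr (fun s hs => by rw [hyz s hs]) (by rw [hyz t ht])

theorem CtrlBound.continuous_der (hγ : 0 < γ) {S : ℝ} {x Y : Param → Vec}
    {Y' : Param → Vec →L[ℝ] Vec} (h : CtrlBound γ S x Y Y') : Continuous Y' :=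
  continuous_of_wt hγ (fun _ => S) fun p q => h.inc p q

/-- Over a continuously differentiable loop solutions are classical, with derivative
`Y'(t)_ξ ∂X_ξ`. -/
theorem IsRoughSolution.classical (hγ : 1 / 3 < γ) {r M : ℝ} (hr : 0 ≤ r) (hT : 0 ≤ T)
    {A1 A2 A3} (hA : FieldData M A A1 A2 A3) {X : RoughPath γ} (hX : X ∈ roughBall γ r)
    (hg : IsGeometricLift X) {Y : ℝ → Param → Vec} {Y' : ℝ → Param → Vec →L[ℝ] Vec}
    (h : IsRoughSolution A X T Y Y') :
    IsClassicalSolution A T X.path Y ∧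
      ∀ t ∈ Icc 0 T, ∀ Z, IsLift X (Y t) (Y' t) Z → IsGeometricLift Z := by
  have hγ0 : 0 < γ := by linarith
  obtain ⟨S₀, hS₀⟩ := h.exists_bound
  set S := max S₀ r
  have hrS : r ≤ S := le_max_right _ _
  have hS : 0 ≤ S := hr.trans hrS
  have hb := h.bddFlow fun t ht => (hS₀ t ht).mono (le_max_left S₀ r)
  obtain ⟨C, hC, hrem⟩ := hb.rem_le_sq hγ hr hrS hA hX
  obtain ⟨dX, hdXc, hdX, harea⟩ := hg
  have hg : IsGeometricLift X := ⟨dX, hdXc, hdX, harea⟩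
  set dy : ℝ → Param → Vec := fun t ξ => Y' t ξ (dX ξ) with hdy
  have hder : ∀ t ∈ Icc 0 T, IsDerivOf (Y t) (dy t) := fun t ht =>
    isDerivOf_of_norm_le_sq hdX hdXc hC (hrem t ht)
  have hY'c : ∀ t ∈ Icc 0 T, Continuous (Y' t) := fun t ht => (hb.bound t ht).continuous_der hγ0
  have hYc : ∀ t ∈ Icc 0 T, Continuous (Y t) := fun t ht => continuous_of_wt hγ0 _
    ((hb.bound t ht).norm_increment_le hγ0.le fun ξ η => (roughBall_bounds hr hX ξ η).1.trans
      (mul_le_mul_of_nonneg_right hrS (wt_nonneg _ _ _)))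
  have hdyc : ∀ t ∈ Icc 0 T, Continuous (dy t) := fun t ht => (hY'c t ht).clm_apply hdXc
  -- The rough velocity is the ordinary integral, so the time integrands are continuous and the
  -- integral equation can be differentiated.
  have hvel : ∀ t ∈ Icc 0 T, ∀ x, vel A X (Y t) (Y' t) x = classicalVelocity A (Y t) (dy t) x :=
    fun t ht x => (isVelocity_of_isDerivOf hA.d0 hA.b1 hg (hder t ht) (hdyc t ht)
      (hb.bound t ht).der x).vel_eq
  have hj : ContinuousOn (fun p : ℝ × Param => Y p.1 p.2) (Icc 0 T ×ˢ univ) :=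
    continuousOn_uncurry_of_uniform hYc fun t ht ε hε => by
      filter_upwards [(h.continuous_curve t ht).eventually_lt_const
        (ENNReal.ofReal_pos.2 hε)] with s hs ξ
      have := ((le_iSup (fun ξ => ENNReal.ofReal ‖(Y s - Y t) ξ‖) ξ).trans le_add_self).trans
        hs.le
      exact (ENNReal.ofReal_le_ofReal_iff hε.le).1 this
  have hj' : ContinuousOn (fun p : ℝ × Param => Y' p.1 p.2) (Icc 0 T ×ˢ univ) :=
    continuousOn_uncurry_of_uniform hY'c fun t ht ε hε => by
      filter_upwards [h.eventually_ctrlBound ht hε] with s hs ξ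
      exact hs.der ξ
  have hjd : ContinuousOn (fun p : ℝ × Param => dy p.1 p.2) (Icc 0 T ×ˢ univ) :=
    hj'.clm_apply (hdXc.comp continuous_snd).continuousOn
  have hAc : Continuous A := continuous_iff_continuousAt.2 fun x => (hA.d0 x).continuousAt
  refine ⟨⟨dy, hj, hjd, funext fun ξ => ?_, fun t ht => ⟨hb.closed t ht, hder t ht, fun ξ => ?_⟩⟩,
    fun t ht Z hZ => hZ.isGeometricLift hg (hder t ht) (hdyc t ht) (hb.bound t ht).der⟩
  · have := (hb.path 0 ⟨le_rfl, hT⟩ ξ).eq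
    rwa [intervalIntegral.integral_same, sub_eq_zero] at this
  · refine hasDerivWithinAt_of_accum (continuousOn_classicalVelocity hAc hT hj hjd ξ)
      (fun t ht => (hb.path t ht ξ).congr ht.1 fun s hs => ?_) ht
    exact hvel s ⟨hs.1, hs.2.trans ht.2⟩ _

/-- The classical velocity depends Lipschitz continuously on the curve in the uniform norm. -/
theorem norm_classicalVelocity_sub_le {M L m : ℝ} {A1 : Vec → Vec →L[ℝ] Vec →L[ℝ] Vec}
    (hA : ∀ x, HasFDerivAt A (A1 x) x) (hA1 : Continuous A1) (hb : ∀ x, ‖A1 x‖ ≤ M)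
    {y dy z dz : Param → Vec} (hy : IsDerivOf y dy) (hdy : Continuous dy) (hz : IsDerivOf z dz)
    (hdz : Continuous dz) (hyL : ∀ ξ, ‖dy ξ‖ ≤ L) (hzL : ∀ ξ, ‖dz ξ‖ ≤ L) (hyc : y 0 = y 1)
    (hzc : z 0 = z 1) (hm : ∀ ξ, ‖y ξ - z ξ‖ ≤ m) (ξ : Param) :
    ‖classicalVelocity A y dy (y ξ) - classicalVelocity A z dz (z ξ)‖ ≤ 3 * M * L * m := by
  have hM : 0 ≤ M := (norm_nonneg _).trans (hb 0)
  have hL : 0 ≤ L := (norm_nonneg _).trans (hyL 0)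
  have hm0 : 0 ≤ m := (norm_nonneg _).trans (hm 0)
  have hAc : Continuous A := continuous_iff_continuousAt.2 fun x => (hA x).continuousAt
  have hcont : ∀ {f df : Param → Vec}, IsDerivOf f df → Continuous (endExtend f) :=
      fun {f df} h => by
    have h0 : ContinuousOn (endExtend f) (Icc 0 1) := fun x hx =>
      (h.hasDerivWithinAt x hx).continuousWithinAt
    have h1 : Continuous f := by
      have := h0.comp_continuous (f := fun ξ : Param => (ξ : ℝ)) continuous_subtype_val
        fun ξ => ξ.2
      exact this.congr fun ξ => endExtend_coe f ξ
    exact continuous_endExtend h1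
  have cy := hcont hy
  have cz := hcont hz
  have cdy := continuous_endExtend hdy
  have cdz := continuous_endExtend hdz
  set D : ℝ → Vec := fun η => endExtend y η - endExtend z η with hD
  have cD : Continuous D := cy.sub cz
  have hDm : ∀ η, ‖D η‖ ≤ m := fun η => hm _
  have c1 : Continuous fun η => A (y ξ - endExtend y η) (endExtend dy η) :=
    (hAc.comp (continuous_const.sub cy)).clm_apply cdy
  have c2 : Continuous fun η => A (z ξ - endExtend z η) (endExtend dz η) :=
    (hAc.comp (continuous_const.sub cz)).clm_apply cdz
  have c3 : Continuous fun η => A (z ξ - endExtend z η) (endExtend dy η - endExtend dz η) :=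
    (hAc.comp (continuous_const.sub cz)).clm_apply (cdy.sub cdz)
  have c4 : Continuous fun η => A1 (z ξ - endExtend z η) (-endExtend dz η) (D η) :=
    ((hA1.comp (continuous_const.sub cz)).clm_apply cdz.neg).clm_apply cD
  -- integration by parts
  have hparts : ∫ η in (0 : ℝ)..1, A (z ξ - endExtend z η) (endExtend dy η - endExtend dz η)
      = -∫ η in (0 : ℝ)..1, A1 (z ξ - endExtend z η) (-endExtend dz η) (D η) := by
    have hd : ∀ η ∈ Icc (0 : ℝ) 1, HasDerivWithinAt (fun η => A (z ξ - endExtend z η) (D η))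
        (A1 (z ξ - endExtend z η) (-endExtend dz η) (D η)
          + A (z ξ - endExtend z η) (endExtend dy η - endExtend dz η)) (Icc 0 1) η := by
      intro η hη
      have e1 : HasDerivWithinAt (fun η => z ξ - endExtend z η) (-endExtend dz η) (Icc 0 1) η :=
        (hz.hasDerivWithinAt η hη).const_sub (z ξ)
      exact ((hA _).comp_hasDerivWithinAt η e1).clm_apply
        ((hy.hasDerivWithinAt η hη).sub (hz.hasDerivWithinAt η hη))
    have h1 := integral_of_hasDerivWithinAt hd (c4.add c3) 0 1
    have e0 : D ((0 : Param) : ℝ) = D ((1 : Param) : ℝ) := by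
      simp only [hD, endExtend_coe, hyc, hzc]
    simp only [endExtend_coe, e0, hzc, sub_self] at h1
    change ∫ η in (0 : ℝ)..1, _ = (0 : Vec) at h1
    rw [intervalIntegral.integral_add (c4.intervalIntegrable _ _) (c3.intervalIntegrable _ _)]
      at h1
    exact eq_neg_of_add_eq_zero_right h1
  -- The difference of derivatives is not controlled by `m`, so it is isolated for the integration
  -- by parts, whose boundary terms cancel for closed curves. The first integral contributes `2 * M
  -- * L * m`, the second `M * L * m`.
  have hsplit : classicalVelocity A y dy (y ξ) - classicalVelocity A z dz (z ξ)
      = (∫ η in (0 : ℝ)..1, (A (y ξ - endExtend y η) - A (z ξ - endExtend z η)) (endExtend dy η))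
        + ∫ η in (0 : ℝ)..1, A (z ξ - endExtend z η) (endExtend dy η - endExtend dz η) := by
    have c5 : Continuous fun η =>
        (A (y ξ - endExtend y η) - A (z ξ - endExtend z η)) (endExtend dy η) :=
      ((hAc.comp (continuous_const.sub cy)).sub (hAc.comp (continuous_const.sub cz))).clm_apply cdy
    rw [classicalVelocity, classicalVelocity, ← intervalIntegral.integral_sub
      (c1.intervalIntegrable _ _) (c2.intervalIntegrable _ _), ← intervalIntegral.integral_add
      (c5.intervalIntegrable _ _) (c3.intervalIntegrable _ _)]
    refine intervalIntegral.integral_congr fun η _ => ?_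
    simp only [sub_apply, map_sub]
    abel
  rw [hsplit, hparts]
  have b1 : ‖∫ η in (0 : ℝ)..1,
      (A (y ξ - endExtend y η) - A (z ξ - endExtend z η)) (endExtend dy η)‖
      ≤ M * (2 * m) * L * |1 - 0| := by
    refine intervalIntegral.norm_integral_le_of_norm_le_const fun η _ => ?_
    refine ContinuousLinearMap.le_of_opNorm_le_of_le _ ((lip_of_hasFDerivAt hA hb _ _).trans
      (mul_le_mul_of_nonneg_left ?_ hM)) (hyL _)
    rw [sub_sub_sub_comm, two_mul]
    exact (norm_sub_le _ _).trans (add_le_add (hm ξ) (hDm η))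
  have b2 : ‖∫ η in (0 : ℝ)..1, A1 (z ξ - endExtend z η) (-endExtend dz η) (D η)‖
      ≤ M * L * m * |1 - 0| := by
    refine intervalIntegral.norm_integral_le_of_norm_le_const fun η _ => ?_
    refine ContinuousLinearMap.le_of_opNorm_le_of_le _
      (ContinuousLinearMap.le_of_opNorm_le_of_le _ (hb _) ?_) (hDm η)
    rw [norm_neg]; exact hzL _
  rw [sub_zero, abs_one, mul_one] at b1 b2
  refine (norm_add_le _ _).trans ?_
  rw [norm_neg]
  linarith

/-- Classical solutions are unique. -/
theorem IsClassicalSolution.unique {M : ℝ} (hT : 0 ≤ T) {A1 : Vec → Vec →L[ℝ] Vec →L[ℝ] Vec}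
    (hA : ∀ x, HasFDerivAt A (A1 x) x) (hA1 : Continuous A1) (hb : ∀ x, ‖A1 x‖ ≤ M)
    {x : Param → Vec} {y z : ℝ → Param → Vec} (hy : IsClassicalSolution A T x y)
    (hz : IsClassicalSolution A T x z) : ∀ t ∈ Icc 0 T, y t = z t := by
  obtain ⟨dy, y1, y2, y3, y4⟩ := hy
  obtain ⟨dz, z1, z2, z3, z4⟩ := hz
  have hM : 0 ≤ M := (norm_nonneg _).trans (hb 0)
  have hAc : Continuous A := continuous_iff_continuousAt.2 fun x => (hA x).continuousAt
  have hbdd : ∀ {f : ℝ → Param → Vec},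
      ContinuousOn (fun p : ℝ × Param => f p.1 p.2) (Icc 0 T ×ˢ univ) →
      ∃ C, ∀ t ∈ Icc 0 T, ∀ ξ, ‖f t ξ‖ ≤ C := fun {f} hf => by
    obtain ⟨C, hC⟩ := (isCompact_Icc.prod isCompact_univ).exists_bound_of_continuousOn hf
    exact ⟨C, fun t ht ξ => hC (t, ξ) ⟨ht, mem_univ _⟩⟩
  have hslice : ∀ {f : ℝ → Param → Vec},
      ContinuousOn (fun p : ℝ × Param => f p.1 p.2) (Icc 0 T ×ˢ univ) →
      ∀ t ∈ Icc 0 T, Continuous (f t) := fun {f} hf t ht =>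
    hf.comp_continuous (f := fun ξ : Param => (t, ξ)) (by fun_prop) fun ξ => ⟨ht, mem_univ _⟩
  obtain ⟨L₁, hL₁⟩ := hbdd y2
  obtain ⟨L₂, hL₂⟩ := hbdd z2
  obtain ⟨B, hB⟩ := hbdd (f := fun t ξ => y t ξ - z t ξ) (y1.sub z1)
  have h0 : (0 : ℝ) ∈ Icc 0 T := ⟨le_rfl, hT⟩
  set L := max L₁ L₂
  have hL : 0 ≤ L := ((norm_nonneg _).trans (hL₁ 0 h0 0)).trans (le_max_left _ _)
  have hB0 : 0 ≤ B := (norm_nonneg _).trans (hB 0 h0 0)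
  -- The index runs over all parameters because the velocity estimate needs the uniform distance.
  -- With zero initial difference and zero source the bound is zero.
  have key := norm_le_of_accum (κ := Param) (T := T) (K := 3 * M * L) (d := 0) (b := 0) (B := B)
    (c := fun _ => 0) (D := fun ξ t => y t ξ - z t ξ)
    (q := fun ξ t => classicalVelocity A (y t) (dy t) (y t ξ)
      - classicalVelocity A (z t) (dz t) (z t ξ)) (by positivity) le_rfl le_rfl hB0
    (fun t ht ξ => by
      have a1 := integral_eq_of_hasDerivWithinAt (fun t ht => (y4 t ht).2.2 ξ)
        (continuousOn_classicalVelocity hAc hT y1 y2 ξ) ht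
      have a2 := integral_eq_of_hasDerivWithinAt (fun t ht => (z4 t ht).2.2 ξ)
        (continuousOn_classicalVelocity hAc hT z1 z2 ξ) ht
      have b1 : Accum (fun t => classicalVelocity A (y t) (dy t) (y t ξ)) t (y t ξ - y 0 ξ) :=
        ⟨a1.1, by rw [a1.2]; abel⟩
      have b2 : Accum (fun t => classicalVelocity A (z t) (dz t) (z t ξ)) t (z t ξ - z 0 ξ) :=
        ⟨a2.1, by rw [a2.2]; abel⟩
      have := b1.sub b2
      rwa [sub_sub_sub_comm, y3, z3, sub_self] at this)
    (fun _ => norm_zero.le) (fun t ht ξ => hB t ht ξ) fun t ht m hm ξ => by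
      rw [zero_add]
      exact norm_classicalVelocity_sub_le hA hA1 hb (y4 t ht).2.1 (hslice y2 t ht) (z4 t ht).2.1
        (hslice z2 t ht) (fun ξ => (hL₁ t ht ξ).trans (le_max_left _ _))
        (fun ξ => (hL₂ t ht ξ).trans (le_max_right _ _)) (y4 t ht).1 (z4 t ht).1 hm ξ
  intro t ht
  funext ξ
  have := key t ht ξ
  rw [add_zero, mul_zero, mul_zero, norm_le_zero_iff, sub_eq_zero] at this
  exact this

end Classical

/-! ### Properties of the solution map -/

section Main

variable {γ r T : ℝ} {A : Vec → Vec →L[ℝ] Vec} {N B : ℝ≥0}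

/-- The components of the lifted solution from `X`, bounded by `S`. -/
def SolvedBy (A : Vec → Vec →L[ℝ] Vec) (T S : ℝ) (X : RoughPath γ) (Z : ℝ → RoughPath γ)
    (Y : ℝ → Param → Vec) (Y' : ℝ → Param → Vec →L[ℝ] Vec) : Prop :=
  IsRoughSolution A X T Y Y' ∧ (∀ t ∈ Icc 0 T, CtrlBound γ S X.path (Y t) (Y' t)) ∧
    ∀ t ∈ Icc 0 T, IsLift X (Y t) (Y' t) (Z t)

theorem exists_fieldData (hA : ContDiff ℝ 5 A) (h4 : gradNorm A 4 ≤ N) :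
    ∃ A1 A2 A3, FieldData (N : ℝ) A A1 A2 A3 ∧ TwoLip (N : ℝ) A3 := by
  have b4 : ∀ k < 5, ∀ x, ‖iteratedFDeriv ℝ (k + 1) A x‖ ≤ N := fun k hk x =>
    norm_iteratedFDeriv_le_of_gradNorm h4 hk x
  exact ⟨_, _, _, fieldData_of_contDiff hA fun k hk x => b4 k (by omega) x,
    twoLip_of_contDiff hA b4⟩

theorem mem_roughBall_of_tendsto {X : RoughPath γ} (hX : X ∈ roughBall γ r)
    {Xn : ℕ → RoughPath γ} (h : Tendsto (fun n => roughDist (Xn n) X) atTop (𝓝 0)) :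
    ∀ᶠ n in atTop, Xn n ∈ roughBall γ r := by
  have h1 : Tendsto (fun n => roughDist (Xn n) X + roughDist X (RoughPath.trivial γ)) atTop
      (𝓝 (0 + roughDist X (RoughPath.trivial γ))) := h.add tendsto_const_nhds
  rw [zero_add] at h1
  filter_upwards [h1.eventually_lt_const hX] with n hn
  exact (roughDist_triangle _ _ _).trans_lt hn

theorem uniformDist_congr {Y Y' Z Z' : ℝ → RoughPath γ} (h : ∀ t ∈ Icc 0 T, Y t = Y' t)
    (h' : ∀ t ∈ Icc 0 T, Z t = Z' t) : uniformDist T Y Z = uniformDist T Y' Z' :=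
  iSup_congr fun t => iSup_congr fun ht => by rw [h t ht, h' t ht]

/-- A common bound for the sizes of the data and of the solutions. -/
def sizeBound (r : ℝ) (B : ℝ≥0) : ℝ := max (B : ℝ) (max r 1)

theorem SolvedBy.uniformDist_le (hγ : 1 / 3 < γ) (hr : 0 ≤ r) (hT : 0 ≤ T)
    (hA : ContDiff ℝ 5 A) (h4 : gradNorm A 4 ≤ N) {X : Bool → RoughPath γ}
    (hX : ∀ b, X b ∈ roughBall γ r) {Z : Bool → ℝ → RoughPath γ} {Y : Bool → ℝ → Param → Vec}
    {Y' : Bool → ℝ → Param → Vec →L[ℝ] Vec}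
    (h : ∀ b, SolvedBy A T B (X b) (Z b) (Y b) (Y' b)) :
    uniformDist T (Z false) (Z true)
      ≤ (stabConst γ (sizeBound r B) N T).toNNReal * roughDist (X false) (X true) := by
  obtain ⟨A1, A2, A3, hF, h2⟩ := exists_fieldData hA h4
  exact BddFlow.uniformDist_le hγ hr (show r ≤ sizeBound r B from
      (le_max_left _ _).trans (le_max_right _ _))
    (show 1 ≤ sizeBound r B from (le_max_right _ _).trans (le_max_right _ _)) hT hF h2 hX
    (fun b => (h b).1.bddFlow fun t ht => ((h b).2.1 t ht).mono (le_max_left _ _))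
    fun b => (h b).2.2

theorem IsRoughSolution.eq_of_gradNorm (hγ : 1 / 3 < γ) (hr : 0 ≤ r) (hA : ContDiff ℝ 5 A)
    (h4 : gradNorm A 4 ≤ N) {X : RoughPath γ} (hX : X ∈ roughBall γ r)
    {Y Z : ℝ → Param → Vec} {Y' Z' : ℝ → Param → Vec →L[ℝ] Vec}
    (hY : IsRoughSolution A X T Y Y') (hZ : IsRoughSolution A X T Z Z') :
    ∀ t ∈ Icc 0 T, Y t = Z t ∧ Y' t = Z' t := by
  obtain ⟨A1, A2, A3, hF, h2⟩ := exists_fieldData hA h4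
  exact IsRoughSolution.unique hγ hr hF h2 hX hY hZ

theorem SolvedBy.classical (hγ : 1 / 3 < γ) (hr : 0 ≤ r) (hT : 0 ≤ T) (hA : ContDiff ℝ 5 A)
    (h4 : gradNorm A 4 ≤ N) {X : RoughPath γ} (hX : X ∈ roughBall γ r) (hg : IsGeometricLift X)
    {S : ℝ} {Z : ℝ → RoughPath γ} {Y : ℝ → Param → Vec} {Y' : ℝ → Param → Vec →L[ℝ] Vec}
    (h : SolvedBy A T S X Z Y Y') :
    IsClassicalSolution A T X.path (fun t => (Z t).path) ∧
      (∀ t ∈ Icc 0 T, IsGeometricLift (Z t)) ∧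
      ∀ y : ℝ → Param → Vec, IsClassicalSolution A T X.path y →
        ∀ t ∈ Icc 0 T, y t = (Z t).path := by
  obtain ⟨A1, A2, A3, hF, h2⟩ := exists_fieldData hA h4
  obtain ⟨h1, h3⟩ := h.1.classical hγ hr hT hF hX hg
  have hc : IsClassicalSolution A T X.path (fun t => (Z t).path) :=
    h1.congr hT fun t ht => (h.2.2 t ht).1.symm
  refine ⟨hc, fun t ht => h3 t ht _ (h.2.2 t ht), fun y hy => ?_⟩
  exact IsClassicalSolution.unique hT hF.d0
    (continuous_iff_continuousAt.2 fun x => (hF.d1 x).continuousAt) hF.b1 hy hc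

end Main

end VortexFilament

end

/-! ### The main theorem -/

open VortexFilament
theorem mainTheorem3 (γ : ℝ) (hγ : 1 / 3 < γ) (r : ℝ) (hr : 0 < r) :
    -- a common existence time, depending only on `γ`, `r` and a bound for `‖∇A‖_3`
    (∀ M : ℝ≥0, ∃ T₀ : ℝ, 0 < T₀ ∧ ∃ B : ℝ≥0, ∀ A : Vec → Vec →L[ℝ] Vec,
      ContDiff ℝ 5 A → gradNorm A 4 < ⊤ → gradNorm A 3 ≤ M → IsExistenceTime γ r A T₀ B) ∧
    -- the solution map on any such time interval
    (∀ T : ℝ, 0 < T → ∀ B N : ℝ≥0, ∃ L : ℝ≥0, ∀ A : Vec → Vec →L[ℝ] Vec,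
      ContDiff ℝ 5 A → gradNorm A 4 ≤ N → IsExistenceTime γ r A T B →
      ∃ Γ : RoughPath γ → ℝ → RoughPath γ,
        -- `Γ X` is the unique solution with its area, and is continuous in time
        (∀ X ∈ roughBall γ r,
          IsLiftedSolution A X T (Γ X) ∧
          IsContinuousCurve T (Γ X) ∧
          (∀ (Y Z : ℝ → Param → Vec) (Y' Z' : ℝ → Param → Vec →L[ℝ] Vec),
            IsRoughSolution A X T Y Y' → IsRoughSolution A X T Z Z' →
              ∀ t ∈ Icc 0 T, Y t = Z t ∧ Y' t = Z' t) ∧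
          (∀ W : ℝ → RoughPath γ, IsLiftedSolution A X T W → ∀ t ∈ Icc 0 T, W t = Γ X t)) ∧
        -- `Γ` is Lipschitz for the uniform distance
        (∀ X ∈ roughBall γ r, ∀ Z ∈ roughBall γ r,
          uniformDist T (Γ X) (Γ Z) ≤ L * roughDist X Z) ∧
        -- for smooth loops the solution is the unique classical one, geometrically lifted
        (∀ X ∈ roughBall γ r, IsGeometricLift X →
          IsClassicalSolution A T X.path (fun t => (Γ X t).path) ∧
          (∀ t ∈ Icc 0 T, IsGeometricLift (Γ X t)) ∧
          (∀ y : ℝ → Param → Vec, IsClassicalSolution A T X.path y →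
            ∀ t ∈ Icc 0 T, y t = (Γ X t).path)) ∧
        -- lifted classical solutions from smooth approximations converge to the rough solution
        (∀ X ∈ roughBall γ r, ∀ Xn : ℕ → RoughPath γ, (∀ n, IsGeometricLift (Xn n)) →
          Tendsto (fun n => roughDist (Xn n) X) atTop (𝓝 0) →
          ∀ Yn : ℕ → ℝ → RoughPath γ,
            (∀ᶠ n in atTop, IsClassicalSolution A T (Xn n).path (fun t => (Yn n t).path) ∧
              ∀ t ∈ Icc 0 T, IsGeometricLift (Yn n t)) →
            Tendsto (fun n => uniformDist T (Yn n) (Γ X)) atTop (𝓝 0))) := by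
  refine ⟨exists_existenceTime hγ hr, fun T hT B N =>
    ⟨(stabConst γ (sizeBound r B) N T).toNNReal, fun A hA h4 hE => ?_⟩⟩
  obtain ⟨Γ, hΓ⟩ := exists_solutionMap hγ hr.le hE
  have huniq : ∀ X ∈ roughBall γ r, ∀ (Y Z : ℝ → Param → Vec) (Y' Z' : ℝ → Param → Vec →L[ℝ] Vec),
      IsRoughSolution A X T Y Y' → IsRoughSolution A X T Z Z' →
        ∀ t ∈ Icc 0 T, Y t = Z t ∧ Y' t = Z' t := fun X hX _ _ _ _ hY hZ =>
    hY.eq_of_gradNorm hγ hr.le hA h4 hX hZ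
  have hlip : ∀ X ∈ roughBall γ r, ∀ Z ∈ roughBall γ r, uniformDist T (Γ X) (Γ Z)
      ≤ (stabConst γ (sizeBound r B) N T).toNNReal * roughDist X Z := by
    intro X hX Z hZ
    obtain ⟨Y, Y', hY⟩ := hΓ X hX
    obtain ⟨W, W', hW⟩ := hΓ Z hZ
    exact SolvedBy.uniformDist_le hγ hr.le hT.le hA h4 (X := fun b => bif b then Z else X)
      (fun b => by cases b; exacts [hX, hZ]) (Z := fun b => bif b then Γ Z else Γ X)
      (Y := fun b => bif b then W else Y) (Y' := fun b => bif b then W' else Y')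
      fun b => by cases b; exacts [hY, hW]
  have hclass := fun (X : RoughPath γ) (hX : X ∈ roughBall γ r) (hg : IsGeometricLift X) =>
    SolvedBy.classical hγ hr.le hT.le hA h4 hX hg (hΓ X hX).choose_spec.choose_spec
  refine ⟨Γ, fun X hX => ?_, hlip, hclass, fun X hX Xn hg hlim Yn hYn => ?_⟩
  · obtain ⟨Y, Y', hY, hB, hl⟩ := hΓ X hX
    refine ⟨⟨Y, Y', hY, hl⟩, IsLift.isContinuousCurve hγ hr.le hX hY hl, huniq X hX, ?_⟩
    rintro W ⟨Z, Z', hZ, hW⟩ t ht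
    have h1 := huniq X hX _ _ _ _ hZ hY t ht
    have h2 := hW t ht
    rw [h1.1, h1.2] at h2
    exact h2.unique (hl t ht)
  · have h1 : Tendsto (fun n => ((stabConst γ (sizeBound r B) N T).toNNReal : ℝ≥0∞)
        * roughDist (Xn n) X) atTop (𝓝 0) := by
      have := ENNReal.Tendsto.const_mul (a := ((stabConst γ (sizeBound r B) N T).toNNReal : ℝ≥0∞))
        hlim (Or.inr ENNReal.coe_ne_top)
      rwa [mul_zero] at this
    refine tendsto_of_tendsto_of_tendsto_of_le_of_le' tendsto_const_nhds h1
      (Eventually.of_forall fun _ => zero_le) ?_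
    filter_upwards [hYn, mem_roughBall_of_tendsto hX hlim] with n hn hb
    obtain ⟨-, hgn, hun⟩ := hclass (Xn n) hb (hg n)
    -- By uniqueness the classical solution is the path of `Γ (Xn n)`, and a geometric lift is
    -- determined by its path. So `Yn n` agrees with `Γ (Xn n)` on `[0, T]`, and the Lipschitz
    -- estimate concludes.
    rw [uniformDist_congr (Y' := Γ (Xn n)) (fun t ht =>
      (hn.2 t ht).eq_of_path (hgn t ht) (hun _ hn.1 t ht)) fun _ _ => rfl]
    exact hlip _ hb _ hX
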